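/- **Setting.** Let $n\in\mathbb N$, $s>1$ and $1\le p,q<\infty$. The Gelfand–Shilov space $\mathcal S_s(\mathbb R^n)$ consists of all $f\in C^\infty(\mathbb R^n)$ for which there are $h,C>0$ with $\sup_x|x^\alpha\partial^\beta f(x)|\le C\,h^{|\alpha|+|\beta|}(\alpha!\,\beta!)^s$ for all multi-indices $\alpha,\beta$; the dual space $\mathcal S_s'(\mathbb R^n)$ consists of the linear functionals on $\mathcal S_s(\mathbb R^n)$ that, for every $h>0$, are bounded with respect to the best constant $C$ in this estimate (functions $f$ are identified with the functionals $\psi\mapsto\int f\psi$). Fix a function $\rho\in\mathcal S_s(\mathbb R^n)$ with values in $[0,1]$, supported in the cube $[-1,1]^n$, equal to $1$ for $|\xi|\le\frac12$, and whose translates $\rho(\cdot-k)$, $k\in\mathbb Z^n$, have no common zero. Put $$\sigma_k(\xi)=\frac{\rho(\xi-k)}{\sum_{l\in\mathbb Z^n}\rho(\xi-l)},\qquad \Box_k f=\mathcal F^{-1}(\sigma_k\,\mathcal F f),\qquad k\in\mathbb Z^n .$$ The Gevrey-modulation space $\mathcal{GM}^{p,q}_s=\mathcal{GM}^{p,q}_s(\mathbb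 R^n)$ is the set of all $f\in\mathcal S_s'(\mathbb R^n)$ with $$\|f\|_{\mathcal{GM}^{p,q}_s}=\Big(\sum_{k\in\mathbb Z^n}e^{q|k|^{1/s}}\,\|\Box_k f\|_{L^p}^q\Big)^{1/q}<\infty .$$ **Lemma.** There are constants $b,c>0$ (which may depend on $n,s,p,q$ and $\rho$) such that for every real-valued function $u\in\mathcal{GM}^{p,q}_s$ one has $e^{iu}-1\in\mathcal{GM}^{p,q}_s$ and $$\|e^{iu}-1\|_{\mathcal{GM}^{p,q}_s}\le c\begin{cases}\exp\big(b\,\|u\|_{\mathcal{GM}^{p,q}_s}^{1/s}\,\log\|u\|_{\mathcal{GM}^{p,q}_s}\big)&\text{if }\|u\|_{\mathcal{GM}^{p,q}_s}>1,\\[2pt] \|u\|_{\mathcal{GM}^{p,q}_s}&\text{if }\|u\|_{\mathcal{GM}^{p,q}_s}\le1.\end{cases}$$ -/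

import Mathlib

open scoped ContDiff

noncomputable section

namespace GevreyModulation

/-- The lattice point `k ∈ ℤⁿ`, viewed in Euclidean space `ℝⁿ`. -/
def latticePoint {n : ℕ} (k : Fin n → ℤ) : EuclideanSpace ℝ (Fin n) :=
  WithLp.toLp 2 (fun i => (k i : ℝ))

/-- The Gelfand-Shilov estimate with parameters `s`, `h` and constant `C`:
`|x|^a |D^b f(x)| ≤ C h^(a+b) (a! b!)^s` for all orders `a`, `b` and all `x`.
As usual for Schwartz functions, all monomials of degree `a` and all partial derivatives of order
`b` are collected in the norms; because of `α! ≤ |α|! ≤ n^|α| α!` this agrees with the multi-index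
version up to replacing `h` by a fixed multiple of `h`, so the union over `h` (the Gelfand-Shilov
space) and the intersection over `h` of the dual spaces are unaffected. -/
def GelfandShilovBound {n : ℕ} {F : Type*} [NormedAddCommGroup F] [NormedSpace ℝ F]
    (s h C : ℝ) (f : EuclideanSpace ℝ (Fin n) → F) : Prop :=
  ∀ (a b : ℕ) (x : EuclideanSpace ℝ (Fin n)),
    ‖x‖ ^ a * ‖iteratedFDeriv ℝ b f x‖ ≤
      C * h ^ (a + b) * ((a.factorial : ℝ) * (b.factorial : ℝ)) ^ s

/-- The Gelfand-Shilov space `𝒮_s(ℝⁿ) = ⋃_{h > 0} 𝒮_{s,h}(ℝⁿ)`. -/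
def MemGelfandShilov {n : ℕ} {F : Type*} [NormedAddCommGroup F] [NormedSpace ℝ F]
    (s : ℝ) (f : EuclideanSpace ℝ (Fin n) → F) : Prop :=
  ContDiff ℝ ∞ f ∧ ∃ h : ℝ, 0 < h ∧ ∃ C : ℝ, GelfandShilovBound s h C f

/-- The function `f` belongs to the Gelfand-Shilov distribution space
`𝒮_s'(ℝⁿ) = ⋂_{h > 0} 𝒮_{s,h}'(ℝⁿ)`: the functional `ψ ↦ ∫ f ψ` is defined on `𝒮_s(ℝⁿ)` and it is
bounded on every normed space `𝒮_{s,h}(ℝⁿ)`. -/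
def MemGelfandShilovDual {n : ℕ} (s : ℝ) (f : EuclideanSpace ℝ (Fin n) → ℂ) : Prop :=
  (∀ ψ : EuclideanSpace ℝ (Fin n) → ℂ, MemGelfandShilov s ψ →
      MeasureTheory.Integrable (fun x => f x * ψ x)) ∧
  ∀ h : ℝ, 0 < h → ∃ A : ℝ, ∀ (ψ : EuclideanSpace ℝ (Fin n) → ℂ) (C : ℝ),
    ContDiff ℝ ∞ ψ → GelfandShilovBound s h C ψ → ‖∫ x, f x * ψ x‖ ≤ A * C

/-- `ρ` generates a frequency-uniform decomposition: `ρ ∈ 𝒮_s(ℝⁿ)` takes values in `[0,1]`, is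
supported in the cube `[-1,1]ⁿ`, equals `1` on `|ξ| ≤ 1/2`, and its integer translates have no
common zero (so that one may divide by their sum). -/
structure GeneratesDecomposition {n : ℕ} (s : ℝ) (ρ : EuclideanSpace ℝ (Fin n) → ℝ) : Prop where
  memGelfandShilov : MemGelfandShilov s ρ
  mem_Icc : ∀ ξ, ρ ξ ∈ Set.Icc (0 : ℝ) 1
  support_subset : Function.support ρ ⊆ {ξ | ∀ i, ξ i ∈ Set.Icc (-1 : ℝ) 1}
  eq_one : ∀ ξ, ‖ξ‖ ≤ 1 / 2 → ρ ξ = 1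
  cover : ∀ ξ, ∃ k : Fin n → ℤ, ρ (ξ - latticePoint k) ≠ 0

/-- `σ_k(ξ) = ρ(ξ - k) / ∑_l ρ(ξ - l)`; for each `ξ` only finitely many summands are nonzero. -/
def decomp {n : ℕ} (ρ : EuclideanSpace ℝ (Fin n) → ℝ) (k : Fin n → ℤ)
    (ξ : EuclideanSpace ℝ (Fin n)) : ℝ :=
  ρ (ξ - latticePoint k) / ∑' l : Fin n → ℤ, ρ (ξ - latticePoint l)

/-- The convolution kernel `z ↦ (2π)⁻ⁿ ∫ σ_k(ξ) e^{i z·ξ} dξ` of the operator `□_k`. -/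
def boxKernel {n : ℕ} (ρ : EuclideanSpace ℝ (Fin n) → ℝ) (k : Fin n → ℤ)
    (z : EuclideanSpace ℝ (Fin n)) : ℂ :=
  (((2 * Real.pi) ^ n)⁻¹ : ℝ) *
    ∫ ξ : EuclideanSpace ℝ (Fin n),
      (decomp ρ k ξ : ℂ) * Complex.exp (Complex.I * (inner ℝ z ξ : ℝ))

/-- The uniform decomposition operator `□_k f = 𝓕⁻¹ (σ_k 𝓕 f)`. Since `σ_k` has compact support,
this is the function `x ↦ (2π)^(-n/2) ⟨𝓕 f, σ_k e^{i x·}⟩ = (2π)^(-n/2) ⟨f, 𝓕 (σ_k e^{i x·})⟩`,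
that is, the convolution of `f` with the kernel above. -/
def box {n : ℕ} (ρ : EuclideanSpace ℝ (Fin n) → ℝ) (k : Fin n → ℤ)
    (f : EuclideanSpace ℝ (Fin n) → ℂ) (x : EuclideanSpace ℝ (Fin n)) : ℂ :=
  ∫ y : EuclideanSpace ℝ (Fin n), f y * boxKernel ρ k (x - y)

/-- `(∑_k e^{q |k|^{1/s}} ‖□_k f‖_{L^p}^q)^{1/q}`, as an element of `[0,∞]`. -/
def gmENorm {n : ℕ} (s p q : ℝ) (ρ : EuclideanSpace ℝ (Fin n) → ℝ)
    (f : EuclideanSpace ℝ (Fin n) → ℂ) : ENNReal :=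
  (∑' k : Fin n → ℤ,
    ENNReal.ofReal (Real.exp (q * ‖latticePoint k‖ ^ (1 / s))) *
      MeasureTheory.eLpNorm (box ρ k f) (ENNReal.ofReal p) MeasureTheory.volume ^ q) ^ (1 / q)

/-- The Gevrey-modulation norm as a real number, for functions in the Gevrey-modulation space. -/
def gmNorm {n : ℕ} (s p q : ℝ) (ρ : EuclideanSpace ℝ (Fin n) → ℝ)
    (f : EuclideanSpace ℝ (Fin n) → ℂ) : ℝ :=
  (gmENorm s p q ρ f).toReal

/-- `f ∈ 𝒢ℳ^{p,q}_s(ℝⁿ)` (for `p`, `q` finite): `f ∈ 𝒮_s'(ℝⁿ)` and its norm is finite. -/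
def MemGM {n : ℕ} (s p q : ℝ) (ρ : EuclideanSpace ℝ (Fin n) → ℝ)
    (f : EuclideanSpace ℝ (Fin n) → ℂ) : Prop :=
  MemGelfandShilovDual s f ∧ gmENorm s p q ρ f < ⊤

end GevreyModulation

end

noncomputable section

namespace GevreyModulation

/-! ### Gevrey estimates for quotients on the line -/

/-! Let N be the norm of u and X a number with X ≥ max(N, 2). The function is split as u = v + f at
a frequency R with R^(1/s) proportional to log X, and the two parts are treated by different means.

High frequencies. For y ≤ x one has (x + y)^(1/s) ≤ x^(1/s) + y^(1/s)/s. Hence a product costs the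
full weight on one factor only, and the smaller weight exp(|k|^(1/s)/s) on the other
(`weight_add_le`, `familyNorm_familyMul_le`). In the ℓ¹ norm with the smaller weight, f has size at
most a constant times N exp(-β R^(1/s)) with β = (1 - 1/s)/2, which is O(1) by the choice of R. So
the exponential series of f converges, and e^{if} - 1 has norm O(N).

Low frequencies. The function v is real, bounded by O(N), and has its spectrum in a cube of size
about R. A function with spectrum in a cube of size P has modulation norm at most C exp(B
(P+1)^(1/s)) times its L^p norm (`HasSpectrumIn.gmENorm_le`). Terms of degree l ≥ e³ sup|v| in the
series of e^{iv} are at most e^{-2l}, which beats the subexponential cost of their spectrum. The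
first L ~ X terms are not estimated one by one: their sum differs from e^{iv} by a small tail and is
bounded by 2, because |e^{iv}| = 1, while its spectrum has size L R. This costs exp(b X^(1/s) log X)
(`norm_expBlock_le`, `exists_blockSize_mul_exp_le`). It is here that u being real brings the
exponent down from N to N^(1/s) log N.

With G_j the blocks of e^{iv}, the two halves combine through e^{iu} - 1 = Σ_j (G_j - δ_j) + Σ_j G_j
(e^{if} - 1), where δ_0 = 1 and δ_j = 0 otherwise. A factor |v| kept in the bounds for G_j - δ_j,
and the O(N) bound for e^{if} - 1, make the estimate linear for small N.

The groundwork: the window is a Gevrey function, so the kernels of the □_k decay like stretched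
exponentials (`exists_norm_boxKernel_zero_le`); functions in the dual space are integrable against
such decay; hence the blocks □_k u are honest convolutions and sum up to u almost everywhere
(`ae_eq_tsum_box`). Spectra are defined by duality with integrable functions, which avoids
distributions altogether. -/

lemma choose_mul_factorial_rpow_le {s : ℝ} (hs : 1 ≤ s) {b j : ℕ} (hj : j ≤ b) :
    (b.choose j : ℝ) * ((j.factorial : ℝ) ^ s * ((b - j).factorial : ℝ) ^ s) ≤
      (b.factorial : ℝ) ^ s := by
  have h1 : (1 : ℝ) ≤ (b.choose j : ℝ) := by exact_mod_cast Nat.choose_pos hj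
  have h2 : (b.choose j : ℝ) ≤ (b.choose j : ℝ) ^ s := by
    simpa using Real.rpow_le_rpow_of_exponent_le h1 hs
  have h3 : (b.factorial : ℝ) = (b.choose j : ℝ) * ((j.factorial : ℝ) * ((b - j).factorial : ℝ)) := by
    have := Nat.choose_mul_factorial_mul_factorial hj
    rw [← this]; push_cast; ring
  rw [h3, Real.mul_rpow (by positivity) (by positivity),
    Real.mul_rpow (by positivity) (by positivity)]
  gcongr

/-- The Leibniz formula for f g = r is solved for the term with all derivatives on f, and the lower
ones are inserted by strong induction. Writing the quotient as a product identity avoids any formula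
for derivatives of 1/g. -/
lemma abs_iteratedDeriv_quotient_le {s A h δ : ℝ} (hs : 1 ≤ s) (hA : 0 < A) (hh : 0 < h)
    (hδ : 0 < δ) {f g r : ℝ → ℝ} (hf : ContDiff ℝ ∞ f) (hg : ContDiff ℝ ∞ g)
    (hfg : ∀ t, f t * g t = r t) (hgδ : ∀ t, δ ≤ g t)
    (hgb : ∀ b t, |iteratedDeriv b g t| ≤ A * h ^ b * (b.factorial : ℝ) ^ s)
    (hrb : ∀ b t, |iteratedDeriv b r t| ≤ A * h ^ b * (b.factorial : ℝ) ^ s) (b : ℕ) (t : ℝ) :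
    |iteratedDeriv b f t| ≤
      (2 * A / δ) * (h * (1 + 2 * A / δ)) ^ b * (b.factorial : ℝ) ^ s := by
  -- The growth ratio is chosen such that q - 1 = 2A/δ is exactly the constant in front of the
  -- induction hypothesis; the sum over lower orders then is a geometric sum equal to q^b - 1.
  set q : ℝ := 1 + 2 * A / δ with hq
  have hq0 : 0 < 2 * A / δ := by positivity
  have hq1 : 1 ≤ q := by linarith
  induction b using Nat.strong_induction_on with
  | _ b ih =>
  have hfun : f * g = r := funext hfg
  have hle : ((b : ℕ∞) : WithTop ℕ∞) ≤ (∞ : WithTop ℕ∞) := by exact_mod_cast le_top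
  have hleib := iteratedDeriv_mul (n := b) (x := t) (hf.of_le hle).contDiffAt
    (hg.of_le hle).contDiffAt
  rw [hfun, Finset.sum_range_succ] at hleib
  simp only [Nat.choose_self, Nat.cast_one, one_mul, Nat.sub_self, iteratedDeriv_zero] at hleib
  have hsum : |∑ i ∈ Finset.range b, (b.choose i : ℝ) * iteratedDeriv i f t *
      iteratedDeriv (b - i) g t| ≤ A * q ^ b * h ^ b * (b.factorial : ℝ) ^ s := by
    calc _ ≤ ∑ i ∈ Finset.range b, |(b.choose i : ℝ) * iteratedDeriv i f t *
            iteratedDeriv (b - i) g t| := Finset.abs_sum_le_sum_abs _ _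
      _ ≤ ∑ i ∈ Finset.range b, (2 * A / δ * q ^ i) * (A * h ^ b * (b.factorial : ℝ) ^ s) := by
          refine Finset.sum_le_sum fun i hi => ?_
          have hib := Finset.mem_range.1 hi
          rw [abs_mul, abs_mul, Nat.abs_cast]
          calc _ ≤ (b.choose i : ℝ) * ((2 * A / δ) * (h * q) ^ i * (i.factorial : ℝ) ^ s) *
                (A * h ^ (b - i) * ((b - i).factorial : ℝ) ^ s) := by
                gcongr
                · exact ih i hib
                · exact hgb _ _
            _ = (2 * A / δ * q ^ i) * (A * (h ^ i * h ^ (b - i))) * ((b.choose i : ℝ) *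
                ((i.factorial : ℝ) ^ s * ((b - i).factorial : ℝ) ^ s)) := by
                rw [mul_pow]; ring
            _ ≤ (2 * A / δ * q ^ i) * (A * (h ^ i * h ^ (b - i))) * (b.factorial : ℝ) ^ s := by
                gcongr
                exact choose_mul_factorial_rpow_le hs hib.le
            _ = _ := by rw [← pow_add, Nat.add_sub_cancel' hib.le]; ring
      _ = (∑ i ∈ Finset.range b, q ^ i) * (q - 1) * (A * h ^ b * (b.factorial : ℝ) ^ s) := by
          rw [← Finset.sum_mul, ← Finset.mul_sum, hq]; ring
      _ = (q ^ b - 1) * (A * h ^ b * (b.factorial : ℝ) ^ s) := by rw [geom_sum_mul]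
      _ ≤ q ^ b * (A * h ^ b * (b.factorial : ℝ) ^ s) := by gcongr; linarith
      _ = _ := by ring
  have hfact : |iteratedDeriv b f t * g t| ≤ 2 * A * q ^ b * h ^ b * (b.factorial : ℝ) ^ s := by
    have e : iteratedDeriv b f t * g t = iteratedDeriv b r t - ∑ i ∈ Finset.range b,
        (b.choose i : ℝ) * iteratedDeriv i f t * iteratedDeriv (b - i) g t := by
      rw [hleib]; ring
    rw [e]
    have h3 : A * h ^ b * (b.factorial : ℝ) ^ s ≤ A * q ^ b * h ^ b * (b.factorial : ℝ) ^ s := by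
      have : (1 : ℝ) ≤ q ^ b := one_le_pow₀ hq1
      have h4 : 0 ≤ A * h ^ b * (b.factorial : ℝ) ^ s := by positivity
      nlinarith
    calc _ ≤ _ := abs_sub _ _
      _ ≤ _ := add_le_add (hrb b t) hsum
      _ ≤ _ := by linarith
  rw [abs_mul, abs_of_nonneg (hδ.le.trans (hgδ t))] at hfact
  have : |iteratedDeriv b f t| * δ ≤ 2 * A * q ^ b * h ^ b * (b.factorial : ℝ) ^ s :=
    (mul_le_mul_of_nonneg_left (hgδ t) (abs_nonneg _)).trans hfact
  rw [mul_pow]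
  calc _ ≤ (2 * A * q ^ b * h ^ b * (b.factorial : ℝ) ^ s) / δ := by rwa [le_div_iff₀ hδ]
    _ = _ := by ring

/-! ### Derivatives along lines -/

section Lines

variable {V F : Type*} [NormedAddCommGroup V] [NormedSpace ℝ V] [NormedAddCommGroup F]
  [NormedSpace ℝ F]

lemma norm_iteratedDeriv_line_le {f : V → F} (hf : ContDiff ℝ ∞ f) (x e : V) (b : ℕ) (t : ℝ) :
    ‖iteratedDeriv b (fun t : ℝ => f (x + t • e)) t‖ ≤
      ‖iteratedFDeriv ℝ b f (x + t • e)‖ * ‖e‖ ^ b := by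
  let L : ℝ →L[ℝ] V := ContinuousLinearMap.toSpanSingleton ℝ e
  have h1 : (fun t : ℝ => f (x + t • e)) = (fun y => f (x + y)) ∘ L := by
    ext t; simp [L]
  have hf' : ContDiff ℝ ∞ (fun y => f (x + y)) := hf.comp (by fun_prop)
  rw [← norm_iteratedFDeriv_eq_norm_iteratedDeriv, h1,
    L.iteratedFDeriv_comp_right hf' t (i := b) (by exact_mod_cast le_top)]
  refine (ContinuousMultilinearMap.norm_compContinuousLinearMap_le _ _).trans ?_
  simp only [Finset.prod_const, Finset.card_univ, Fintype.card_fin]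
  rw [iteratedFDeriv_comp_add_left]
  simp [L]

/-- Passing to lines reduces the Gevrey estimate for the quotient in ℝⁿ to one variable, while
iterated directional derivatives are what the Fourier transform turns into powers of |z|. -/
lemma iterate_lineDeriv_eq_iteratedDeriv (f : V → F) (x e : V) (b : ℕ) (t : ℝ) :
    ((fun g y => lineDeriv ℝ g y e)^[b] f) (x + t • e) =
      iteratedDeriv b (fun t : ℝ => f (x + t • e)) t := by
  induction b generalizing t with
  | zero => simp
  | succ b ih =>
    rw [Function.iterate_succ_apply', iteratedDeriv_succ]
    have : (fun t => ((fun g y => lineDeriv ℝ g y e)^[b] f) (x + t • e)) =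
      iteratedDeriv b (fun t : ℝ => f (x + t • e)) := funext ih
    rw [← this, lineDeriv]
    simp only [add_assoc, ← add_smul]
    have := deriv_comp_const_add (fun τ => ((fun g y => lineDeriv ℝ g y e)^[b] f) (x + τ • e)) t 0
    simpa using this

end Lines

end GevreyModulation

end

noncomputable section

namespace GevreyModulation

/-! ### Fractional powers and stretched exponentials -/

/-- Bernoulli's inequality for t = y/x, followed by t ≤ t^a. The factor a < 1 on the smaller summand
is the gain on which the whole high frequency estimate rests. -/
lemma add_rpow_le_add_mul_rpow {a x y : ℝ} (ha0 : 0 ≤ a) (ha1 : a ≤ 1) (hy : 0 ≤ y) (hyx : y ≤ x) :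
    (x + y) ^ a ≤ x ^ a + a * y ^ a := by
  rcases hy.eq_or_lt with rfl | hy0
  · have : 0 ≤ a * (0 : ℝ) ^ a := by positivity
    simpa using this
  have hx0 : 0 < x := hy0.trans_le hyx
  set t := y / x with ht
  have ht0 : 0 < t := by positivity
  have ht1 : t ≤ 1 := (div_le_one hx0).2 hyx
  have hxy : x + y = x * (1 + t) := by rw [ht]; field_simp
  have hyt : y = x * t := by rw [ht]; field_simp
  have h1 : (1 + t) ^ a ≤ 1 + a * t :=
    rpow_one_add_le_one_add_mul_self (by linarith) ha0 ha1
  have h2 : t ≤ t ^ a := by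
    simpa using Real.rpow_le_rpow_of_exponent_ge ht0 ht1 ha1
  rw [hxy, Real.mul_rpow hx0.le (by positivity), hyt, Real.mul_rpow hx0.le ht0.le]
  have hxa : 0 ≤ x ^ a := by positivity
  have h3 : a * t ≤ a * t ^ a := by gcongr
  nlinarith

lemma add_rpow_le_add_rpow {a x y : ℝ} (ha0 : 0 ≤ a) (ha1 : a ≤ 1) (hx : 0 ≤ x) (hy : 0 ≤ y) :
    (x + y) ^ a ≤ x ^ a + y ^ a := by
  rcases le_total y x with h | h
  · have := add_rpow_le_add_mul_rpow ha0 ha1 hy h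
    have hy : 0 ≤ y ^ a := by positivity
    nlinarith
  · have := add_rpow_le_add_mul_rpow ha0 ha1 hx h
    have hy : 0 ≤ x ^ a := by positivity
    rw [add_comm]
    nlinarith

/-- The inequality z^a / a! ≤ e^z at z = (c/s) t^(1/s), raised to the power s. -/
lemma pow_le_mul_exp_rpow {s c t : ℝ} (hs : 0 < s) (hc : 0 < c) (ht : 0 ≤ t) (a : ℕ) :
    t ^ a ≤ ((s / c) ^ s) ^ a * (a.factorial : ℝ) ^ s * Real.exp (c * t ^ (1 / s)) := by
  have h1 := Real.pow_div_factorial_le_exp (c / s * t ^ (1 / s)) (by positivity) a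
  have h2 : ((c / s * t ^ (1 / s)) ^ a / a.factorial) ^ s ≤
      Real.exp (c / s * t ^ (1 / s)) ^ s := by gcongr
  rw [← Real.exp_mul, Real.div_rpow (by positivity) (by positivity), div_le_iff₀ (by positivity),
    ← Real.rpow_natCast, ← Real.rpow_mul (by positivity), mul_comm (a : ℝ) s,
    Real.rpow_mul (by positivity), Real.mul_rpow (by positivity) (by positivity),
    ← Real.rpow_mul ht, one_div_mul_cancel hs.ne', Real.rpow_one, Real.rpow_natCast, mul_pow] at h2
  have h3 : ((s / c) ^ s) ^ a * ((c / s) ^ s) ^ a = 1 := by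
    rw [← mul_pow, ← Real.mul_rpow (by positivity) (by positivity)]
    have : s / c * (c / s) = 1 := by field_simp
    simp [this]
  have h4 : c / s * t ^ (1 / s) * s = c * t ^ (1 / s) := by field_simp
  rw [h4] at h2
  calc t ^ a = ((s / c) ^ s) ^ a * (((c / s) ^ s) ^ a * t ^ a) := by rw [← mul_assoc, h3, one_mul]
    _ ≤ ((s / c) ^ s) ^ a * (Real.exp (c * t ^ (1 / s)) * (a.factorial : ℝ) ^ s) := by gcongr
    _ = _ := by ring

/-- Converse of the previous bound. Rather than optimizing over a, one takes s-th roots, multiplies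
by 2^{-a} and sums over a: the left sides build an exponential series and the right sides a
geometric one. -/
lemma le_exp_of_forall_pow_mul_le {s C H t y : ℝ} (hs : 0 < s) (hC : 0 < C) (hH : 0 < H)
    (ht : 0 ≤ t) (hy : 0 ≤ y) (h : ∀ a : ℕ, t ^ a * y ≤ C * H ^ a * (a.factorial : ℝ) ^ s) :
    y ≤ 2 ^ s * C * Real.exp (-(s * (1 / 2) * (1 / H) ^ (1 / s)) * t ^ (1 / s)) := by
  -- The division by 2 supplies the factors 2^{-a} that make the right-hand sides summable.
  set z := (t / H) ^ (1 / s) / 2 with hz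
  have hz0 : 0 ≤ z := by positivity
  have hzs : ∀ a : ℕ, ((2 * z) ^ a) ^ s = (t / H) ^ a := fun a => by
    rw [hz, mul_div_cancel₀ _ (by norm_num : (2 : ℝ) ≠ 0), ← Real.rpow_natCast,
      ← Real.rpow_mul (by positivity), ← Real.rpow_mul (by positivity), ← Real.rpow_natCast]
    congr 1; field_simp
  have hterm : ∀ a : ℕ, z ^ a / a.factorial * y ^ (1 / s) ≤ C ^ (1 / s) * (1 / 2) ^ a := fun a => by
    have h1 : (t / H) ^ a * y ≤ C * (a.factorial : ℝ) ^ s := by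
      rw [div_pow, div_mul_eq_mul_div, div_le_iff₀ (by positivity)]
      linarith [h a]
    rw [← hzs a] at h1
    have h2 : (((2 * z) ^ a) ^ s * y) ^ (1 / s) ≤ (C * (a.factorial : ℝ) ^ s) ^ (1 / s) := by gcongr
    rw [Real.mul_rpow (by positivity) hy, Real.mul_rpow hC.le (by positivity),
      ← Real.rpow_mul (by positivity), ← Real.rpow_mul (by positivity), mul_one_div_cancel hs.ne',
      Real.rpow_one, Real.rpow_one, mul_pow] at h2
    have h3 : (1 / 2 : ℝ) ^ a * 2 ^ a = 1 := by rw [← mul_pow]; norm_num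
    have hp : (0 : ℝ) < (1 / 2) ^ a := by positivity
    calc z ^ a / a.factorial * y ^ (1 / s)
        = (2 ^ a * z ^ a * y ^ (1 / s)) * (1 / 2) ^ a / a.factorial := by
          rw [show (2 ^ a * z ^ a * y ^ (1 / s)) * (1 / 2) ^ a =
            ((1 / 2 : ℝ) ^ a * 2 ^ a) * (z ^ a * y ^ (1 / s)) by ring, h3]; ring
      _ ≤ (C ^ (1 / s) * a.factorial) * (1 / 2) ^ a / a.factorial := by gcongr
      _ = _ := by field_simp
  have hexp : Real.exp z * y ^ (1 / s) ≤ C ^ (1 / s) * 2 := by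
    have h1 : HasSum (fun a : ℕ => z ^ a / a.factorial * y ^ (1 / s))
        (Real.exp z * y ^ (1 / s)) := by
      refine HasSum.mul_right _ ?_
      rw [Real.exp_eq_exp_ℝ]
      exact NormedSpace.expSeries_div_hasSum_exp z
    have h2 : HasSum (fun a : ℕ => C ^ (1 / s) * (1 / 2 : ℝ) ^ a) (C ^ (1 / s) * 2) :=
      hasSum_geometric_two.mul_left _
    exact hasSum_le hterm h1 h2
  have h5 : (Real.exp z * y ^ (1 / s)) ^ s ≤ (C ^ (1 / s) * 2) ^ s := by gcongr
  rw [Real.mul_rpow (by positivity) (by positivity), Real.mul_rpow (by positivity) (by positivity),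
    ← Real.rpow_mul hy, ← Real.rpow_mul hC.le, one_div_mul_cancel hs.ne', Real.rpow_one,
    Real.rpow_one, ← Real.exp_mul] at h5
  have h6 : s * (1 / 2) * (1 / H) ^ (1 / s) * t ^ (1 / s) = z * s := by
    rw [hz, div_eq_mul_one_div t H, Real.mul_rpow ht (by positivity)]; ring
  rw [neg_mul, h6, Real.exp_neg, ← div_eq_mul_inv, le_div_iff₀ (Real.exp_pos _)]
  linarith

/-! ### Lattice points -/

variable {n : ℕ}

lemma abs_coord_le_norm (x : EuclideanSpace ℝ (Fin n)) (i : Fin n) : |x i| ≤ ‖x‖ := by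
  simpa using PiLp.norm_apply_le x i

lemma norm_le_of_abs_coord_le {x : EuclideanSpace ℝ (Fin n)} {B : ℝ} (h : ∀ i, |x i| ≤ B) :
    ‖x‖ ≤ n * B := by
  rcases Nat.eq_zero_or_pos n with rfl | hn
  · simp [Subsingleton.elim x 0]
  have hB : 0 ≤ B := (abs_nonneg _).trans (h ⟨0, hn⟩)
  rw [EuclideanSpace.norm_eq]
  refine Real.sqrt_le_iff.2 ⟨by positivity, ?_⟩
  calc ∑ i, ‖x i‖ ^ 2 ≤ ∑ _i : Fin n, B ^ 2 := by
        refine Finset.sum_le_sum fun i _ => ?_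
        gcongr; exact h i
    _ = n * B ^ 2 := by simp
    _ ≤ (n * B) ^ 2 := by
        have : (1 : ℝ) ≤ n := by exact_mod_cast hn
        rw [mul_pow, sq (n : ℝ)]
        have : (n : ℝ) * 1 ≤ n * n := by gcongr
        nlinarith [sq_nonneg B]

@[simp] lemma latticePoint_apply (k : Fin n → ℤ) (i : Fin n) : latticePoint k i = (k i : ℝ) := rfl

lemma latticePoint_add (k l : Fin n → ℤ) :
    latticePoint (k + l) = latticePoint k + latticePoint l := by
  ext i; simp

lemma latticePoint_neg (k : Fin n → ℤ) : latticePoint (-k) = -latticePoint k := by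
  ext i; simp

@[simp] lemma latticePoint_zero : latticePoint (0 : Fin n → ℤ) = 0 := by
  ext i; simp

lemma summable_exp_neg_mul_abs_rpow {c a : ℝ} (hc : 0 < c) (ha : 0 < a) :
    Summable fun j : ℤ => Real.exp (-c * |(j : ℝ)| ^ a) := by
  have hs : (0 : ℝ) < 1 / a := by positivity
  have h := fun j : ℤ => pow_le_mul_exp_rpow hs hc (abs_nonneg (j : ℝ)) 2
  simp only [one_div_one_div] at h
  set D := (((1 / a / c) ^ (1 / a)) ^ 2 * ((2 : ℕ).factorial : ℝ) ^ (1 / a))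
  have hsum : Summable fun j : ℤ => D * (1 / (j : ℝ) ^ 2) :=
    (Real.summable_one_div_int_pow.2 one_lt_two).mul_left _
  refine Summable.of_norm_bounded_eventually hsum ?_
  have : ∀ᶠ j : ℤ in Filter.cofinite, j ≠ 0 :=
    (Set.finite_singleton (0 : ℤ)).compl_mem_cofinite
  filter_upwards [this] with j hj
  have hj' : (0 : ℝ) < (j : ℝ) ^ 2 := by positivity
  rw [Real.norm_of_nonneg (Real.exp_pos _).le, mul_one_div, le_div_iff₀ hj', neg_mul, Real.exp_neg,
    inv_mul_le_iff₀ (Real.exp_pos _)]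
  have := h j
  rw [sq_abs] at this
  linarith

theorem summable_exp_neg_mul_norm_latticePoint_rpow {c a : ℝ} (hc : 0 < c) (ha : 0 < a) :
    Summable fun k : Fin n → ℤ => Real.exp (-c * ‖latticePoint k‖ ^ a) := by
  rcases Nat.eq_zero_or_pos n with rfl | hn
  · exact Summable.of_finite
  -- The power of the norm dominates the mean of the powers of the coordinates, so the exponential
  -- factorizes into n one-dimensional ones with rate c/n.
  have hcn : 0 < c / n := by positivity
  set g : ℤ → ℝ := fun j => Real.exp (-(c / n) * |(j : ℝ)| ^ a) with hg
  have hgs : Summable g := summable_exp_neg_mul_abs_rpow hcn ha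
  have hle : ∀ k : Fin n → ℤ, Real.exp (-c * ‖latticePoint k‖ ^ a) ≤ ∏ i, g (k i) := fun k => by
    rw [hg, ← Real.exp_sum]
    refine Real.exp_le_exp.2 ?_
    rw [← Finset.mul_sum, neg_mul, neg_mul]
    refine neg_le_neg ?_
    calc c / n * ∑ i, |(k i : ℝ)| ^ a ≤ c / n * ∑ _i : Fin n, ‖latticePoint k‖ ^ a := by
          gcongr with i
          exact abs_coord_le_norm (latticePoint k) i
      _ = _ := by simp; field_simp
  refine Summable.of_nonneg_of_le (fun _ => (Real.exp_pos _).le) hle ?_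
  refine summable_of_sum_le (c := (∑' j, g j) ^ n)
    (fun k => Finset.prod_nonneg fun i _ => (Real.exp_pos _).le) fun u => ?_
  classical
  let t : Finset ℤ := u.biUnion fun k => Finset.univ.image k
  have hsub : u ⊆ Fintype.piFinset fun _ : Fin n => t := fun k hk => by
    refine Fintype.mem_piFinset.2 fun i => ?_
    exact Finset.mem_biUnion.2 ⟨k, hk, Finset.mem_image_of_mem _ (Finset.mem_univ i)⟩
  calc ∑ k ∈ u, ∏ i, g (k i) ≤ ∑ k ∈ Fintype.piFinset fun _ : Fin n => t, ∏ i, g (k i) :=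
        Finset.sum_le_sum_of_subset_of_nonneg hsub
          fun k _ _ => Finset.prod_nonneg fun i _ => (Real.exp_pos _).le
    _ = ∏ _i : Fin n, ∑ j ∈ t, g j := (Finset.prod_univ_sum (fun _ => t) (fun _ j => g j)).symm
    _ = (∑ j ∈ t, g j) ^ n := by simp
    _ ≤ _ := by
        gcongr
        exact hgs.sum_le_tsum t fun j _ => (Real.exp_pos _).le

end GevreyModulation

end

noncomputable section

namespace GevreyModulation

variable {n : ℕ}

/-! ### Locally finite sums of lattice translates -/

/-- The lattice points in a box around `ξ`. -/
def nearLattice (ξ : EuclideanSpace ℝ (Fin n)) : Finset (Fin n → ℤ) :=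
  Fintype.piFinset fun i => Finset.Icc (⌊ξ i⌋ - 3) (⌊ξ i⌋ + 3)

lemma card_nearLattice (ξ : EuclideanSpace ℝ (Fin n)) : (nearLattice ξ).card = 7 ^ n := by
  have : ∀ z : ℤ, (z + 3 + 1 - (z - 3)).toNat = 7 := fun z => by
    rw [show z + 3 + 1 - (z - 3) = 7 by ring]; rfl
  simp [nearLattice, this]

lemma norm_sub_le_of_mem_nearLattice {ξ : EuclideanSpace ℝ (Fin n)} {l : Fin n → ℤ}
    (hl : l ∈ nearLattice ξ) : ‖ξ - latticePoint l‖ ≤ n * 4 := by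
  refine norm_le_of_abs_coord_le fun i => ?_
  have h := Finset.mem_Icc.1 (Fintype.mem_piFinset.1 hl i)
  have h1 : ((⌊ξ i⌋ : ℝ) - 3) ≤ l i := by exact_mod_cast h.1
  have h2 : (l i : ℝ) ≤ (⌊ξ i⌋ : ℝ) + 3 := by exact_mod_cast h.2
  have h3 := Int.floor_le (ξ i)
  have h4 := Int.lt_floor_add_one (ξ i)
  simp only [PiLp.sub_apply, latticePoint_apply]
  rw [abs_le]; constructor <;> linarith

/-- The sum of the translates of `ρ`, weighted with the coefficients `c`. -/
def translateSum (c : (Fin n → ℤ) → ℝ) (ρ : EuclideanSpace ℝ (Fin n) → ℝ)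
    (ξ : EuclideanSpace ℝ (Fin n)) : ℝ :=
  ∑' l : Fin n → ℤ, c l * ρ (ξ - latticePoint l)

section

variable {s : ℝ} {ρ : EuclideanSpace ℝ (Fin n) → ℝ} (hρ : GeneratesDecomposition s ρ)
  (c : (Fin n → ℤ) → ℝ)
include hρ

lemma GeneratesDecomposition.abs_coord_le_one {ξ : EuclideanSpace ℝ (Fin n)} (h : ρ ξ ≠ 0)
    (i : Fin n) : |ξ i| ≤ 1 :=
  abs_le.2 (hρ.support_subset h i)

/-- The radius 3 in `nearLattice` collects 1 for the support of ρ, 1 for the distance of ξ from ξ₀,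
and 1 for rounding ξ₀ down. -/
lemma GeneratesDecomposition.mem_nearLattice {ξ ξ₀ : EuclideanSpace ℝ (Fin n)} (hξ : ‖ξ - ξ₀‖ < 1)
    {l : Fin n → ℤ} (h : ρ (ξ - latticePoint l) ≠ 0) : l ∈ nearLattice ξ₀ := by
  refine Fintype.mem_piFinset.2 fun i => Finset.mem_Icc.2 ?_
  have h1 := abs_le.1 (hρ.abs_coord_le_one h i)
  have h2 := abs_le.1 ((abs_coord_le_norm (ξ - ξ₀) i).trans hξ.le)
  have h3 := Int.floor_le (ξ₀ i)
  have h4 := Int.lt_floor_add_one (ξ₀ i)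
  simp only [PiLp.sub_apply, latticePoint_apply] at h1 h2
  constructor
  · have : ((⌊ξ₀ i⌋ : ℝ) - 3) ≤ l i := by linarith
    exact_mod_cast this
  · have : (l i : ℝ) ≤ (⌊ξ₀ i⌋ : ℝ) + 3 := by linarith
    exact_mod_cast this

lemma translateSum_eq_sum {ξ ξ₀ : EuclideanSpace ℝ (Fin n)} (hξ : ‖ξ - ξ₀‖ < 1) :
    translateSum c ρ ξ = ∑ l ∈ nearLattice ξ₀, c l * ρ (ξ - latticePoint l) := by
  refine tsum_eq_sum fun l hl => ?_
  by_contra h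
  exact hl (hρ.mem_nearLattice hξ (right_ne_zero_of_mul h))

lemma translateSum_eventuallyEq (ξ₀ : EuclideanSpace ℝ (Fin n)) :
    translateSum c ρ =ᶠ[nhds ξ₀]
      fun ξ => ∑ l ∈ nearLattice ξ₀, c l * ρ (ξ - latticePoint l) := by
  filter_upwards [Metric.ball_mem_nhds ξ₀ one_pos] with ξ hξ
  exact translateSum_eq_sum hρ c (by simpa [dist_eq_norm] using hξ)

lemma contDiff_translateSum : ContDiff ℝ ∞ (translateSum c ρ) := by
  refine contDiff_iff_contDiffAt.2 fun ξ₀ => ?_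
  refine ContDiffAt.congr_of_eventuallyEq ?_ (translateSum_eventuallyEq hρ c ξ₀)
  refine ContDiffAt.sum fun l _ => ContDiff.contDiffAt ?_
  exact contDiff_const.mul (hρ.memGelfandShilov.1.comp (contDiff_id.sub contDiff_const))

/-- Near ξ only 7^n translates matter. This serves twice: for c = 1, where the sum is the
denominator of σ_k, and for stretched exponential coefficients, where it is a test function of
prescribed decay. -/
lemma norm_iteratedFDeriv_translateSum_le (b : ℕ) (ξ : EuclideanSpace ℝ (Fin n)) :
    ‖iteratedFDeriv ℝ b (translateSum c ρ) ξ‖ ≤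
      ∑ l ∈ nearLattice ξ, |c l| * ‖iteratedFDeriv ℝ b ρ (ξ - latticePoint l)‖ := by
  have hle : ((b : ℕ∞) : WithTop ℕ∞) ≤ (∞ : WithTop ℕ∞) := by exact_mod_cast le_top
  have hsm : ∀ l : Fin n → ℤ, ContDiff ℝ b fun ξ => ρ (ξ - latticePoint l) := fun l =>
    (hρ.memGelfandShilov.1.comp (contDiff_id.sub contDiff_const)).of_le hle
  rw [((translateSum_eventuallyEq hρ c ξ).iteratedFDeriv ℝ b).eq_of_nhds,
    iteratedFDeriv_fun_sum_apply fun l _ => (contDiff_const.mul (hsm l)).contDiffAt]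
  refine (norm_sum_le _ _).trans (Finset.sum_le_sum fun l _ => ?_)
  have : (fun ξ => c l * ρ (ξ - latticePoint l)) = c l • fun ξ => ρ (ξ - latticePoint l) := rfl
  rw [this, iteratedFDeriv_const_smul_apply (hsm l).contDiffAt, norm_smul, iteratedFDeriv_comp_sub,
    Real.norm_eq_abs]

lemma exists_norm_iteratedFDeriv_le :
    ∃ A h : ℝ, 0 < A ∧ 0 < h ∧ ∀ b ξ,
      ‖iteratedFDeriv ℝ b ρ ξ‖ ≤ A * h ^ b * (b.factorial : ℝ) ^ s := by
  obtain ⟨h, hh, C, hC⟩ := hρ.memGelfandShilov.2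
  refine ⟨|C| + 1, h, by positivity, hh, fun b ξ => ?_⟩
  have := hC 0 b ξ
  simp only [pow_zero, one_mul, zero_add, Nat.factorial_zero, Nat.cast_one] at this
  refine this.trans ?_
  gcongr
  linarith [le_abs_self C]

lemma exists_norm_iteratedFDeriv_translateSum_one_le :
    ∃ A h : ℝ, 0 < A ∧ 0 < h ∧ ∀ b ξ,
      ‖iteratedFDeriv ℝ b (translateSum 1 ρ) ξ‖ ≤ A * h ^ b * (b.factorial : ℝ) ^ s ∧
      ‖iteratedFDeriv ℝ b ρ ξ‖ ≤ A * h ^ b * (b.factorial : ℝ) ^ s := by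
  obtain ⟨A, h, hA, hh, hb⟩ := exists_norm_iteratedFDeriv_le hρ
  have h7 : (1 : ℝ) ≤ 7 ^ n := one_le_pow₀ (by norm_num)
  refine ⟨7 ^ n * A, h, by positivity, hh, fun b ξ => ⟨?_, ?_⟩⟩
  · refine (norm_iteratedFDeriv_translateSum_le hρ 1 b ξ).trans ?_
    calc _ ≤ ∑ l ∈ nearLattice ξ, A * h ^ b * (b.factorial : ℝ) ^ s := by
          refine Finset.sum_le_sum fun l _ => ?_
          simpa using hb b (ξ - latticePoint l)
      _ = _ := by simp [card_nearLattice]; ring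
  · refine (hb b ξ).trans ?_
    gcongr
    nlinarith

lemma translateSum_one_pos (ξ : EuclideanSpace ℝ (Fin n)) : 0 < translateSum 1 ρ ξ := by
  obtain ⟨k, hk⟩ := hρ.cover ξ
  rw [translateSum_eq_sum hρ 1 (ξ₀ := ξ) (by simp)]
  refine Finset.sum_pos' (fun l _ => ?_) ⟨k, hρ.mem_nearLattice (by simp) hk, ?_⟩
  · simpa using (hρ.mem_Icc (ξ - latticePoint l)).1
  · simpa using lt_of_le_of_ne (hρ.mem_Icc (ξ - latticePoint k)).1 hk.symm

omit hρ in
lemma translateSum_one_sub_latticePoint (ξ : EuclideanSpace ℝ (Fin n)) (k : Fin n → ℤ) :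
    translateSum 1 ρ (ξ - latticePoint k) = translateSum 1 ρ ξ := by
  unfold translateSum
  conv_rhs => rw [← (Equiv.addLeft k).tsum_eq]
  refine tsum_congr fun l => ?_
  simp [latticePoint_add, sub_sub]

/-- The sum is positive, continuous and periodic, so its minimum over a ball containing a unit cell
bounds it from below everywhere. -/
lemma exists_le_translateSum_one : ∃ δ : ℝ, 0 < δ ∧ ∀ ξ, δ ≤ translateSum 1 ρ ξ := by
  have hcont := (contDiff_translateSum hρ 1).continuous
  obtain ⟨ξ₀, -, h₀⟩ := (isCompact_closedBall (0 : EuclideanSpace ℝ (Fin n)) n).exists_isMinOn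
    ⟨0, by simp⟩ hcont.continuousOn
  refine ⟨translateSum 1 ρ ξ₀, translateSum_one_pos hρ ξ₀, fun ξ => ?_⟩
  rw [← translateSum_one_sub_latticePoint ξ fun i => ⌊ξ i⌋]
  refine h₀ ?_
  rw [mem_closedBall_zero_iff]
  simpa using norm_le_of_abs_coord_le (x := ξ - latticePoint fun i => ⌊ξ i⌋) (B := 1) fun i => by
    simp only [PiLp.sub_apply, latticePoint_apply]
    rw [abs_le]
    constructor <;> linarith [Int.floor_le (ξ i), Int.lt_floor_add_one (ξ i)]

/-! ### The symbols of the decomposition operators -/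

omit hρ in
lemma decomp_eq_div (k : Fin n → ℤ) (ξ : EuclideanSpace ℝ (Fin n)) :
    decomp ρ k ξ = ρ (ξ - latticePoint k) / translateSum 1 ρ ξ := by
  simp [decomp, translateSum]

omit hρ in
lemma decomp_eq_decomp_zero (k : Fin n → ℤ) (ξ : EuclideanSpace ℝ (Fin n)) :
    decomp ρ k ξ = decomp ρ 0 (ξ - latticePoint k) := by
  simp [decomp_eq_div, translateSum_one_sub_latticePoint]

lemma contDiff_decomp (k : Fin n → ℤ) : ContDiff ℝ ∞ (decomp ρ k) := by
  rw [funext (decomp_eq_div k)]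
  exact (hρ.memGelfandShilov.1.comp (contDiff_id.sub contDiff_const)).div
    (contDiff_translateSum hρ 1) fun ξ => (translateSum_one_pos hρ ξ).ne'

lemma abs_coord_sub_le_of_decomp_ne_zero {k : Fin n → ℤ} {ξ : EuclideanSpace ℝ (Fin n)}
    (h : decomp ρ k ξ ≠ 0) (i : Fin n) : |ξ i - k i| ≤ 1 := by
  rw [decomp_eq_div] at h
  exact hρ.abs_coord_le_one (left_ne_zero_of_mul h) i

lemma decomp_mem_Icc (k : Fin n → ℤ) (ξ : EuclideanSpace ℝ (Fin n)) :
    decomp ρ k ξ ∈ Set.Icc (0 : ℝ) 1 := by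
  rw [decomp_eq_div]
  have hS := translateSum_one_pos hρ ξ
  refine ⟨div_nonneg (hρ.mem_Icc _).1 hS.le, (div_le_one hS).2 ?_⟩
  rw [translateSum_eq_sum hρ 1 (ξ₀ := ξ) (by simp)]
  by_cases h : ρ (ξ - latticePoint k) = 0
  · rw [h]
    exact Finset.sum_nonneg fun l _ => by simpa using (hρ.mem_Icc (ξ - latticePoint l)).1
  · have := Finset.single_le_sum (f := fun l => (1 : (Fin n → ℤ) → ℝ) l * ρ (ξ - latticePoint l))
      (fun l _ => by simpa using (hρ.mem_Icc (ξ - latticePoint l)).1)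
      (hρ.mem_nearLattice (ξ₀ := ξ) (by simp) h)
    simpa using this

/-- The partition of unity over any finite set containing all active indices, so that a set working
for all ξ in a window can be inserted. -/
lemma sum_decomp_eq_one {ξ : EuclideanSpace ℝ (Fin n)} {t : Finset (Fin n → ℤ)}
    (ht : ∀ k, decomp ρ k ξ ≠ 0 → k ∈ t) : ∑ k ∈ t, decomp ρ k ξ = 1 := by
  have hS := translateSum_one_pos hρ ξ
  have : translateSum 1 ρ ξ = ∑ k ∈ t, ρ (ξ - latticePoint k) := by
    unfold translateSum
    simp only [Pi.one_apply, one_mul]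
    refine tsum_eq_sum fun k hk => ?_
    by_contra h
    exact hk (ht k (by rw [decomp_eq_div]; exact div_ne_zero h hS.ne'))
  simp only [decomp_eq_div]
  rw [← Finset.sum_div, ← this, div_self hS.ne']

lemma hasCompactSupport_decomp (k : Fin n → ℤ) : HasCompactSupport (decomp ρ k) := by
  refine HasCompactSupport.of_support_subset_isCompact
    (isCompact_closedBall (latticePoint k) n) fun ξ hξ => ?_
  rw [mem_closedBall_iff_norm]
  simpa using norm_le_of_abs_coord_le (x := ξ - latticePoint k) (B := 1) fun i => by
    simpa using abs_coord_sub_le_of_decomp_ne_zero hρ hξ i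

lemma exists_norm_iteratedDeriv_decomp_le (hs : 1 ≤ s) :
    ∃ A h : ℝ, 0 < A ∧ 0 < h ∧ ∀ (b : ℕ) (ξ e : EuclideanSpace ℝ (Fin n)), ‖e‖ ≤ 1 →
      |iteratedDeriv b (fun t : ℝ => decomp ρ 0 (ξ + t • e)) 0| ≤
        A * h ^ b * (b.factorial : ℝ) ^ s := by
  obtain ⟨A, h, hA, hh, hb⟩ := exists_norm_iteratedFDeriv_translateSum_one_le hρ
  obtain ⟨δ, hδ, hδS⟩ := exists_le_translateSum_one hρ
  refine ⟨2 * A / δ, h * (1 + 2 * A / δ), by positivity, by positivity, fun b ξ e he => ?_⟩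
  have hline : ContDiff ℝ ∞ fun t : ℝ => ξ + t • e := by fun_prop
  have hpow : ∀ b : ℕ, ‖e‖ ^ b ≤ 1 := fun b => pow_le_one₀ (norm_nonneg _) he
  refine abs_iteratedDeriv_quotient_le hs hA hh hδ (g := fun t => translateSum 1 ρ (ξ + t • e))
    (r := fun t => ρ (ξ + t • e)) ((contDiff_decomp hρ 0).comp hline)
    ((contDiff_translateSum hρ 1).comp hline) (fun t => ?_) (fun t => hδS _) (fun b t => ?_)
    (fun b t => ?_) b 0
  · rw [Function.comp_apply, decomp_eq_div, latticePoint_zero, sub_zero]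
    exact div_mul_cancel₀ _ (translateSum_one_pos hρ _).ne'
  · have := norm_iteratedDeriv_line_le (contDiff_translateSum hρ 1) ξ e b t
    rw [Real.norm_eq_abs] at this
    exact this.trans ((mul_le_of_le_one_right (norm_nonneg _) (hpow b)).trans (hb b _).1)
  · have := norm_iteratedDeriv_line_le hρ.memGelfandShilov.1 ξ e b t
    rw [Real.norm_eq_abs] at this
    exact this.trans ((mul_le_of_le_one_right (norm_nonneg _) (hpow b)).trans (hb b _).2)

end

end GevreyModulation

end

noncomputable section

namespace GevreyModulation

variable {n : ℕ}

open MeasureTheory FourierTransform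

/-! ### Convolution kernels of Fourier multipliers -/

/-- The kernel `z ↦ (2π)⁻ⁿ ∫ σ(ξ) e^{i z·ξ} dξ` of the Fourier multiplier with symbol `σ`. -/
def kernel (σ : EuclideanSpace ℝ (Fin n) → ℂ) (z : EuclideanSpace ℝ (Fin n)) : ℂ :=
  (((2 * Real.pi) ^ n)⁻¹ : ℝ) *
    ∫ ξ : EuclideanSpace ℝ (Fin n), σ ξ * Complex.exp (Complex.I * (inner ℝ z ξ : ℝ))

lemma boxKernel_eq_kernel (ρ : EuclideanSpace ℝ (Fin n) → ℝ) (k : Fin n → ℤ) :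
    boxKernel ρ k = kernel fun ξ => (decomp ρ k ξ : ℂ) := rfl

lemma kernel_eq_fourierInv (σ : EuclideanSpace ℝ (Fin n) → ℂ) (z : EuclideanSpace ℝ (Fin n)) :
    kernel σ z = (((2 * Real.pi) ^ n)⁻¹ : ℝ) * 𝓕⁻ σ ((2 * Real.pi)⁻¹ • z) := by
  rw [kernel, Real.fourierInv_eq']
  congr 2
  ext ξ
  rw [smul_eq_mul, mul_comm]
  congr 2
  rw [inner_smul_right, real_inner_comm]
  have : (Real.pi : ℂ) ≠ 0 := by exact_mod_cast Real.pi_ne_zero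
  push_cast
  field_simp

open scoped LineDeriv in
-- Stated for Schwartz functions, where differentiating the symbol along e multiplies its inverse
-- transform by -2πi⟨w, e⟩ with no further conditions.
lemma fourierInv_iterate_lineDeriv (g : SchwartzMap (EuclideanSpace ℝ (Fin n)) ℂ)
    (e w : EuclideanSpace ℝ (Fin n)) (a : ℕ) :
    𝓕⁻ (((fun h : SchwartzMap (EuclideanSpace ℝ (Fin n)) ℂ => ∂_{e} h)^[a]) g) w =
      (-(2 * Real.pi * Complex.I) * (inner ℝ w e : ℝ)) ^ a * 𝓕⁻ g w := by
  induction a with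
  | zero => simp
  | succ a ih =>
    rw [Function.iterate_succ_apply', SchwartzMap.fourierInv_lineDerivOp_eq]
    have : (fun x : EuclideanSpace ℝ (Fin n) => inner ℝ x e).HasTemperateGrowth := by fun_prop
    rw [smul_apply, SchwartzMap.smulLeftCLM_apply_apply this, ih, pow_succ]
    simp only [smul_eq_mul, Complex.real_smul]
    ring

open scoped LineDeriv in
lemma coe_iterate_lineDeriv (g : SchwartzMap (EuclideanSpace ℝ (Fin n)) ℂ)
    (e ξ : EuclideanSpace ℝ (Fin n)) (a : ℕ) :
    (((fun h : SchwartzMap (EuclideanSpace ℝ (Fin n)) ℂ => ∂_{e} h)^[a]) g) ξ =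
      iteratedDeriv a (fun t : ℝ => g (ξ + t • e)) 0 := by
  have h : ∀ a, ⇑(((fun h : SchwartzMap (EuclideanSpace ℝ (Fin n)) ℂ => ∂_{e} h)^[a]) g) =
      ((fun f y => lineDeriv ℝ f y e)^[a] g) := fun a => by
    induction a with
    | zero => rfl
    | succ a ih =>
      rw [Function.iterate_succ_apply', Function.iterate_succ_apply', ← ih]
      ext y
      exact SchwartzMap.lineDerivOp_apply _ _ _
  rw [h, ← iterate_lineDeriv_eq_iteratedDeriv]
  simp

section

variable {s : ℝ} {ρ : EuclideanSpace ℝ (Fin n) → ℝ}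

/-- The symbol of `□_k` as a complex valued Schwartz function. -/
def decompSchwartz (hρ : GeneratesDecomposition s ρ) (k : Fin n → ℤ) :
    SchwartzMap (EuclideanSpace ℝ (Fin n)) ℂ :=
  HasCompactSupport.toSchwartzMap (f := fun ξ => (decomp ρ k ξ : ℂ))
    ((hasCompactSupport_decomp hρ k).comp_left Complex.ofReal_zero)
    (Complex.ofRealCLM.contDiff.comp (contDiff_decomp hρ k))

lemma decompSchwartz_apply (hρ : GeneratesDecomposition s ρ) (k : Fin n → ℤ)
    (ξ : EuclideanSpace ℝ (Fin n)) : decompSchwartz hρ k ξ = (decomp ρ k ξ : ℂ) := rfl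

/-- Differentiating the symbol a times in the direction of z multiplies the kernel by |z|^a up to a
phase. The Gevrey bounds and the compact support control the result by C h^a (a!)^s for every a,
which amounts to stretched exponential decay. -/
theorem exists_norm_boxKernel_zero_le (hs : 1 ≤ s) (hρ : GeneratesDecomposition s ρ) :
    ∃ c C : ℝ, 0 < c ∧ 0 < C ∧ ∀ z, ‖boxKernel ρ 0 z‖ ≤ C * Real.exp (-c * ‖z‖ ^ (1 / s)) := by
  obtain ⟨A, h, hA, hh, hb⟩ := exists_norm_iteratedDeriv_decomp_le hρ hs
  have hs0 : 0 < s := by linarith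
  set B : Set (EuclideanSpace ℝ (Fin n)) := Metric.closedBall 0 n
  set m : ℝ := (volume B).toReal
  have hBfin : volume B < ⊤ := (isCompact_closedBall _ _).measure_lt_top
  have hpi : 0 < ((2 * Real.pi) ^ n)⁻¹ := by positivity
  have hC : 0 < ((2 * Real.pi) ^ n)⁻¹ * A * (m + 1) := by positivity
  refine ⟨s * (1 / 2) * (1 / h) ^ (1 / s), 2 ^ s * (((2 * Real.pi) ^ n)⁻¹ * A * (m + 1)),
    by positivity, by positivity, fun z => ?_⟩
  refine le_exp_of_forall_pow_mul_le hs0 hC hh (norm_nonneg z) (norm_nonneg _) fun a => ?_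
  -- At z = 0 the inverse is 0 and so e = 0; both facts about e established next remain valid there.
  set e : EuclideanSpace ℝ (Fin n) := ‖z‖⁻¹ • z with he
  have he1 : ‖e‖ ≤ 1 := by
    rw [he, norm_smul, norm_inv, norm_norm]
    exact inv_mul_le_one
  have hinner : inner ℝ z e = ‖z‖ := by
    rw [he, inner_smul_right, real_inner_self_eq_norm_sq]
    rcases eq_or_ne ‖z‖ 0 with h0 | h0
    · simp [h0]
    · field_simp
  have key := fourierInv_iterate_lineDeriv (decompSchwartz hρ 0) e ((2 * Real.pi)⁻¹ • z) a
  set D := (((fun h : SchwartzMap (EuclideanSpace ℝ (Fin n)) ℂ =>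
    LineDeriv.lineDerivOp e h)^[a]) (decompSchwartz hρ 0))
  have hD : ∀ ξ, ‖D ξ‖ ≤ A * h ^ a * (a.factorial : ℝ) ^ s := fun ξ => by
    have h1 : D ξ = iteratedDeriv a (fun t : ℝ => ((decomp ρ 0 (ξ + t • e) : ℝ) : ℂ)) 0 :=
      coe_iterate_lineDeriv _ _ _ _
    rw [h1, ← norm_iteratedFDeriv_eq_norm_iteratedDeriv]
    have h2 : (fun t : ℝ => ((decomp ρ 0 (ξ + t • e) : ℝ) : ℂ)) =
      Complex.ofRealLI ∘ fun t : ℝ => decomp ρ 0 (ξ + t • e) := rfl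
    have hsm : ContDiff ℝ ∞ fun t : ℝ => decomp ρ 0 (ξ + t • e) :=
      (contDiff_decomp hρ 0).comp (by fun_prop)
    rw [h2, LinearIsometry.norm_iteratedFDeriv_comp_left _ (hsm.contDiffAt (x := 0))
      (by exact_mod_cast le_top), norm_iteratedFDeriv_eq_norm_iteratedDeriv]
    exact hb a ξ e he1
  have hD0 : ∀ ξ, ξ ∉ B → D ξ = 0 := fun ξ hξ => by
    have h1 : D ξ = iteratedDeriv a (fun t : ℝ => ((decomp ρ 0 (ξ + t • e) : ℝ) : ℂ)) 0 :=
      coe_iterate_lineDeriv _ _ _ _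
    have hev : (fun t : ℝ => ((decomp ρ 0 (ξ + t • e) : ℝ) : ℂ)) =ᶠ[nhds 0] fun _ => 0 := by
      have hcont : Continuous fun t : ℝ => ξ + t • e := by fun_prop
      have hmem : (fun t : ℝ => ξ + t • e) ⁻¹' Bᶜ ∈ nhds (0 : ℝ) :=
        hcont.continuousAt.preimage_mem_nhds
          (Metric.isClosed_closedBall.isOpen_compl.mem_nhds (by rwa [zero_smul, add_zero]))
      filter_upwards [hmem] with t ht
      by_contra hne
      refine ht ?_
      rw [mem_closedBall_zero_iff]
      simpa using norm_le_of_abs_coord_le (B := 1) fun i => by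
        simpa using abs_coord_sub_le_of_decomp_ne_zero hρ (Complex.ofReal_ne_zero.1 hne) i
    rw [h1, (hev.iteratedDeriv_eq a)]
    simp
  have hF : ‖𝓕⁻ D ((2 * Real.pi)⁻¹ • z)‖ ≤ A * h ^ a * (a.factorial : ℝ) ^ s * m := by
    rw [SchwartzMap.fourierInv_coe, Real.fourierInv_eq']
    rw [← setIntegral_eq_integral_of_forall_compl_eq_zero (s := B) fun ξ hξ => by
      rw [hD0 ξ hξ, smul_zero]]
    refine norm_setIntegral_le_of_norm_le_const hBfin fun ξ _ => ?_
    rw [norm_smul]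
    have : ‖Complex.exp (↑(2 * Real.pi * inner ℝ ξ ((2 * Real.pi)⁻¹ • z)) * Complex.I)‖ = 1 :=
      Complex.norm_exp_ofReal_mul_I _
    rw [this, one_mul]
    exact hD ξ
  rw [key, norm_mul, norm_pow, norm_mul, inner_smul_left, hinner] at hF
  have hn : ‖-(2 * (Real.pi : ℂ) * Complex.I)‖ = 2 * Real.pi := by
    simp [abs_of_pos Real.pi_pos]
  have hn2 : ‖(((starRingEnd ℝ) (2 * Real.pi)⁻¹ * ‖z‖ : ℝ) : ℂ)‖ = (2 * Real.pi)⁻¹ * ‖z‖ := by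
    rw [Complex.norm_real]
    simp [abs_of_pos Real.pi_pos]
  rw [hn, hn2, mul_inv_cancel_left₀ (by positivity)] at hF
  have hk : ‖boxKernel ρ 0 z‖ = ((2 * Real.pi) ^ n)⁻¹ *
      ‖𝓕⁻ (decompSchwartz hρ 0) ((2 * Real.pi)⁻¹ • z)‖ := by
    rw [boxKernel_eq_kernel, kernel_eq_fourierInv, norm_mul, Complex.norm_real,
      Real.norm_of_nonneg hpi.le, SchwartzMap.fourierInv_coe]
    rfl
  rw [hk]
  calc _ = ((2 * Real.pi) ^ n)⁻¹ *
        (‖z‖ ^ a * ‖𝓕⁻ (decompSchwartz hρ 0) ((2 * Real.pi)⁻¹ • z)‖) := by ring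
    _ ≤ ((2 * Real.pi) ^ n)⁻¹ * (A * h ^ a * (a.factorial : ℝ) ^ s * (m + 1)) := by
        refine mul_le_mul_of_nonneg_left (hF.trans ?_) hpi.le
        gcongr
        linarith
    _ = _ := by ring

end

end GevreyModulation

end

noncomputable section

namespace GevreyModulation

variable {n : ℕ}

open MeasureTheory

/-! ### Functions in the Gelfand-Shilov dual -/

/-- `f` becomes integrable after multiplication with any stretched exponential
`exp (-c ‖x‖ ^ a)`, `c > 0`. -/
structure StretchedIntegrable (a : ℝ) (f : EuclideanSpace ℝ (Fin n) → ℂ) : Prop where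
  aestronglyMeasurable : AEStronglyMeasurable f volume
  integrable : ∀ c : ℝ, 0 < c → Integrable fun x => ‖f x‖ * Real.exp (-c * ‖x‖ ^ a)

lemma exp_neg_rpow_le_of_norm_sub_le {a c B : ℝ} (ha0 : 0 ≤ a) (ha1 : a ≤ 1) (hc : 0 ≤ c)
    {V : Type*} [NormedAddCommGroup V] {x y : V} (h : ‖x - y‖ ≤ B) :
    Real.exp (-c * ‖x‖ ^ a) ≤ Real.exp (c * B ^ a) * Real.exp (-c * ‖y‖ ^ a) := by
  rw [← Real.exp_add]
  refine Real.exp_le_exp.2 ?_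
  have hB : 0 ≤ B := (norm_nonneg _).trans h
  have h1 : ‖y‖ ≤ ‖x‖ + B := by
    calc ‖y‖ = ‖x - (x - y)‖ := by simp
      _ ≤ ‖x‖ + ‖x - y‖ := norm_sub_le _ _
      _ ≤ _ := by gcongr
  have h2 : ‖y‖ ^ a ≤ ‖x‖ ^ a + B ^ a :=
    (Real.rpow_le_rpow (norm_nonneg _) h1 ha0).trans
      (add_rpow_le_add_rpow ha0 ha1 (norm_nonneg _) hB)
  nlinarith

/-! ### Test functions with stretched exponential decay -/

section

variable {s : ℝ} {ρ : EuclideanSpace ℝ (Fin n) → ℝ}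

/-- A positive Gelfand-Shilov function which decays exactly like a stretched exponential. -/
def stretchedBump (s c : ℝ) (ρ : EuclideanSpace ℝ (Fin n) → ℝ) :
    EuclideanSpace ℝ (Fin n) → ℝ :=
  translateSum (fun l => Real.exp (-c * ‖latticePoint l‖ ^ (1 / s))) ρ

/-- All active lattice points lie within 4n of x, so the coefficients are comparable to exp(-c
|x|^(1/s)), which absorbs |x|^a at the price D^a (a!)^s. Derivatives only fall on ρ. -/
lemma memGelfandShilov_stretchedBump (hs : 1 < s) (hρ : GeneratesDecomposition s ρ) {c : ℝ}
    (hc : 0 < c) : MemGelfandShilov s fun x => (stretchedBump s c ρ x : ℂ) := by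
  have hs0 : 0 < s := by linarith
  have ha0 : 0 ≤ 1 / s := by positivity
  have ha1 : 1 / s ≤ 1 := by rw [div_le_one hs0]; exact hs.le
  have hsm := contDiff_translateSum hρ fun l => Real.exp (-c * ‖latticePoint l‖ ^ (1 / s))
  obtain ⟨A, h, hA, hh, hb⟩ := exists_norm_iteratedFDeriv_le hρ
  set D : ℝ := (s / c) ^ s
  have hD : 0 < D := by positivity
  set K : ℝ := Real.exp (c * (n * 4) ^ (1 / s))
  refine ⟨Complex.ofRealCLM.contDiff.comp hsm, max D h, lt_max_of_lt_right hh, 7 ^ n * K * A,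
    fun a b x => ?_⟩
  have h1 : ‖iteratedFDeriv ℝ b (fun x => (stretchedBump s c ρ x : ℂ)) x‖ =
      ‖iteratedFDeriv ℝ b (stretchedBump s c ρ) x‖ :=
    LinearIsometry.norm_iteratedFDeriv_comp_left Complex.ofRealLI (hsm.contDiffAt (x := x))
      (by exact_mod_cast le_top)
  rw [h1]
  have h2 := pow_le_mul_exp_rpow hs0 hc (norm_nonneg x) a
  have h3 : ‖x‖ ^ a * Real.exp (-c * ‖x‖ ^ (1 / s)) ≤ D ^ a * (a.factorial : ℝ) ^ s := by
    rw [neg_mul, Real.exp_neg, ← div_eq_mul_inv, div_le_iff₀ (Real.exp_pos _)]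
    exact h2
  have h4 : ‖iteratedFDeriv ℝ b (stretchedBump s c ρ) x‖ ≤
      7 ^ n * (K * Real.exp (-c * ‖x‖ ^ (1 / s)) * (A * h ^ b * (b.factorial : ℝ) ^ s)) := by
    refine (norm_iteratedFDeriv_translateSum_le hρ _ b x).trans ?_
    calc _ ≤ ∑ l ∈ nearLattice x,
          (K * Real.exp (-c * ‖x‖ ^ (1 / s)) * (A * h ^ b * (b.factorial : ℝ) ^ s)) := by
          refine Finset.sum_le_sum fun l hl => ?_
          rw [abs_of_pos (Real.exp_pos _)]
          gcongr
          · refine exp_neg_rpow_le_of_norm_sub_le ha0 ha1 hc.le ?_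
            rw [norm_sub_rev]
            exact norm_sub_le_of_mem_nearLattice hl
          · exact hb _ _
      _ = _ := by simp [card_nearLattice]
  calc ‖x‖ ^ a * ‖iteratedFDeriv ℝ b (stretchedBump s c ρ) x‖
      ≤ ‖x‖ ^ a *
        (7 ^ n * (K * Real.exp (-c * ‖x‖ ^ (1 / s)) * (A * h ^ b * (b.factorial : ℝ) ^ s))) := by
        gcongr
    _ = 7 ^ n * K * A * (‖x‖ ^ a * Real.exp (-c * ‖x‖ ^ (1 / s))) *
        (h ^ b * (b.factorial : ℝ) ^ s) := by ring
    _ ≤ 7 ^ n * K * A * (D ^ a * (a.factorial : ℝ) ^ s) * (h ^ b * (b.factorial : ℝ) ^ s) := by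
        gcongr
    _ ≤ 7 ^ n * K * A * ((max D h) ^ a * (a.factorial : ℝ) ^ s) *
        ((max D h) ^ b * (b.factorial : ℝ) ^ s) := by
        gcongr
        · exact le_max_left _ _
        · exact le_max_right _ _
    _ = _ := by rw [Real.mul_rpow (by positivity) (by positivity), pow_add]; ring

lemma exists_le_stretchedBump (hs : 1 < s) (hρ : GeneratesDecomposition s ρ) {c : ℝ} (hc : 0 < c) :
    ∃ δ : ℝ, 0 < δ ∧ ∀ x, δ * Real.exp (-c * ‖x‖ ^ (1 / s)) ≤ stretchedBump s c ρ x := by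
  have hs0 : 0 < s := by linarith
  have ha0 : 0 ≤ 1 / s := by positivity
  have ha1 : 1 / s ≤ 1 := by rw [div_le_one hs0]; exact hs.le
  obtain ⟨δ, hδ, hS⟩ := exists_le_translateSum_one hρ
  set K : ℝ := Real.exp (c * (n * 4) ^ (1 / s))
  have hK : 0 < K := Real.exp_pos _
  refine ⟨δ / K, by positivity, fun x => ?_⟩
  have hx := hS x
  unfold stretchedBump
  rw [translateSum_eq_sum hρ _ (ξ₀ := x) (by simp)] at hx ⊢
  rw [div_mul_eq_mul_div, div_le_iff₀ hK, Finset.sum_mul]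
  calc δ * Real.exp (-c * ‖x‖ ^ (1 / s))
      ≤ (∑ l ∈ nearLattice x, (1 : (Fin n → ℤ) → ℝ) l * ρ (x - latticePoint l)) *
        Real.exp (-c * ‖x‖ ^ (1 / s)) := by gcongr
    _ ≤ _ := by
        rw [Finset.sum_mul]
        refine Finset.sum_le_sum fun l hl => ?_
        have h0 := (hρ.mem_Icc (x - latticePoint l)).1
        have := exp_neg_rpow_le_of_norm_sub_le ha0 ha1 hc.le (norm_sub_le_of_mem_nearLattice hl)
        simp only [Pi.one_apply, one_mul]
        nlinarith

/-- The functional is tested on the positive functions `stretchedBump`, which dominate stretched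
exponentials of any rate. Dividing by a nonvanishing one of them also yields the measurability of f.
-/
theorem MemGelfandShilovDual.stretchedIntegrable (hs : 1 < s) (hρ : GeneratesDecomposition s ρ)
    {f : EuclideanSpace ℝ (Fin n) → ℂ} (hf : MemGelfandShilovDual s f) :
    StretchedIntegrable (1 / s) f := by
  have key : ∀ c : ℝ, 0 < c → Integrable fun x => f x * (stretchedBump s c ρ x : ℂ) :=
    fun c hc => hf.1 _ (memGelfandShilov_stretchedBump hs hρ hc)
  have hcont : ∀ c : ℝ, Continuous fun x => (stretchedBump s c ρ x : ℂ) := fun c =>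
    Complex.continuous_ofReal.comp (contDiff_translateSum hρ _).continuous
  have hmeas : AEStronglyMeasurable f volume := by
    obtain ⟨δ, hδ, hb⟩ := exists_le_stretchedBump hs hρ one_pos
    have hne : ∀ x, (stretchedBump s 1 ρ x : ℂ) ≠ 0 := fun x => by
      have := hb x
      have h2 : 0 < δ * Real.exp (-1 * ‖x‖ ^ (1 / s)) := by positivity
      exact_mod_cast (h2.trans_le this).ne'
    have h1 : f = fun x => (f x * (stretchedBump s 1 ρ x : ℂ)) * (stretchedBump s 1 ρ x : ℂ)⁻¹ := by
      ext x; rw [mul_inv_cancel_right₀ (hne x)]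
    rw [h1]
    exact (key 1 one_pos).aestronglyMeasurable.mul
      ((hcont 1).inv₀ hne).aestronglyMeasurable
  refine ⟨hmeas, fun c hc => ?_⟩
  obtain ⟨δ, hδ, hb⟩ := exists_le_stretchedBump hs hρ hc
  refine ((key c hc).norm.const_mul δ⁻¹).mono' (hmeas.norm.mul (by
    refine Continuous.aestronglyMeasurable ?_
    have : Continuous fun x : EuclideanSpace ℝ (Fin n) => ‖x‖ ^ (1 / s) :=
      continuous_norm.rpow_const fun x => Or.inr (by positivity)
    fun_prop)) (Filter.Eventually.of_forall fun x => ?_)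
  rw [Real.norm_of_nonneg (by positivity), norm_mul, Complex.norm_real, Real.norm_eq_abs]
  have h1 := hb x
  have h2 : Real.exp (-c * ‖x‖ ^ (1 / s)) ≤ δ⁻¹ * |stretchedBump s c ρ x| := by
    rw [inv_mul_eq_div, le_div_iff₀ hδ, mul_comm]
    exact h1.trans (le_abs_self _)
  calc _ ≤ ‖f x‖ * (δ⁻¹ * |stretchedBump s c ρ x|) := by gcongr
    _ = _ := by ring

end

/-- Only b = 0 and a ∈ {0, n+1} enter: this decay is just enough for integrability. The bound is
linear in C, as membership in the dual requires. -/
lemma norm_le_of_gelfandShilovBound {s h C : ℝ} {ψ : EuclideanSpace ℝ (Fin n) → ℂ}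
    (hψ : GelfandShilovBound s h C ψ) (x : EuclideanSpace ℝ (Fin n)) :
    ‖ψ x‖ ≤ C * (2 ^ (n + 1) * (1 + h ^ (n + 1) * ((n + 1).factorial : ℝ) ^ s)) *
      (1 + ‖x‖) ^ (-((n : ℝ) + 1)) := by
  have h0 := hψ 0 0 x
  have h1 := hψ (n + 1) 0 x
  simp only [pow_zero, one_mul, norm_iteratedFDeriv_zero, add_zero, Nat.factorial_zero,
    Nat.cast_one, mul_one, Real.one_rpow] at h0 h1
  have hx := norm_nonneg x
  have h2 : (1 + ‖x‖) ^ (n + 1) ≤ 2 ^ (n + 1) * (1 + ‖x‖ ^ (n + 1)) := by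
    rcases le_total ‖x‖ 1 with hle | hle
    · calc (1 + ‖x‖) ^ (n + 1) ≤ 2 ^ (n + 1) := by gcongr; linarith
        _ ≤ _ := le_mul_of_one_le_right (by positivity) (by
          have : 0 ≤ ‖x‖ ^ (n + 1) := by positivity
          linarith)
    · calc (1 + ‖x‖) ^ (n + 1) ≤ (2 * ‖x‖) ^ (n + 1) := by gcongr; linarith
        _ = 2 ^ (n + 1) * ‖x‖ ^ (n + 1) := mul_pow _ _ _
        _ ≤ _ := by gcongr; linarith
  have h3 : (1 + ‖x‖) ^ (-((n : ℝ) + 1)) = ((1 + ‖x‖) ^ (n + 1))⁻¹ := by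
    rw [Real.rpow_neg (by positivity)]
    norm_cast
  rw [h3, ← div_eq_mul_inv, le_div_iff₀ (by positivity)]
  calc ‖ψ x‖ * (1 + ‖x‖) ^ (n + 1) ≤ ‖ψ x‖ * (2 ^ (n + 1) * (1 + ‖x‖ ^ (n + 1))) := by gcongr
    _ = 2 ^ (n + 1) * (‖ψ x‖ + ‖x‖ ^ (n + 1) * ‖ψ x‖) := by ring
    _ ≤ 2 ^ (n + 1) * (C + C * h ^ (n + 1) * ((n + 1).factorial : ℝ) ^ s) := by gcongr
    _ = _ := by ring

/-- This puts e^{iu} - 1 into the dual space, and also gives access to `StretchedIntegrable` for all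
bounded functions. -/
theorem memGelfandShilovDual_of_bounded {s M : ℝ} {f : EuclideanSpace ℝ (Fin n) → ℂ}
    (hf : AEStronglyMeasurable f volume) (hM : ∀ x, ‖f x‖ ≤ M) : MemGelfandShilovDual s f := by
  have hM0 : 0 ≤ M := (norm_nonneg _).trans (hM 0)
  have hint : Integrable fun x : EuclideanSpace ℝ (Fin n) => (1 + ‖x‖) ^ (-((n : ℝ) + 1)) :=
    integrable_one_add_norm (by simp)
  refine ⟨fun ψ hψ => ?_, fun h _ => ⟨M * (2 ^ (n + 1) * (1 + h ^ (n + 1) *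
    ((n + 1).factorial : ℝ) ^ s)) * ∫ x : EuclideanSpace ℝ (Fin n), (1 + ‖x‖) ^ (-((n : ℝ) + 1)),
    fun ψ C hψ hb => ?_⟩⟩
  · obtain ⟨hsm, h, -, C, hb⟩ := hψ
    have : Integrable ψ := (hint.const_mul _).mono' hsm.continuous.aestronglyMeasurable
      (Filter.Eventually.of_forall (norm_le_of_gelfandShilovBound hb))
    exact this.bdd_mul hf (Filter.Eventually.of_forall hM)
  · refine (norm_integral_le_of_norm_le ((hint.const_mul (C * (2 ^ (n + 1) * (1 + h ^ (n + 1) *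
      ((n + 1).factorial : ℝ) ^ s)))).const_mul M) (Filter.Eventually.of_forall fun x => ?_)).trans
      (le_of_eq ?_)
    · rw [norm_mul]
      gcongr
      · exact hM x
      · exact norm_le_of_gelfandShilovBound hb x
    · rw [integral_const_mul, integral_const_mul]; ring

end GevreyModulation

end

noncomputable section

namespace GevreyModulation

variable {n : ℕ}

open MeasureTheory FourierTransform

/-! ### Fourier inversion and Parseval's formula for kernels -/

lemma norm_exp_I_mul_ofReal (r : ℝ) : ‖Complex.exp (Complex.I * (r : ℂ))‖ = 1 := by
  rw [mul_comm]; exact Complex.norm_exp_ofReal_mul_I r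

lemma continuous_exp_I_inner {X : Type*} [TopologicalSpace X]
    {f g : X → EuclideanSpace ℝ (Fin n)} (hf : Continuous f) (hg : Continuous g) :
    Continuous fun x => Complex.exp (Complex.I * (inner ℝ (f x) (g x) : ℝ)) := by
  have : Continuous fun x => ((inner ℝ (f x) (g x) : ℝ) : ℂ) :=
    Complex.continuous_ofReal.comp (hf.inner hg)
  fun_prop

lemma integrable_mul_exp_I_inner {σ : EuclideanSpace ℝ (Fin n) → ℂ} (hσ : Integrable σ)
    {g h : EuclideanSpace ℝ (Fin n) → EuclideanSpace ℝ (Fin n)} (hg : Continuous g)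
    (hh : Continuous h) :
    Integrable fun ξ => σ ξ * Complex.exp (Complex.I * (inner ℝ (g ξ) (h ξ) : ℝ)) :=
  hσ.mul_bdd (c := 1) (continuous_exp_I_inner hg hh).aestronglyMeasurable
    (Filter.Eventually.of_forall fun _ => (norm_exp_I_mul_ofReal _).le)

lemma continuous_kernel {σ : EuclideanSpace ℝ (Fin n) → ℂ} (hσ : Integrable σ) :
    Continuous (kernel σ) := by
  refine continuous_const.mul (continuous_of_dominated (bound := fun ξ => ‖σ ξ‖) (fun z => ?_)
    (fun z => Filter.Eventually.of_forall fun ξ => ?_) hσ.norm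
    (Filter.Eventually.of_forall fun ξ => ?_))
  · exact (integrable_mul_exp_I_inner hσ continuous_const continuous_id).aestronglyMeasurable
  · rw [norm_mul, norm_exp_I_mul_ofReal, mul_one]
  · exact continuous_const.mul (continuous_exp_I_inner continuous_id continuous_const)

/-- Parseval's formula. -/
lemma integral_mul_kernel {ψ τ : EuclideanSpace ℝ (Fin n) → ℂ} (hψ : Integrable ψ)
    (hτ : Integrable τ) (ε : ℝ) (x : EuclideanSpace ℝ (Fin n)) :
    ∫ y, ψ y * kernel τ (ε • y + x) = (((2 * Real.pi) ^ n)⁻¹ : ℝ) *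
      ∫ ξ, τ ξ * Complex.exp (Complex.I * (inner ℝ x ξ : ℝ)) *
        ∫ y, ψ y * Complex.exp (Complex.I * (inner ℝ (ε • y) ξ : ℝ)) := by
  have hint : Integrable (Function.uncurry fun y ξ : EuclideanSpace ℝ (Fin n) =>
      ψ y * (τ ξ * Complex.exp (Complex.I * (inner ℝ (ε • y + x) ξ : ℝ)))) (volume.prod volume) := by
    have h1 : Integrable (fun p : EuclideanSpace ℝ (Fin n) × EuclideanSpace ℝ (Fin n) =>
        ψ p.1 * τ p.2) (volume.prod volume) := hψ.mul_prod hτ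
    have hc : Continuous fun p : EuclideanSpace ℝ (Fin n) × EuclideanSpace ℝ (Fin n) =>
        Complex.exp (Complex.I * (inner ℝ (ε • p.1 + x) p.2 : ℝ)) :=
      continuous_exp_I_inner (by fun_prop) continuous_snd
    have h2 := h1.mul_bdd (c := 1) hc.aestronglyMeasurable
      (Filter.Eventually.of_forall fun _ => (norm_exp_I_mul_ofReal _).le)
    refine h2.congr (Filter.Eventually.of_forall fun p => ?_)
    simp [Function.uncurry, mul_assoc]
  unfold kernel
  have e1 : ∀ y : EuclideanSpace ℝ (Fin n), ψ y * ((((2 * Real.pi) ^ n)⁻¹ : ℝ) *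
      ∫ ξ, τ ξ * Complex.exp (Complex.I * (inner ℝ (ε • y + x) ξ : ℝ))) =
      (((2 * Real.pi) ^ n)⁻¹ : ℝ) *
        ∫ ξ, ψ y * (τ ξ * Complex.exp (Complex.I * (inner ℝ (ε • y + x) ξ : ℝ))) := fun y => by
    rw [integral_const_mul]; ring
  simp_rw [e1]
  rw [integral_const_mul, integral_integral_swap hint]
  congr 2
  ext ξ
  rw [← integral_const_mul]
  congr 1
  ext y
  rw [inner_add_left, Complex.ofReal_add, mul_add, Complex.exp_add]
  ring

/-- Injectivity of the Fourier transform on L¹: every test function is, after a dilation by 2π, the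
kernel of a Schwartz symbol, so Parseval's formula moves the pairing to the vanishing transform of
g. -/
lemma ae_eq_zero_of_forall_integral_mul_exp_eq_zero {g : EuclideanSpace ℝ (Fin n) → ℂ}
    (hg : Integrable g)
    (h : ∀ η, ∫ x, g x * Complex.exp (Complex.I * (inner ℝ x η : ℝ)) = 0) :
    ∀ᵐ x, g x = 0 := by
  refine ae_eq_zero_of_integral_contDiff_smul_eq_zero hg.locallyIntegrable fun φ hφ hφc => ?_
  let Φ : SchwartzMap (EuclideanSpace ℝ (Fin n)) ℂ :=
    HasCompactSupport.toSchwartzMap (f := fun x => (φ x : ℂ))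
      (hφc.comp_left Complex.ofReal_zero) (Complex.ofRealCLM.contDiff.comp hφ)
  let Θ : SchwartzMap (EuclideanSpace ℝ (Fin n)) ℂ := 𝓕 Φ
  have hΘ : 𝓕⁻ Θ = Φ := FourierTransform.fourierInv_fourier_eq Φ
  have hΦ : ∀ x, (φ x : ℂ) = ((2 * Real.pi) ^ n : ℝ) * kernel Θ ((2 * Real.pi) • x + 0) := by
    intro x
    have hpi : (2 * Real.pi) ≠ 0 := by positivity
    rw [kernel_eq_fourierInv, add_zero, inv_smul_smul₀ hpi, ← mul_assoc, ← Complex.ofReal_mul,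
      mul_inv_cancel₀ (by positivity), Complex.ofReal_one, one_mul, ← SchwartzMap.fourierInv_coe, hΘ]
    rfl
  have h1 : ∀ x, φ x • g x =
      ((2 * Real.pi) ^ n : ℝ) * (g x * kernel Θ ((2 * Real.pi) • x + 0)) := fun x => by
    rw [Complex.real_smul, hΦ x]; ring
  simp_rw [h1]
  rw [integral_const_mul, integral_mul_kernel hg Θ.integrable]
  have h2 : ∀ ξ, ∫ y, g y * Complex.exp (Complex.I * (inner ℝ ((2 * Real.pi) • y) ξ : ℝ)) = 0 :=
    fun ξ => by
      rw [← h ((2 * Real.pi) • ξ)]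
      simp_rw [inner_smul_left, inner_smul_right]
      simp
  simp_rw [h2]
  simp

/-- Fourier inversion, transferred between the normalization with 2π in the exponent and the one of
`kernel` by the dilation z ↦ 2πz. -/
lemma integral_kernel_mul_exp {σ : EuclideanSpace ℝ (Fin n) → ℂ} (hc : Continuous σ)
    (hσ : Integrable σ) (hK : Integrable (kernel σ)) (ξ : EuclideanSpace ℝ (Fin n)) :
    ∫ z, kernel σ z * Complex.exp (Complex.I * (inner ℝ (-z) ξ : ℝ)) = σ ξ := by
  have hpi : (2 * Real.pi) ≠ 0 := by positivity
  have e : ∀ w, 𝓕⁻ σ w = ((2 * Real.pi) ^ n : ℝ) * kernel σ ((2 * Real.pi) • w) := fun w => by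
    rw [kernel_eq_fourierInv, inv_smul_smul₀ hpi, ← mul_assoc, ← Complex.ofReal_mul,
      mul_inv_cancel₀ (by positivity), Complex.ofReal_one, one_mul]
  have hinv : Integrable (𝓕⁻ σ) := by
    rw [funext e]
    exact ((integrable_comp_smul_iff volume _ hpi).2 hK).const_mul _
  have hF : Integrable (𝓕 σ) := by
    have : 𝓕 σ = fun w => 𝓕⁻ σ (-w) := by
      ext w; rw [Real.fourierInv_eq_fourier_neg, neg_neg]
    rw [this]
    exact hinv.comp_neg
  have h1 := congrFun (hc.fourier_fourierInv_eq hσ hF) ξ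
  rw [Real.fourier_eq'] at h1
  rw [← h1]
  have h2 := Measure.integral_comp_smul volume (fun z => kernel σ z *
    Complex.exp (Complex.I * (inner ℝ (-z) ξ : ℝ))) (2 * Real.pi)
  rw [finrank_euclideanSpace_fin, abs_of_pos (by positivity)] at h2
  have h3 : (∫ z, kernel σ z * Complex.exp (Complex.I * (inner ℝ (-z) ξ : ℝ))) =
      ((2 * Real.pi) ^ n : ℝ) * ∫ z, kernel σ ((2 * Real.pi) • z) *
        Complex.exp (Complex.I * (inner ℝ (-((2 * Real.pi) • z)) ξ : ℝ)) := by
    rw [h2, Complex.real_smul, ← mul_assoc, ← Complex.ofReal_mul, mul_inv_cancel₀ (by positivity),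
      Complex.ofReal_one, one_mul]
  rw [h3, ← integral_const_mul]
  congr 1
  ext z
  rw [e, smul_eq_mul, inner_neg_left, inner_smul_left]
  have : Complex.I * ((-((starRingEnd ℝ) (2 * Real.pi) * inner ℝ z ξ) : ℝ) : ℂ) =
      ((-2 * Real.pi * inner ℝ z ξ : ℝ) : ℂ) * Complex.I := by
    simp; ring
  rw [this]
  ring

/-! ### Convolutions -/

/-- The convolution of `f` with a kernel `K`. -/
def conv (f K : EuclideanSpace ℝ (Fin n) → ℂ) (x : EuclideanSpace ℝ (Fin n)) : ℂ :=
  ∫ y, f y * K (x - y)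

lemma box_eq_conv (ρ : EuclideanSpace ℝ (Fin n) → ℝ) (k : Fin n → ℤ)
    (f : EuclideanSpace ℝ (Fin n) → ℂ) : box ρ k f = conv f (boxKernel ρ k) := rfl

lemma conv_kernel_kernel {σ τ : EuclideanSpace ℝ (Fin n) → ℂ} (hc : Continuous σ)
    (hσ : Integrable σ) (hK : Integrable (kernel σ)) (hτ : Integrable τ) :
    conv (kernel σ) (kernel τ) = kernel fun ξ => σ ξ * τ ξ := by
  ext x
  -- The dilation parameter -1 turns Parseval's formula into a statement on convolutions.
  have h := integral_mul_kernel hK hτ (-1) x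
  have e : ∀ y, x - y = (-1 : ℝ) • y + x := fun y => by rw [neg_one_smul]; abel
  simp only [conv, e]
  rw [h, kernel]
  congr 2
  ext ξ
  simp only [neg_one_smul]
  rw [integral_kernel_mul_exp hc hσ hK]
  ring

lemma conv_congr_ae {f g : EuclideanSpace ℝ (Fin n) → ℂ} (h : f =ᵐ[volume] g)
    (K : EuclideanSpace ℝ (Fin n) → ℂ) : conv f K = conv g K := by
  ext x
  refine integral_congr_ae ?_
  filter_upwards [h] with y hy
  rw [hy]

/-- A continuous function which decays like a stretched exponential. -/
structure StretchedDecay (a : ℝ) (K : EuclideanSpace ℝ (Fin n) → ℂ) : Prop where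
  continuous : Continuous K
  decay : ∃ c C : ℝ, 0 < c ∧ 0 < C ∧ ∀ z, ‖K z‖ ≤ C * Real.exp (-c * ‖z‖ ^ a)

lemma StretchedDecay.add {a : ℝ} {K L : EuclideanSpace ℝ (Fin n) → ℂ} (hK : StretchedDecay a K)
    (hL : StretchedDecay a L) : StretchedDecay a fun z => K z + L z := by
  obtain ⟨c, C, hc, hC, h⟩ := hK.decay
  obtain ⟨c', C', hc', hC', h'⟩ := hL.decay
  refine ⟨hK.continuous.add hL.continuous, min c c', C + C', lt_min hc hc', by positivity,
    fun z => ?_⟩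
  calc ‖K z + L z‖ ≤ ‖K z‖ + ‖L z‖ := norm_add_le _ _
    _ ≤ C * Real.exp (-c * ‖z‖ ^ a) + C' * Real.exp (-c' * ‖z‖ ^ a) := add_le_add (h z) (h' z)
    _ ≤ C * Real.exp (-(min c c') * ‖z‖ ^ a) + C' * Real.exp (-(min c c') * ‖z‖ ^ a) := by
        gcongr
        · exact min_le_left _ _
        · exact min_le_right _ _
    _ = _ := by ring

lemma StretchedDecay.sum {a : ℝ} {ι : Type*} {K : ι → EuclideanSpace ℝ (Fin n) → ℂ} (t : Finset ι)
    (hK : ∀ i ∈ t, StretchedDecay a (K i)) : StretchedDecay a fun z => ∑ i ∈ t, K i z := by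
  classical
  induction t using Finset.induction_on with
  | empty => exact ⟨by simpa using continuous_const, 1, 1, one_pos, one_pos, fun z => by
      simpa using (Real.exp_pos _).le⟩
  | insert i t hi ih =>
    simp_rw [Finset.sum_insert hi]
    exact (hK i (by simp)).add (ih fun j hj => hK j (by simp [hj]))

/-! ### Convolutions with kernels of stretched exponential decay -/

section

variable {s : ℝ} {ρ : EuclideanSpace ℝ (Fin n) → ℝ}

lemma StretchedIntegrable.of_bounded (hs : 1 < s) (hρ : GeneratesDecomposition s ρ) {M : ℝ}
    {f : EuclideanSpace ℝ (Fin n) → ℂ} (hf : AEStronglyMeasurable f volume)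
    (hM : ∀ x, ‖f x‖ ≤ M) : StretchedIntegrable (1 / s) f :=
  (memGelfandShilovDual_of_bounded hf hM).stretchedIntegrable hs hρ

/-- The case of the constant function 1, which is bounded and hence in the dual space. -/
lemma integrable_exp_neg_mul_rpow (hs : 1 < s) (hρ : GeneratesDecomposition s ρ) {c : ℝ}
    (hc : 0 < c) : Integrable fun x : EuclideanSpace ℝ (Fin n) =>
      Real.exp (-c * ‖x‖ ^ (1 / s)) := by
  have := (StretchedIntegrable.of_bounded hs hρ (f := fun _ => (1 : ℂ)) (M := 1)
    aestronglyMeasurable_const (by simp)).integrable c hc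
  simpa using this

lemma StretchedDecay.integrable (hs : 1 < s) (hρ : GeneratesDecomposition s ρ)
    {K : EuclideanSpace ℝ (Fin n) → ℂ} (hK : StretchedDecay (1 / s) K) : Integrable K := by
  obtain ⟨c, C, hc, -, h⟩ := hK.decay
  exact ((integrable_exp_neg_mul_rpow hs hρ hc).const_mul C).mono'
    hK.continuous.aestronglyMeasurable (Filter.Eventually.of_forall h)

/-- Half of the decay is traded, by the triangle inequality, for decay in y that f can be integrated
against; half of the second factor is kept for integrability in z. -/
lemma exp_mul_exp_le {c : ℝ} (hs : 1 < s) (hc : 0 < c)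
    (x y z : EuclideanSpace ℝ (Fin n)) :
    Real.exp (-c * ‖z - y‖ ^ (1 / s)) * Real.exp (-c * ‖x - z‖ ^ (1 / s)) ≤
      Real.exp (c / 2 * ‖x‖ ^ (1 / s)) * (Real.exp (-(c / 2) * ‖y‖ ^ (1 / s)) *
        Real.exp (-(c / 2) * ‖x - z‖ ^ (1 / s))) := by
  have hs0 : 0 < s := by linarith
  have ha0 : 0 ≤ 1 / s := by positivity
  have ha1 : 1 / s ≤ 1 := by rw [div_le_one hs0]; exact hs.le
  rw [← Real.exp_add, ← Real.exp_add, ← Real.exp_add]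
  refine Real.exp_le_exp.2 ?_
  have h1 : ‖y‖ ≤ ‖x‖ + (‖z - y‖ + ‖x - z‖) := by
    calc ‖y‖ = ‖x - ((z - y) + (x - z))‖ := by congr 1; abel
      _ ≤ ‖x‖ + ‖(z - y) + (x - z)‖ := norm_sub_le _ _
      _ ≤ _ := by gcongr; exact norm_add_le _ _
  have h2 : ‖y‖ ^ (1 / s) ≤ ‖x‖ ^ (1 / s) + (‖z - y‖ ^ (1 / s) + ‖x - z‖ ^ (1 / s)) :=
    (Real.rpow_le_rpow (norm_nonneg _) h1 ha0).trans
      ((add_rpow_le_add_rpow ha0 ha1 (norm_nonneg _) (by positivity)).trans (by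
        gcongr; exact add_rpow_le_add_rpow ha0 ha1 (norm_nonneg _) (norm_nonneg _)))
  have h3 : 0 ≤ ‖z - y‖ ^ (1 / s) := by positivity
  nlinarith

lemma exp_neg_norm_sub_le {c : ℝ} (hs : 1 < s) (hc : 0 < c) (x y : EuclideanSpace ℝ (Fin n)) :
    Real.exp (-c * ‖x - y‖ ^ (1 / s)) ≤
      Real.exp (c * ‖x‖ ^ (1 / s)) * Real.exp (-c * ‖y‖ ^ (1 / s)) := by
  have hs0 : 0 < s := by linarith
  have ha1 : 1 / s ≤ 1 := by rw [div_le_one hs0]; exact hs.le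
  have := exp_neg_rpow_le_of_norm_sub_le (a := 1 / s) (by positivity) ha1 hc.le
    (x := x - y) (y := -y) (B := ‖x‖) (by simp)
  simpa using this

lemma StretchedIntegrable.integrable_mul (hs : 1 < s) {f K : EuclideanSpace ℝ (Fin n) → ℂ}
    (hf : StretchedIntegrable (1 / s) f) (hK : StretchedDecay (1 / s) K)
    (x : EuclideanSpace ℝ (Fin n)) : Integrable fun y => f y * K (x - y) := by
  obtain ⟨c, C, hc, hC, h⟩ := hK.decay
  refine ((hf.integrable c hc).const_mul (C * Real.exp (c * ‖x‖ ^ (1 / s)))).mono'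
    (hf.aestronglyMeasurable.mul
      (hK.continuous.comp (by fun_prop : Continuous fun y => x - y)).aestronglyMeasurable)
    (Filter.Eventually.of_forall fun y => ?_)
  rw [norm_mul]
  calc ‖f y‖ * ‖K (x - y)‖ ≤ ‖f y‖ * (C * (Real.exp (c * ‖x‖ ^ (1 / s)) *
        Real.exp (-c * ‖y‖ ^ (1 / s)))) := by
        gcongr
        exact (h _).trans (by gcongr; exact exp_neg_norm_sub_le hs hc x y)
    _ = _ := by ring

lemma StretchedIntegrable.aestronglyMeasurable_conv {f K : EuclideanSpace ℝ (Fin n) → ℂ} {a : ℝ}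
    (hf : StretchedIntegrable a f) (hK : StretchedDecay a K) :
    AEStronglyMeasurable (conv f K) volume := by
  have h1 : AEStronglyMeasurable (fun p : EuclideanSpace ℝ (Fin n) × EuclideanSpace ℝ (Fin n) =>
      f p.2 * K (p.1 - p.2)) (volume.prod volume) :=
    hf.aestronglyMeasurable.comp_snd.mul
      (hK.continuous.comp (by fun_prop : Continuous fun p :
        EuclideanSpace ℝ (Fin n) × EuclideanSpace ℝ (Fin n) => p.1 - p.2)).aestronglyMeasurable
  exact h1.integral_prod_right'

/-- Fubini's theorem. Since f is integrable only against stretched exponentials, the integrand is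
dominated through `exp_mul_exp_le`. -/
lemma conv_conv (hs : 1 < s) (hρ : GeneratesDecomposition s ρ)
    {f K L : EuclideanSpace ℝ (Fin n) → ℂ} (hf : StretchedIntegrable (1 / s) f)
    (hK : StretchedDecay (1 / s) K) (hL : StretchedDecay (1 / s) L) :
    conv (conv f K) L = conv f (conv K L) := by
  ext x
  obtain ⟨c₁, C₁, hc₁, hC₁, h₁⟩ := hK.decay
  obtain ⟨c₂, C₂, hc₂, hC₂, h₂⟩ := hL.decay
  set c := min c₁ c₂
  have hc : 0 < c := lt_min hc₁ hc₂
  have hint : Integrable (Function.uncurry fun z y : EuclideanSpace ℝ (Fin n) =>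
      f y * K (z - y) * L (x - z)) (volume.prod volume) := by
    have hG : Integrable fun z : EuclideanSpace ℝ (Fin n) =>
        Real.exp (-(c / 2) * ‖x - z‖ ^ (1 / s)) :=
      (integrable_exp_neg_mul_rpow hs hρ (half_pos hc)).comp_sub_left x
    have hprod := (hG.mul_prod (hf.integrable (c / 2) (half_pos hc))).const_mul
      (C₁ * C₂ * Real.exp (c / 2 * ‖x‖ ^ (1 / s)))
    refine hprod.mono' ?_ (Filter.Eventually.of_forall fun p => ?_)
    · refine (hf.aestronglyMeasurable.comp_snd.mul (Continuous.aestronglyMeasurable ?_)).mul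
        (Continuous.aestronglyMeasurable ?_)
      · exact hK.continuous.comp (by fun_prop)
      · exact hL.continuous.comp (by fun_prop)
    · obtain ⟨z, y⟩ := p
      simp only [Function.uncurry, norm_mul]
      calc ‖f y‖ * ‖K (z - y)‖ * ‖L (x - z)‖
          ≤ ‖f y‖ * (C₁ * Real.exp (-c * ‖z - y‖ ^ (1 / s))) *
            (C₂ * Real.exp (-c * ‖x - z‖ ^ (1 / s))) := by
            gcongr
            · refine (h₁ _).trans ?_
              gcongr
              exact min_le_left _ _
            · refine (h₂ _).trans ?_
              gcongr
              exact min_le_right _ _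
        _ = ‖f y‖ * (C₁ * C₂) * (Real.exp (-c * ‖z - y‖ ^ (1 / s)) *
              Real.exp (-c * ‖x - z‖ ^ (1 / s))) := by ring
        _ ≤ ‖f y‖ * (C₁ * C₂) * (Real.exp (c / 2 * ‖x‖ ^ (1 / s)) *
              (Real.exp (-(c / 2) * ‖y‖ ^ (1 / s)) *
                Real.exp (-(c / 2) * ‖x - z‖ ^ (1 / s)))) := by
            gcongr ‖f y‖ * (C₁ * C₂) * ?_
            exact exp_mul_exp_le hs hc x y z
        _ = _ := by ring
  unfold conv
  calc ∫ z, (∫ y, f y * K (z - y)) * L (x - z) = ∫ z, ∫ y, f y * K (z - y) * L (x - z) := by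
        simp_rw [integral_mul_const]
    _ = ∫ y, ∫ z, f y * K (z - y) * L (x - z) := integral_integral_swap hint
    _ = ∫ y, f y * ∫ z, K z * L (x - y - z) := by
        congr 1
        ext y
        rw [← integral_sub_right_eq_self (fun z => K z * L (x - y - z)) y, ← integral_const_mul]
        congr 1
        ext z
        rw [mul_assoc, sub_sub_sub_cancel_right]

end

end GevreyModulation

end

noncomputable section

namespace GevreyModulation

variable {n : ℕ}

open MeasureTheory

section

variable {s : ℝ} {ρ : EuclideanSpace ℝ (Fin n) → ℝ}

/-! ### Algebra of the kernels of the decomposition operators -/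

/-- The kernel of the Fourier multiplier whose symbol is the basic window, translated by `η`. -/
def modKernel (ρ : EuclideanSpace ℝ (Fin n) → ℝ) (η : EuclideanSpace ℝ (Fin n)) :
    EuclideanSpace ℝ (Fin n) → ℂ :=
  kernel fun ξ => (decomp ρ 0 (ξ - η) : ℂ)

lemma boxKernel_eq_modKernel (k : Fin n → ℤ) : boxKernel ρ k = modKernel ρ (latticePoint k) := by
  rw [boxKernel_eq_kernel, modKernel]
  simp_rw [← decomp_eq_decomp_zero]

/-- Translating the symbol only modulates the kernel, so all size and decay estimates are uniform in
η. Arbitrary real centers η are needed below to detect that a function vanishes. -/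
lemma modKernel_eq (η z : EuclideanSpace ℝ (Fin n)) :
    modKernel ρ η z = Complex.exp (Complex.I * (inner ℝ z η : ℝ)) * boxKernel ρ 0 z := by
  rw [modKernel, kernel, boxKernel_eq_kernel, kernel,
    ← integral_sub_right_eq_self (fun ξ => (decomp ρ 0 ξ : ℂ) *
      Complex.exp (Complex.I * (inner ℝ z ξ : ℝ))) η, mul_left_comm]
  congr 1
  rw [← integral_const_mul]
  refine integral_congr_ae (Filter.Eventually.of_forall fun ξ => ?_)
  beta_reduce
  rw [inner_sub_right, mul_left_comm, ← Complex.exp_add]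
  congr 2
  push_cast
  ring

lemma norm_modKernel (η z : EuclideanSpace ℝ (Fin n)) :
    ‖modKernel ρ η z‖ = ‖boxKernel ρ 0 z‖ := by
  rw [modKernel_eq, norm_mul, norm_exp_I_mul_ofReal, one_mul]

lemma norm_boxKernel (k : Fin n → ℤ) (z : EuclideanSpace ℝ (Fin n)) :
    ‖boxKernel ρ k z‖ = ‖boxKernel ρ 0 z‖ := by
  rw [boxKernel_eq_modKernel, norm_modKernel]

lemma integrable_decomp_sub (hρ : GeneratesDecomposition s ρ) (η : EuclideanSpace ℝ (Fin n)) :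
    Integrable fun ξ => (decomp ρ 0 (ξ - η) : ℂ) :=
  (decompSchwartz hρ 0).integrable.comp_sub_right η

lemma continuous_decomp_sub (hρ : GeneratesDecomposition s ρ) (η : EuclideanSpace ℝ (Fin n)) :
    Continuous fun ξ => (decomp ρ 0 (ξ - η) : ℂ) :=
  (decompSchwartz hρ 0).continuous.comp (by fun_prop : Continuous fun ξ => ξ - η)

lemma stretchedDecay_modKernel (hs : 1 < s) (hρ : GeneratesDecomposition s ρ)
    (η : EuclideanSpace ℝ (Fin n)) : StretchedDecay (1 / s) (modKernel ρ η) := by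
  obtain ⟨c, C, hc, hC, h⟩ := exists_norm_boxKernel_zero_le hs.le hρ
  exact ⟨continuous_kernel (integrable_decomp_sub hρ η), c, C, hc, hC, fun z => by
    rw [norm_modKernel]; exact h z⟩

lemma stretchedDecay_boxKernel (hs : 1 < s) (hρ : GeneratesDecomposition s ρ) (k : Fin n → ℤ) :
    StretchedDecay (1 / s) (boxKernel ρ k) := by
  rw [boxKernel_eq_modKernel]; exact stretchedDecay_modKernel hs hρ _

lemma conv_boxKernel_modKernel (hs : 1 < s) (hρ : GeneratesDecomposition s ρ) (k : Fin n → ℤ)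
    (η : EuclideanSpace ℝ (Fin n)) : conv (boxKernel ρ k) (modKernel ρ η) =
      kernel fun ξ => (decomp ρ k ξ : ℂ) * (decomp ρ 0 (ξ - η) : ℂ) := by
  have h := conv_kernel_kernel (continuous_decomp_sub hρ (latticePoint k))
    (integrable_decomp_sub hρ (latticePoint k))
    ((stretchedDecay_modKernel hs hρ (latticePoint k)).integrable hs hρ)
    (integrable_decomp_sub hρ η)
  simp_rw [← decomp_eq_decomp_zero] at h
  exact h

lemma integrable_decomp_mul_decomp_sub (hρ : GeneratesDecomposition s ρ) (k : Fin n → ℤ)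
    (η : EuclideanSpace ℝ (Fin n)) :
    Integrable fun ξ => (decomp ρ k ξ : ℂ) * (decomp ρ 0 (ξ - η) : ℂ) := by
  refine (integrable_decomp_sub hρ η).bdd_mul (c := 1)
    (decompSchwartz hρ k).continuous.aestronglyMeasurable (Filter.Eventually.of_forall fun ξ => ?_)
  rw [Complex.norm_real, Real.norm_of_nonneg (decomp_mem_Icc hρ k ξ).1]
  exact (decomp_mem_Icc hρ k ξ).2

lemma stretchedDecay_conv (hs : 1 < s) (hρ : GeneratesDecomposition s ρ) (k : Fin n → ℤ)
    (η : EuclideanSpace ℝ (Fin n)) :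
    StretchedDecay (1 / s) (conv (boxKernel ρ k) (modKernel ρ η)) := by
  obtain ⟨c, C, hc, hC, h⟩ := exists_norm_boxKernel_zero_le hs.le hρ
  have hexp := integrable_exp_neg_mul_rpow hs hρ (half_pos hc)
  set I := ∫ x : EuclideanSpace ℝ (Fin n), Real.exp (-(c / 2) * ‖x‖ ^ (1 / s)) with hI
  have hI0 : 0 ≤ I := integral_nonneg fun _ => (Real.exp_pos _).le
  refine ⟨?_, c / 2, C * C * (I + 1), half_pos hc, by positivity, fun x => ?_⟩
  · rw [conv_boxKernel_modKernel hs hρ]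
    exact continuous_kernel (integrable_decomp_mul_decomp_sub hρ k η)
  · have hle : ∀ y, ‖boxKernel ρ k y * modKernel ρ η (x - y)‖ ≤
        C * C * Real.exp (-(c / 2) * ‖x‖ ^ (1 / s)) *
          Real.exp (-(c / 2) * ‖x - y‖ ^ (1 / s)) := fun y => by
      have h1 := exp_mul_exp_le hs hc 0 (-x) (y - x)
      have h2 : (0 : ℝ) ^ (1 / s) = 0 := Real.zero_rpow (by positivity)
      rw [zero_sub, neg_sub, sub_neg_eq_add, sub_add_cancel, norm_neg, norm_zero, h2, mul_zero,
        Real.exp_zero, one_mul] at h1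
      rw [norm_mul, norm_boxKernel, norm_modKernel]
      calc _ ≤ (C * Real.exp (-c * ‖y‖ ^ (1 / s))) * (C * Real.exp (-c * ‖x - y‖ ^ (1 / s))) := by
            gcongr
            · exact h _
            · exact h _
        _ = C * C * (Real.exp (-c * ‖y‖ ^ (1 / s)) * Real.exp (-c * ‖x - y‖ ^ (1 / s))) := by ring
        _ ≤ C * C * (Real.exp (-(c / 2) * ‖x‖ ^ (1 / s)) *
            Real.exp (-(c / 2) * ‖x - y‖ ^ (1 / s))) := by gcongr
        _ = _ := by ring
    refine (norm_integral_le_of_norm_le ((hexp.comp_sub_left x).const_mul _)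
      (Filter.Eventually.of_forall hle)).trans ?_
    rw [integral_const_mul, integral_sub_left_eq_self
      (fun y : EuclideanSpace ℝ (Fin n) => Real.exp (-(c / 2) * ‖y‖ ^ (1 / s))) volume x, ← hI]
    have : 0 ≤ C * C * Real.exp (-(c / 2) * ‖x‖ ^ (1 / s)) := by positivity
    nlinarith

lemma mem_nearLattice_of_decomp_ne_zero (hρ : GeneratesDecomposition s ρ) {k : Fin n → ℤ}
    {η ξ : EuclideanSpace ℝ (Fin n)} (h₁ : decomp ρ k ξ ≠ 0) (h₂ : decomp ρ 0 (ξ - η) ≠ 0) :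
    k ∈ nearLattice η := by
  refine Fintype.mem_piFinset.2 fun i => Finset.mem_Icc.2 ?_
  have h1 := abs_le.1 (abs_coord_sub_le_of_decomp_ne_zero hρ h₁ i)
  have h2 := abs_le.1 (abs_coord_sub_le_of_decomp_ne_zero hρ h₂ i)
  have h3 := Int.floor_le (η i)
  have h4 := Int.lt_floor_add_one (η i)
  simp only [PiLp.sub_apply, Pi.zero_apply, Int.cast_zero, sub_zero] at h2
  constructor
  · have : ((⌊η i⌋ : ℝ) - 3) ≤ k i := by linarith
    exact_mod_cast this
  · have : (k i : ℝ) ≤ (⌊η i⌋ : ℝ) + 3 := by linarith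
    exact_mod_cast this

lemma conv_boxKernel_modKernel_eq_zero (hs : 1 < s) (hρ : GeneratesDecomposition s ρ)
    {k : Fin n → ℤ} {η : EuclideanSpace ℝ (Fin n)} (hk : k ∉ nearLattice η) :
    conv (boxKernel ρ k) (modKernel ρ η) = 0 := by
  rw [conv_boxKernel_modKernel hs hρ]
  have : (fun ξ => (decomp ρ k ξ : ℂ) * (decomp ρ 0 (ξ - η) : ℂ)) = fun _ => 0 := by
    ext ξ
    by_contra h
    exact hk (mem_nearLattice_of_decomp_ne_zero hρ
      (Complex.ofReal_ne_zero.1 (left_ne_zero_of_mul h))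
      (Complex.ofReal_ne_zero.1 (right_ne_zero_of_mul h)))
  rw [this]
  ext z
  simp [kernel]

/-- On the support of the window at η the finitely many symbols with index in `nearLattice η`
already add up to 1. -/
lemma sum_conv_boxKernel_modKernel (hs : 1 < s) (hρ : GeneratesDecomposition s ρ)
    (η z : EuclideanSpace ℝ (Fin n)) :
    ∑ k ∈ nearLattice η, conv (boxKernel ρ k) (modKernel ρ η) z = modKernel ρ η z := by
  simp_rw [conv_boxKernel_modKernel hs hρ]
  simp only [kernel, modKernel]
  rw [← Finset.mul_sum, ← integral_finsetSum]
  · congr 2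
    ext ξ
    rw [← Finset.sum_mul, ← Finset.sum_mul]
    by_cases h : decomp ρ 0 (ξ - η) = 0
    · simp [h]
    · have h1 := sum_decomp_eq_one hρ (ξ := ξ) (t := nearLattice η) fun k hk =>
        mem_nearLattice_of_decomp_ne_zero hρ hk h
      rw [← Complex.ofReal_sum, h1, Complex.ofReal_one, one_mul]
  · intro k _
    exact integrable_mul_exp_I_inner (integrable_decomp_mul_decomp_sub hρ k η) continuous_const
      continuous_id

/-! ### Reconstruction from the decomposition operators -/

lemma aestronglyMeasurable_box (hs : 1 < s) (hρ : GeneratesDecomposition s ρ)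
    {f : EuclideanSpace ℝ (Fin n) → ℂ} (hf : StretchedIntegrable (1 / s) f) (k : Fin n → ℤ) :
    AEStronglyMeasurable (box ρ k f) volume :=
  hf.aestronglyMeasurable_conv (stretchedDecay_boxKernel hs hρ k)

lemma aestronglyMeasurable_tsum {ι : Type*} [Countable ι]
    {F : ι → EuclideanSpace ℝ (Fin n) → ℂ} {M : ι → ℝ} (hM : Summable M)
    (hF : ∀ i, AEStronglyMeasurable (F i) volume) (hb : ∀ i x, ‖F i x‖ ≤ M i) :
    AEStronglyMeasurable (fun x => ∑' i, F i x) volume := by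
  refine aestronglyMeasurable_of_tendsto_ae (Filter.atTop : Filter (Finset ι))
    (f := fun t x => ∑ i ∈ t, F i x) (fun t => ?_) (Filter.Eventually.of_forall fun x => ?_)
  · exact Finset.aestronglyMeasurable_fun_sum t fun i _ => hF i
  · exact (Summable.of_norm_bounded hM fun i => hb i x).hasSum

lemma norm_tsum_le_tsum_of_norm_le {ι : Type*} {F : ι → EuclideanSpace ℝ (Fin n) → ℂ} {M : ι → ℝ}
    (hM : Summable M) (hb : ∀ i x, ‖F i x‖ ≤ M i) (x : EuclideanSpace ℝ (Fin n)) :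
    ‖∑' i, F i x‖ ≤ ∑' i, M i :=
  tsum_of_norm_bounded hM.hasSum fun i => hb i x

lemma integral_tsum_mul {ι : Type*} [Countable ι]
    {F : ι → EuclideanSpace ℝ (Fin n) → ℂ} {M : ι → ℝ} (hM : Summable M)
    (hF : ∀ i, AEStronglyMeasurable (F i) volume) (hb : ∀ i x, ‖F i x‖ ≤ M i)
    {ψ : EuclideanSpace ℝ (Fin n) → ℂ} (hψ : Integrable ψ) :
    ∫ x, (∑' i, F i x) * ψ x = ∑' i, ∫ x, F i x * ψ x := by
  have hint : ∀ i, Integrable fun x => F i x * ψ x := fun i =>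
    hψ.bdd_mul (hF i) (Filter.Eventually.of_forall (hb i))
  simp_rw [← tsum_mul_right]
  refine (integral_tsum_of_summable_integral_norm hint ?_).symm
  refine Summable.of_nonneg_of_le (fun i => integral_nonneg fun _ => norm_nonneg _) (fun i => ?_)
    (hM.mul_right (∫ x, ‖ψ x‖))
  rw [← integral_const_mul]
  refine integral_mono (hint i).norm (hψ.norm.const_mul _) fun x => ?_
  simp only [norm_mul]
  gcongr
  exact hb i x

lemma conv_tsum (hs : 1 < s) (hρ : GeneratesDecomposition s ρ) {ι : Type*} [Countable ι]
    {F : ι → EuclideanSpace ℝ (Fin n) → ℂ} {M : ι → ℝ} (hM : Summable M)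
    (hF : ∀ i, AEStronglyMeasurable (F i) volume) (hb : ∀ i x, ‖F i x‖ ≤ M i)
    {K : EuclideanSpace ℝ (Fin n) → ℂ} (hK : StretchedDecay (1 / s) K)
    (x : EuclideanSpace ℝ (Fin n)) :
    conv (fun x => ∑' i, F i x) K x = ∑' i, conv (F i) K x :=
  integral_tsum_mul hM hF hb ((hK.integrable hs hρ).comp_sub_left x)

lemma boxKernel_zero_zero_ne (hs : 1 < s) (hρ : GeneratesDecomposition s ρ) :
    ∃ z, boxKernel ρ 0 z ≠ 0 := by
  by_contra! h
  have h0 : decomp ρ 0 (0 : EuclideanSpace ℝ (Fin n)) ≠ 0 := by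
    rw [decomp_eq_div, latticePoint_zero, sub_zero, hρ.eq_one 0 (by simp)]
    exact div_ne_zero one_ne_zero (translateSum_one_pos hρ _).ne'
  have h1 := integral_kernel_mul_exp (decompSchwartz hρ 0).continuous
    (decompSchwartz hρ 0).integrable
    ((stretchedDecay_boxKernel hs hρ 0).integrable hs hρ) (0 : EuclideanSpace ℝ (Fin n))
  have h2 : ∀ z, kernel (decompSchwartz hρ 0) z = 0 := h
  simp_rw [h2] at h1
  simp only [zero_mul, integral_zero] at h1
  exact h0 (Complex.ofReal_eq_zero.1 h1.symm)

/-- Injectivity of a short-time Fourier transform. Up to a phase, the convolution at y with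
frequency -η is the Fourier transform at η of x ↦ w(x) K(y - x), where K is `boxKernel ρ 0`; this
product thus vanishes almost everywhere for each y. -/
lemma ae_eq_zero_of_forall_conv_modKernel_eq_zero (hs : 1 < s) (hρ : GeneratesDecomposition s ρ)
    {w : EuclideanSpace ℝ (Fin n) → ℂ} (hw : StretchedIntegrable (1 / s) w)
    (h : ∀ η x, conv w (modKernel ρ η) x = 0) : ∀ᵐ x, w x = 0 := by
  have hK := stretchedDecay_boxKernel hs hρ (0 : Fin n → ℤ)
  have h1 : ∀ y, ∀ᵐ x, w x * boxKernel ρ 0 (y - x) = 0 := fun y => by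
    refine ae_eq_zero_of_forall_integral_mul_exp_eq_zero (hw.integrable_mul hs hK y) fun η => ?_
    have h2 := h (-η) y
    simp only [conv, modKernel_eq] at h2
    have h3 : ∀ x, w x * boxKernel ρ 0 (y - x) * Complex.exp (Complex.I * (inner ℝ x η : ℝ)) =
        Complex.exp (Complex.I * (inner ℝ y η : ℝ)) *
        (w x * (Complex.exp (Complex.I * (inner ℝ (y - x) (-η) : ℝ)) * boxKernel ρ 0 (y - x))) :=
      fun x => by
        have : Complex.exp (Complex.I * (inner ℝ x η : ℝ)) =
            Complex.exp (Complex.I * (inner ℝ y η : ℝ)) *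
              Complex.exp (Complex.I * (inner ℝ (y - x) (-η) : ℝ)) := by
          rw [← Complex.exp_add, inner_neg_right, inner_sub_left]
          congr 1
          push_cast
          ring
        rw [this]; ring
    simp_rw [h3]
    rw [integral_const_mul, h2, mul_zero]
  -- The kernel is nonzero on a ball, so countably many y from a dense set suffice to reach every x,
  -- and the exceptional null sets can be united.
  obtain ⟨z₀, hz₀⟩ := boxKernel_zero_zero_ne hs hρ
  obtain ⟨r, hr, hball⟩ := Metric.isOpen_iff.1 (hK.continuous.isOpen_preimage _
    (isOpen_compl_singleton (x := (0 : ℂ)))) z₀ hz₀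
  obtain ⟨D, hDc, hD⟩ := TopologicalSpace.exists_countable_dense (EuclideanSpace ℝ (Fin n))
  have h2 : ∀ᵐ x, ∀ y ∈ D, w x * boxKernel ρ 0 (y - x) = 0 :=
    (ae_ball_iff hDc).2 fun y _ => h1 y
  filter_upwards [h2] with x hx
  obtain ⟨y, hy, hyd⟩ := hD.exists_dist_lt (z₀ + x) hr
  have hne : boxKernel ρ 0 (y - x) ≠ 0 := hball (by
    rw [Metric.mem_ball, dist_eq_norm, sub_sub, add_comm x z₀, ← dist_eq_norm, dist_comm]
    exact hyd)
  exact (mul_eq_zero.1 (hx y hy)).resolve_right hne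

/-- The difference w between f and the sum of its blocks is annihilated by every window at η: only
finitely many blocks meet that window, and there their symbols add up to 1. -/
theorem ae_eq_tsum_box (hs : 1 < s) (hρ : GeneratesDecomposition s ρ)
    {f : EuclideanSpace ℝ (Fin n) → ℂ} (hf : StretchedIntegrable (1 / s) f)
    {M : (Fin n → ℤ) → ℝ} (hM : Summable M) (hb : ∀ k x, ‖box ρ k f x‖ ≤ M k) :
    ∀ᵐ x, f x = ∑' k, box ρ k f x := by
  have hmeas := fun k => aestronglyMeasurable_box hs hρ hf k
  set W := fun x => ∑' k, box ρ k f x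
  have hW : StretchedIntegrable (1 / s) W := StretchedIntegrable.of_bounded hs hρ
    (aestronglyMeasurable_tsum hM hmeas hb) (norm_tsum_le_tsum_of_norm_le hM hb)
  have hw : StretchedIntegrable (1 / s) fun x => f x - W x := by
    refine ⟨hf.aestronglyMeasurable.sub hW.aestronglyMeasurable, fun c hc => ?_⟩
    have hexp := integrable_exp_neg_mul_rpow hs hρ hc
    refine ((hf.integrable c hc).add (hW.integrable c hc)).mono'
      ((hf.aestronglyMeasurable.sub hW.aestronglyMeasurable).norm.mul hexp.aestronglyMeasurable)
      (Filter.Eventually.of_forall fun x => ?_)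
    rw [Real.norm_of_nonneg (by positivity), Pi.add_apply, ← add_mul]
    gcongr
    exact norm_sub_le _ _
  have hzero := ae_eq_zero_of_forall_conv_modKernel_eq_zero hs hρ hw fun η x => by
    have hK := stretchedDecay_modKernel hs hρ η
    have hterm : ∀ k, conv (box ρ k f) (modKernel ρ η) =
        conv f (conv (boxKernel ρ k) (modKernel ρ η)) := fun k =>
      conv_conv hs hρ hf (stretchedDecay_boxKernel hs hρ k) hK
    have h1 : conv W (modKernel ρ η) x = conv f (modKernel ρ η) x := by
      rw [conv_tsum hs hρ hM hmeas hb hK,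
        tsum_eq_sum (s := nearLattice η) fun k hk => by
          rw [hterm, conv_boxKernel_modKernel_eq_zero hs hρ hk]
          simp [conv]]
      simp_rw [hterm]
      have h3 : ∀ k, Integrable fun y =>
          f y * conv (boxKernel ρ k) (modKernel ρ η) (x - y) := fun k =>
        hf.integrable_mul hs (stretchedDecay_conv hs hρ k η) x
      unfold conv at h3 ⊢
      rw [← integral_finsetSum _ fun k _ => h3 k]
      congr 1
      ext y
      rw [← Finset.mul_sum]
      congr 1
      exact sum_conv_boxKernel_modKernel hs hρ η (x - y)
    have h5 : conv (fun x => f x - W x) (modKernel ρ η) x =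
        conv f (modKernel ρ η) x - conv W (modKernel ρ η) x := by
      unfold conv
      rw [← integral_sub (hf.integrable_mul hs hK x) (hW.integrable_mul hs hK x)]
      simp_rw [sub_mul]
    rw [h5, h1, sub_self]
  filter_upwards [hzero] with x hx
  exact sub_eq_zero.1 hx

end

end GevreyModulation

end

noncomputable section

namespace GevreyModulation

variable {n : ℕ}

open MeasureTheory

/-! ### Spectra of bounded functions -/

/-- The spectrum of `f` is contained in `A`: `f` annihilates every integrable function whose Fourier
transform vanishes on `-A`. -/
def HasSpectrumIn (f : EuclideanSpace ℝ (Fin n) → ℂ) (A : Set (EuclideanSpace ℝ (Fin n))) : Prop :=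
  ∀ ψ : EuclideanSpace ℝ (Fin n) → ℂ, Integrable ψ →
    (∀ ξ ∈ A, ∫ y, ψ y * Complex.exp (Complex.I * (inner ℝ y ξ : ℝ)) = 0) → ∫ y, f y * ψ y = 0

/-- The cube with center `c` and side length `2 P`. -/
def latticeCube (c : Fin n → ℤ) (P : ℝ) : Set (EuclideanSpace ℝ (Fin n)) :=
  {ξ | ∀ i, |ξ i - c i| ≤ P}

lemma add_mem_latticeCube {c c' : Fin n → ℤ} {P P' : ℝ} {ξ ξ' : EuclideanSpace ℝ (Fin n)}
    (h : ξ ∈ latticeCube c P) (h' : ξ' ∈ latticeCube c' P') :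
    ξ + ξ' ∈ latticeCube (c + c') (P + P') := fun i => by
  have h1 := abs_le.1 (h i)
  have h2 := abs_le.1 (h' i)
  simp only [PiLp.add_apply, Pi.add_apply, Int.cast_add]
  rw [abs_le]
  constructor <;> linarith

lemma latticeCube_mono (c : Fin n → ℤ) {P P' : ℝ} (h : P ≤ P') :
    latticeCube c P ⊆ latticeCube c P' := fun _ hξ i => (hξ i).trans h

namespace HasSpectrumIn

variable {f g : EuclideanSpace ℝ (Fin n) → ℂ} {A B : Set (EuclideanSpace ℝ (Fin n))}

lemma mono (hf : HasSpectrumIn f A) (h : A ⊆ B) : HasSpectrumIn f B :=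
  fun ψ hψ h0 => hf ψ hψ fun ξ hξ => h0 ξ (h hξ)

lemma const_mul (hf : HasSpectrumIn f A) (c : ℂ) : HasSpectrumIn (fun x => c * f x) A :=
  fun ψ hψ h0 => by
    simp_rw [mul_assoc]
    rw [integral_const_mul, hf ψ hψ h0, mul_zero]

lemma const (c : ℂ) : HasSpectrumIn (fun _ => c) (latticeCube (0 : Fin n → ℤ) 0) :=
  fun ψ _ h0 => by
    have := h0 0 fun i => by simp
    simp only [inner_zero_right, Complex.ofReal_zero, mul_zero, Complex.exp_zero, mul_one] at this
    rw [integral_const_mul, this, mul_zero]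

lemma zero (A : Set (EuclideanSpace ℝ (Fin n))) : HasSpectrumIn (fun _ => 0) A :=
  fun ψ _ _ => by simp

lemma add {M M' : ℝ} (hf : HasSpectrumIn f A) (hg : HasSpectrumIn g A)
    (hfm : AEStronglyMeasurable f volume) (hfb : ∀ x, ‖f x‖ ≤ M)
    (hgm : AEStronglyMeasurable g volume) (hgb : ∀ x, ‖g x‖ ≤ M') :
    HasSpectrumIn (fun x => f x + g x) A := fun ψ hψ h0 => by
  simp_rw [add_mul]
  rw [integral_add (hψ.bdd_mul hfm (Filter.Eventually.of_forall hfb))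
    (hψ.bdd_mul hgm (Filter.Eventually.of_forall hgb)), hf ψ hψ h0, hg ψ hψ h0, add_zero]

/-- Duality is used twice. The function g ψ is a test function for f; its transform at ξ is the
pairing of g with ψ e^{i⟨y,ξ⟩}, whose transform at ζ is that of ψ at ξ + ζ. -/
lemma mul {M : ℝ} {c c' : Fin n → ℤ} {P P' : ℝ} (hf : HasSpectrumIn f (latticeCube c P))
    (hg : HasSpectrumIn g (latticeCube c' P')) (hgm : AEStronglyMeasurable g volume)
    (hgb : ∀ x, ‖g x‖ ≤ M) :
    HasSpectrumIn (fun x => f x * g x) (latticeCube (c + c') (P + P')) := fun ψ hψ h0 => by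
  simp_rw [mul_assoc]
  refine hf _ (hψ.bdd_mul hgm (Filter.Eventually.of_forall hgb)) fun ξ hξ => ?_
  simp_rw [mul_assoc]
  refine hg _ (integrable_mul_exp_I_inner hψ continuous_id continuous_const) fun ζ hζ => ?_
  rw [← h0 (ξ + ζ) (add_mem_latticeCube hξ hζ)]
  congr 1
  ext y
  rw [mul_assoc, ← Complex.exp_add, inner_add_right]
  push_cast [id_eq]
  ring_nf

lemma conj {c : Fin n → ℤ} {P : ℝ} (hf : HasSpectrumIn f (latticeCube c P)) :
    HasSpectrumIn (fun x => (starRingEnd ℂ) (f x)) (latticeCube (-c) P) := fun ψ hψ h0 => by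
  have h1 : ∀ y, (starRingEnd ℂ) (f y) * ψ y =
      (starRingEnd ℂ) (f y * (starRingEnd ℂ) (ψ y)) := fun y => by simp
  have hψc : Integrable fun y => (starRingEnd ℂ) (ψ y) :=
    (Complex.conjCLE : ℂ →L[ℝ] ℂ).integrable_comp hψ
  simp_rw [h1]
  rw [integral_conj, hf _ hψc fun ξ hξ => ?_, map_zero]
  have h2 := h0 (-ξ) fun i => by
    have := hξ i
    rw [abs_sub_comm] at this
    simpa [neg_add_eq_sub] using this
  have h3 : ∀ y, (starRingEnd ℂ) (ψ y) * Complex.exp (Complex.I * (inner ℝ y ξ : ℝ)) =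
      (starRingEnd ℂ) (ψ y * Complex.exp (Complex.I * (inner ℝ y (-ξ) : ℝ))) := fun y => by
    rw [map_mul, ← Complex.exp_conj]
    simp
  simp_rw [h3]
  rw [integral_conj, h2, map_zero]

lemma tsum {ι : Type*} [Countable ι] {F : ι → EuclideanSpace ℝ (Fin n) → ℂ} {M : ι → ℝ}
    (hM : Summable M) (hF : ∀ i, AEStronglyMeasurable (F i) volume) (hb : ∀ i x, ‖F i x‖ ≤ M i)
    (hA : ∀ i, HasSpectrumIn (F i) A) : HasSpectrumIn (fun x => ∑' i, F i x) A :=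
  fun ψ hψ h0 => by
    rw [integral_tsum_mul hM hF hb hψ]
    simp [fun i => hA i ψ hψ h0]

lemma sum {ι : Type*} {F : ι → EuclideanSpace ℝ (Fin n) → ℂ} {M : ι → ℝ} (t : Finset ι)
    (hF : ∀ i ∈ t, AEStronglyMeasurable (F i) volume) (hb : ∀ i ∈ t, ∀ x, ‖F i x‖ ≤ M i)
    (hA : ∀ i ∈ t, HasSpectrumIn (F i) A) : HasSpectrumIn (fun x => ∑ i ∈ t, F i x) A :=
  fun ψ hψ h0 => by
    simp_rw [Finset.sum_mul]
    rw [integral_finsetSum _ fun i hi =>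
      hψ.bdd_mul (hF i hi) (Filter.Eventually.of_forall (hb i hi))]
    exact Finset.sum_eq_zero fun i hi => hA i hi ψ hψ h0

lemma pow {M P : ℝ} (hf : HasSpectrumIn f (latticeCube 0 P)) (hfm : AEStronglyMeasurable f volume)
    (hfb : ∀ x, ‖f x‖ ≤ M) (l : ℕ) :
    HasSpectrumIn (fun x => f x ^ l) (latticeCube 0 (l * P)) := by
  induction l with
  | zero => simpa using! const (n := n) 1
  | succ l ih =>
    have := ih.mul hf hfm hfb
    simp_rw [← pow_succ] at this
    convert this using 2
    · simp
    · push_cast; ring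

/-- After exchanging integrals, Parseval's formula turns the inner pairing into an integral of τ
times the transform of ψ; one of the two vanishes at each frequency. -/
lemma conv_kernel {M : ℝ} {τ K : EuclideanSpace ℝ (Fin n) → ℂ} (hK : Integrable K)
    (hfm : AEStronglyMeasurable f volume) (hfb : ∀ x, ‖f x‖ ≤ M) (hτ : Integrable τ)
    (hKτ : K = kernel τ) (hA : ∀ ξ, ξ ∉ A → τ ξ = 0) : HasSpectrumIn (conv f K) A := by
  intro ψ hψ h0
  have hint : Integrable (Function.uncurry fun x y : EuclideanSpace ℝ (Fin n) =>
      f y * K (x - y) * ψ x) (volume.prod volume) := by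
    have h1 : Integrable (fun p : EuclideanSpace ℝ (Fin n) × EuclideanSpace ℝ (Fin n) =>
        ψ p.2 * K (p.1 - p.2)) (volume.prod volume) :=
      hψ.convolution_integrand (ContinuousLinearMap.mul ℂ ℂ) hK
    have h2 : Integrable (fun p : EuclideanSpace ℝ (Fin n) × EuclideanSpace ℝ (Fin n) =>
        ψ p.1 * K (p.1 - p.2)) (volume.prod volume) := by
      have hK' : Integrable fun z => K (-z) := hK.comp_neg
      have h3 : Integrable (fun p : EuclideanSpace ℝ (Fin n) × EuclideanSpace ℝ (Fin n) =>
        ψ p.2 * K (-(p.1 - p.2))) (volume.prod volume) :=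
        hψ.convolution_integrand (ContinuousLinearMap.mul ℂ ℂ) hK'
      have h4 := h3.swap
      refine h4.congr (Filter.Eventually.of_forall fun p => ?_)
      simp [Function.comp]
    have h5 := h2.bdd_mul (f := fun p : EuclideanSpace ℝ (Fin n) × EuclideanSpace ℝ (Fin n) =>
      f p.2) hfm.comp_snd (Filter.Eventually.of_forall fun p => hfb p.2)
    refine h5.congr (Filter.Eventually.of_forall fun p => ?_)
    simp only [Function.uncurry]
    ring
  unfold conv
  simp_rw [← integral_mul_const]
  rw [integral_integral_swap hint]
  have h1 : ∀ y, ∫ x, f y * K (x - y) * ψ x = 0 := fun y => by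
    have h2 : ∀ x, f y * K (x - y) * ψ x = f y * (ψ x * kernel τ ((1 : ℝ) • x + -y)) := fun x => by
      rw [hKτ, one_smul, ← sub_eq_add_neg]; ring
    simp_rw [h2]
    rw [integral_const_mul, integral_mul_kernel hψ hτ]
    have h3 : ∀ ξ, τ ξ * Complex.exp (Complex.I * (inner ℝ (-y) ξ : ℝ)) *
        ∫ x, ψ x * Complex.exp (Complex.I * (inner ℝ ((1 : ℝ) • x) ξ : ℝ)) = 0 := fun ξ => by
      by_cases hξ : ξ ∈ A
      · simp_rw [one_smul]
        rw [h0 ξ hξ, mul_zero]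
      · rw [hA ξ hξ, zero_mul, zero_mul]
    simp_rw [h3]
    simp
  simp_rw [h1]
  simp

end HasSpectrumIn

/-! ### Reproducing kernels and spectra of the frequency blocks -/

section

variable {s : ℝ} {ρ : EuclideanSpace ℝ (Fin n) → ℝ}

/-- The sum of the kernels of the decomposition operators near `k`; it reproduces the range of
`□_k`. -/
def reproKernel (ρ : EuclideanSpace ℝ (Fin n) → ℝ) (k : Fin n → ℤ)
    (z : EuclideanSpace ℝ (Fin n)) : ℂ :=
  ∑ l ∈ nearLattice (latticePoint k), boxKernel ρ l z

lemma stretchedDecay_reproKernel (hs : 1 < s) (hρ : GeneratesDecomposition s ρ) (k : Fin n → ℤ) :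
    StretchedDecay (1 / s) (reproKernel ρ k) :=
  StretchedDecay.sum _ fun l _ => stretchedDecay_boxKernel hs hρ l

lemma norm_reproKernel_le (k : Fin n → ℤ) (z : EuclideanSpace ℝ (Fin n)) :
    ‖reproKernel ρ k z‖ ≤ 7 ^ n * ‖boxKernel ρ 0 z‖ := by
  refine (norm_sum_le _ _).trans (le_of_eq ?_)
  simp_rw [norm_boxKernel]
  simp [card_nearLattice]

lemma conv_boxKernel_comm (hs : 1 < s) (hρ : GeneratesDecomposition s ρ) (k l : Fin n → ℤ) :
    conv (boxKernel ρ k) (boxKernel ρ l) = conv (boxKernel ρ l) (boxKernel ρ k) := by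
  rw [boxKernel_eq_modKernel l, conv_boxKernel_modKernel hs hρ, ← boxKernel_eq_modKernel,
    boxKernel_eq_modKernel k, conv_boxKernel_modKernel hs hρ]
  simp_rw [← decomp_eq_decomp_zero, mul_comm]

lemma conv_boxKernel_reproKernel (hs : 1 < s) (hρ : GeneratesDecomposition s ρ) (k : Fin n → ℤ) :
    conv (boxKernel ρ k) (reproKernel ρ k) = boxKernel ρ k := by
  ext z
  have hint : ∀ l, Integrable fun y => boxKernel ρ k y * boxKernel ρ l (z - y) := fun l => by
    obtain ⟨c, C, hc, hC, h⟩ := (stretchedDecay_boxKernel hs hρ k).decay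
    refine ((stretchedDecay_boxKernel hs hρ l).integrable hs hρ |>.comp_sub_left z).bdd_mul (c := C)
      (stretchedDecay_boxKernel hs hρ k).continuous.aestronglyMeasurable
      (Filter.Eventually.of_forall fun y => (h y).trans ?_)
    refine mul_le_of_le_one_right hC.le (Real.exp_le_one_iff.2 ?_)
    have : 0 ≤ ‖y‖ ^ (1 / s) := by positivity
    nlinarith
  have h1 := sum_conv_boxKernel_modKernel hs hρ (latticePoint k) z
  rw [← boxKernel_eq_modKernel] at h1
  rw [← h1]
  simp_rw [fun l => conv_boxKernel_comm hs hρ l k]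
  unfold conv reproKernel
  rw [← integral_finsetSum _ fun l _ => hint l]
  simp_rw [Finset.mul_sum]

theorem box_eq_conv_reproKernel (hs : 1 < s) (hρ : GeneratesDecomposition s ρ)
    {f : EuclideanSpace ℝ (Fin n) → ℂ} (hf : StretchedIntegrable (1 / s) f) (k : Fin n → ℤ) :
    box ρ k f = conv (box ρ k f) (reproKernel ρ k) := by
  rw [box_eq_conv, conv_conv hs hρ hf (stretchedDecay_boxKernel hs hρ k)
    (stretchedDecay_reproKernel hs hρ k), conv_boxKernel_reproKernel hs hρ]

/-- As f need not be bounded, `HasSpectrumIn.conv_kernel` is applied to the bounded block convolved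
with its reproducing kernel. The radius 4 is 3 from `nearLattice` plus 1 from the support of ρ. -/
theorem hasSpectrumIn_box (hs : 1 < s) (hρ : GeneratesDecomposition s ρ) {M : ℝ}
    {f : EuclideanSpace ℝ (Fin n) → ℂ} (hf : StretchedIntegrable (1 / s) f) {k : Fin n → ℤ}
    (hb : ∀ x, ‖box ρ k f x‖ ≤ M) : HasSpectrumIn (box ρ k f) (latticeCube k 4) := by
  rw [box_eq_conv_reproKernel hs hρ hf k]
  refine HasSpectrumIn.conv_kernel
    (τ := fun ξ => ∑ l ∈ nearLattice (latticePoint k), (decomp ρ l ξ : ℂ))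
    ((stretchedDecay_reproKernel hs hρ k).integrable hs hρ)
    (aestronglyMeasurable_box hs hρ hf k) hb
    (integrable_finsetSum _ fun l _ => (decompSchwartz hρ l).integrable) ?_ fun ξ hξ => ?_
  · ext z
    simp only [reproKernel, boxKernel_eq_kernel, kernel]
    rw [← Finset.mul_sum, ← integral_finsetSum]
    · simp_rw [Finset.sum_mul]
    · intro l _
      exact integrable_mul_exp_I_inner (decompSchwartz hρ l).integrable continuous_const
        continuous_id
  · refine Finset.sum_eq_zero fun l hl => ?_
    by_contra hne
    refine hξ fun i => ?_
    have h1 := abs_le.1 (abs_coord_sub_le_of_decomp_ne_zero hρ (Complex.ofReal_ne_zero.1 hne) i)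
    have h2 := Finset.mem_Icc.1 (Fintype.mem_piFinset.1 hl i)
    rw [latticePoint_apply, Int.floor_intCast] at h2
    have h3 : ((k i : ℝ) - 3) ≤ l i := by exact_mod_cast h2.1
    have h4 : (l i : ℝ) ≤ (k i : ℝ) + 3 := by exact_mod_cast h2.2
    rw [abs_le]
    constructor <;> linarith

/-- The value at x is the pairing of f with z ↦ K(x - z), whose transform at ξ is a phase times the
symbol at ξ. -/
theorem box_eq_zero_of_hasSpectrumIn (hs : 1 < s) (hρ : GeneratesDecomposition s ρ)
    {f : EuclideanSpace ℝ (Fin n) → ℂ} {A : Set (EuclideanSpace ℝ (Fin n))}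
    (hf : HasSpectrumIn f A) {m : Fin n → ℤ} (hA : ∀ ξ ∈ A, decomp ρ m ξ = 0) :
    box ρ m f = 0 := by
  ext x
  have hK := (stretchedDecay_boxKernel hs hρ m).integrable hs hρ
  refine hf _ (hK.comp_sub_left x) fun ξ hξ => ?_
  have h1 := integral_kernel_mul_exp (decompSchwartz hρ m).continuous
    (decompSchwartz hρ m).integrable hK ξ
  rw [decompSchwartz_apply, hA ξ hξ, Complex.ofReal_zero] at h1
  rw [← integral_sub_left_eq_self _ volume x]
  have h2 : ∀ z, boxKernel ρ m (x - (x - z)) *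
      Complex.exp (Complex.I * (inner ℝ (x - z) ξ : ℝ)) =
      Complex.exp (Complex.I * (inner ℝ x ξ : ℝ)) * (kernel (decompSchwartz hρ m) z *
        Complex.exp (Complex.I * (inner ℝ (-z) ξ : ℝ))) := fun z => by
    rw [sub_sub_cancel, sub_eq_add_neg, inner_add_left, Complex.ofReal_add, mul_add,
      Complex.exp_add, boxKernel_eq_kernel]
    change kernel (decompSchwartz hρ m) z * _ = _
    ring
  simp_rw [h2]
  rw [integral_const_mul, h1, mul_zero]

theorem abs_sub_le_of_box_ne_zero (hs : 1 < s) (hρ : GeneratesDecomposition s ρ)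
    {f : EuclideanSpace ℝ (Fin n) → ℂ} {c m : Fin n → ℤ} {P : ℝ}
    (hf : HasSpectrumIn f (latticeCube c P)) (hm : box ρ m f ≠ 0) (i : Fin n) :
    |(m i : ℝ) - c i| ≤ P + 1 := by
  by_contra! h
  refine hm (box_eq_zero_of_hasSpectrumIn hs hρ hf fun ξ hξ => ?_)
  by_contra hne
  have h1 := abs_coord_sub_le_of_decomp_ne_zero hρ hne i
  have h2 := hξ i
  have : |(m i : ℝ) - c i| ≤ |ξ i - c i| + |ξ i - m i| := by
    rw [abs_sub_comm (ξ i) (m i), add_comm]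
    exact abs_sub_le _ _ _
  linarith

end

end GevreyModulation

end

noncomputable section

namespace GevreyModulation

open MeasureTheory
open scoped ENNReal

/-! ### Integral inequalities -/

section Minkowski

variable {X : Type*} [MeasurableSpace X] {μ : Measure X}

/-- Hölder's inequality after the splitting K = K^(1/p') K^(1/p), that is, Jensen's inequality for
the measure with density K. The case p = 1 has no finite conjugate exponent and is separate. -/
lemma lintegral_mul_rpow_le {p : ℝ} (hp : 1 ≤ p) {K g : X → ℝ≥0∞} (hK : AEMeasurable K μ)
    (hg : AEMeasurable g μ) :
    (∫⁻ x, K x * g x ∂μ) ^ p ≤ (∫⁻ x, K x ∂μ) ^ (p - 1) * ∫⁻ x, K x * g x ^ p ∂μ := by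
  rcases hp.eq_or_lt with rfl | hp1
  · simp
  have hp0 : 0 < p := by linarith
  have hpq := Real.HolderConjugate.conjExponent hp1
  set p' := p.conjExponent
  have hp'0 : 0 < p' := hpq.symm.pos
  have h1 : ∀ x, K x * g x = K x ^ (1 / p') * (K x ^ (1 / p) * g x) := fun x => by
    rw [← mul_assoc, ← ENNReal.rpow_add_of_nonneg _ _ (by positivity) (by positivity)]
    have : 1 / p' + 1 / p = 1 := by
      have := hpq.inv_add_inv_eq_one
      rw [one_div, one_div]; linarith
    rw [this, ENNReal.rpow_one]
  simp_rw [h1]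
  have h2 := ENNReal.lintegral_mul_le_Lp_mul_Lq μ hpq.symm (hK.pow_const (1 / p'))
    ((hK.pow_const (1 / p)).mul hg)
  simp only [Pi.mul_apply] at h2
  have h3 : ∀ x, (K x ^ (1 / p')) ^ p' = K x := fun x => by
    rw [← ENNReal.rpow_mul, one_div_mul_cancel hp'0.ne', ENNReal.rpow_one]
  have h4 : ∀ x, (K x ^ (1 / p) * g x) ^ p = K x * g x ^ p := fun x => by
    rw [ENNReal.mul_rpow_of_nonneg _ _ hp0.le, ← ENNReal.rpow_mul, one_div_mul_cancel hp0.ne',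
      ENNReal.rpow_one]
  simp_rw [h3, h4] at h2
  calc _ ≤ ((∫⁻ x, K x ∂μ) ^ (1 / p') * (∫⁻ x, K x * g x ^ p ∂μ) ^ (1 / p)) ^ p :=
        ENNReal.rpow_le_rpow h2 hp0.le
    _ = _ := by
        rw [ENNReal.mul_rpow_of_nonneg _ _ hp0.le, ← ENNReal.rpow_mul, ← ENNReal.rpow_mul,
          one_div_mul_cancel hp0.ne', ENNReal.rpow_one]
        congr 2
        have := hpq.sub_one_mul_conj
        field_simp
        linarith

lemma lintegral_rpow_sum_le {p : ℝ} (hp : 1 ≤ p) {ι : Type*} {g : ι → X → ℝ≥0∞}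
    (hg : ∀ i, AEMeasurable (g i) μ) (t : Finset ι) :
    (∫⁻ x, (∑ i ∈ t, g i x) ^ p ∂μ) ^ (1 / p) ≤ ∑ i ∈ t, (∫⁻ x, g i x ^ p ∂μ) ^ (1 / p) := by
  have hp0 : 0 < p := by linarith
  classical
  induction t using Finset.induction_on with
  | empty => simp [ENNReal.zero_rpow_of_pos hp0, hp0]
  | insert i t hi ih =>
    simp_rw [Finset.sum_insert hi]
    exact (ENNReal.lintegral_Lp_add_le (hg i)
      (Finset.aemeasurable_fun_sum t fun j _ => hg j) hp).trans (add_le_add le_rfl ih)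

/-- Minkowski's inequality for countable sums. -/
lemma lintegral_rpow_tsum_le {p : ℝ} (hp : 1 ≤ p) {ι : Type*} [Countable ι] {g : ι → X → ℝ≥0∞}
    (hg : ∀ i, AEMeasurable (g i) μ) :
    (∫⁻ x, (∑' i, g i x) ^ p ∂μ) ^ (1 / p) ≤ ∑' i, (∫⁻ x, g i x ^ p ∂μ) ^ (1 / p) := by
  have hp0 : 0 < p := by linarith
  have h1 : ∀ x, (∑' i, g i x) ^ p = ⨆ t : Finset ι, (∑ i ∈ t, g i x) ^ p := fun x => by
    rw [ENNReal.tsum_eq_iSup_sum]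
    exact (ENNReal.orderIsoRpow p hp0).map_iSup _
  simp_rw [h1]
  rw [lintegral_iSup_directed]
  · rw [one_div, ENNReal.rpow_inv_le_iff hp0]
    refine iSup_le fun t => ?_
    rw [← ENNReal.rpow_inv_le_iff hp0, ← one_div]
    exact (lintegral_rpow_sum_le hp hg t).trans (ENNReal.sum_le_tsum t)
  · exact fun t => (Finset.aemeasurable_fun_sum t fun i _ => hg i).pow_const p
  · refine (Monotone.directed_le fun t t' htt x => ?_)
    exact ENNReal.rpow_le_rpow (Finset.sum_le_sum_of_subset htt) hp0.le

lemma eLpNorm_ofReal_eq {p : ℝ} (hp : 1 ≤ p) (f : X → ℂ) :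
    eLpNorm f (ENNReal.ofReal p) μ = (∫⁻ x, ‖f x‖ₑ ^ p ∂μ) ^ (1 / p) := by
  have hp0 : 0 < p := by linarith
  rw [eLpNorm_eq_lintegral_rpow_enorm_toReal (by simpa using hp0) ENNReal.ofReal_ne_top,
    ENNReal.toReal_ofReal hp0.le]

lemma eLpNorm_tsum_le {p : ℝ} (hp : 1 ≤ p) {ι : Type*} [Countable ι] {f : ι → X → ℂ}
    (hf : ∀ i, AEStronglyMeasurable (f i) μ) :
    eLpNorm (fun x => ∑' i, f i x) (ENNReal.ofReal p) μ ≤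
      ∑' i, eLpNorm (f i) (ENNReal.ofReal p) μ := by
  have hp0 : 0 < p := by linarith
  simp_rw [eLpNorm_ofReal_eq hp]
  refine le_trans ?_ (lintegral_rpow_tsum_le hp fun i => (hf i).enorm)
  gcongr with x
  exact enorm_tsum_le_tsum_enorm

end Minkowski

/-! ### Young's inequality and the bound from L^p to L^∞ -/

section Young

variable {n : ℕ}

lemma enorm_conv_rpow_le {p : ℝ} (hp : 1 ≤ p) {f K : EuclideanSpace ℝ (Fin n) → ℂ}
    (hf : AEStronglyMeasurable f volume) (hK : Continuous K) (x : EuclideanSpace ℝ (Fin n)) :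
    ‖conv f K x‖ₑ ^ p ≤
      (∫⁻ z, ‖K z‖ₑ) ^ (p - 1) * ∫⁻ y, ‖K (x - y)‖ₑ * ‖f y‖ₑ ^ p := by
  have hp0 : 0 < p := by linarith
  have hKx : Continuous fun y => K (x - y) := hK.comp (by fun_prop)
  calc ‖conv f K x‖ₑ ^ p ≤ (∫⁻ y, ‖K (x - y)‖ₑ * ‖f y‖ₑ) ^ p := by
        refine ENNReal.rpow_le_rpow ?_ hp0.le
        refine (enorm_integral_le_lintegral_enorm _).trans (le_of_eq ?_)
        refine lintegral_congr fun y => ?_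
        rw [enorm_mul, mul_comm]
    _ ≤ _ := lintegral_mul_rpow_le hp hKx.aestronglyMeasurable.enorm hf.enorm
    _ = _ := by rw [lintegral_sub_left_eq_self (fun z => ‖K z‖ₑ) x]

/-- Young's inequality. -/
lemma eLpNorm_conv_le {p : ℝ} (hp : 1 ≤ p) {f K : EuclideanSpace ℝ (Fin n) → ℂ}
    (hf : AEStronglyMeasurable f volume) (hK : Continuous K) :
    eLpNorm (conv f K) (ENNReal.ofReal p) volume ≤
      (∫⁻ z, ‖K z‖ₑ) * eLpNorm f (ENNReal.ofReal p) volume := by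
  have hp0 : 0 < p := by linarith
  rw [eLpNorm_ofReal_eq hp, eLpNorm_ofReal_eq hp, one_div, ENNReal.rpow_inv_le_iff hp0,
    ENNReal.mul_rpow_of_nonneg _ _ hp0.le, ENNReal.rpow_inv_rpow hp0.ne']
  set κ := ∫⁻ z, ‖K z‖ₑ
  have hKy : ∀ y, Continuous fun x => K (x - y) := fun y => hK.comp (by fun_prop)
  calc ∫⁻ x, ‖conv f K x‖ₑ ^ p
      ≤ ∫⁻ x, κ ^ (p - 1) * ∫⁻ y, ‖K (x - y)‖ₑ * ‖f y‖ₑ ^ p :=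
        lintegral_mono fun x => enorm_conv_rpow_le hp hf hK x
    _ ≤ κ ^ (p - 1) * ∫⁻ x, ∫⁻ y, ‖K (x - y)‖ₑ * ‖f y‖ₑ ^ p := by
        rw [lintegral_const_mul'']
        refine AEMeasurable.lintegral_prod_right' (f := fun q : EuclideanSpace ℝ (Fin n) ×
          EuclideanSpace ℝ (Fin n) => ‖K (q.1 - q.2)‖ₑ * ‖f q.2‖ₑ ^ p) ?_
        refine AEMeasurable.mul ?_ (hf.comp_snd.enorm.pow_const p)
        exact (hK.comp (by fun_prop : Continuous fun q : EuclideanSpace ℝ (Fin n) ×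
          EuclideanSpace ℝ (Fin n) => q.1 - q.2)).aestronglyMeasurable.enorm
    _ = κ ^ (p - 1) * ∫⁻ y, ∫⁻ x, ‖K (x - y)‖ₑ * ‖f y‖ₑ ^ p := by
        rw [lintegral_lintegral_swap]
        refine AEMeasurable.mul ?_ (hf.comp_snd.enorm.pow_const p)
        exact (hK.comp (by fun_prop : Continuous fun q : EuclideanSpace ℝ (Fin n) ×
          EuclideanSpace ℝ (Fin n) => q.1 - q.2)).aestronglyMeasurable.enorm
    _ = κ ^ (p - 1) * ∫⁻ y, κ * ‖f y‖ₑ ^ p := by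
        congr 1
        refine lintegral_congr fun y => ?_
        rw [lintegral_mul_const'' _ (hKy y).aestronglyMeasurable.enorm, lintegral_sub_right_eq_self (fun z => ‖K z‖ₑ) y]
    _ = κ ^ p * ∫⁻ y, ‖f y‖ₑ ^ p := by
        rw [lintegral_const_mul'' _ (hf.enorm.pow_const p), ← mul_assoc]
        congr 1
        nth_rewrite 2 [← ENNReal.rpow_one κ]
        rw [← ENNReal.rpow_add_of_nonneg _ _ (by linarith) zero_le_one, sub_add_cancel]

lemma enorm_conv_le {p : ℝ} (hp : 1 ≤ p) {f K : EuclideanSpace ℝ (Fin n) → ℂ} {S : ℝ≥0∞}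
    (hf : AEStronglyMeasurable f volume) (hK : Continuous K) (hS : ∀ z, ‖K z‖ₑ ≤ S)
    (x : EuclideanSpace ℝ (Fin n)) :
    ‖conv f K x‖ₑ ≤ ((∫⁻ z, ‖K z‖ₑ) ^ (p - 1) * S) ^ (1 / p) *
      eLpNorm f (ENNReal.ofReal p) volume := by
  have hp0 : 0 < p := by linarith
  rw [eLpNorm_ofReal_eq hp, ← ENNReal.mul_rpow_of_nonneg _ _ (by positivity), one_div,
    ENNReal.le_rpow_inv_iff hp0, mul_assoc]
  refine (enorm_conv_rpow_le hp hf hK x).trans ?_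
  gcongr
  rw [← lintegral_const_mul'' _ (hf.enorm.pow_const p)]
  gcongr with y
  exact hS _

end Young

/-! ### Sequence norms -/

section Sequences

variable {ι : Type*}

/-- The `ℓ^q` norm of a family in `[0,∞]`. -/
def lqNorm (q : ℝ) (c : ι → ℝ≥0∞) : ℝ≥0∞ := (∑' i, c i ^ q) ^ (1 / q)

lemma lqNorm_mono {q : ℝ} (hq : 1 ≤ q) {c d : ι → ℝ≥0∞} (h : ∀ i, c i ≤ d i) :
    lqNorm q c ≤ lqNorm q d := by
  unfold lqNorm
  gcongr with i
  exact h i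

lemma le_lqNorm {q : ℝ} (hq : 1 ≤ q) (c : ι → ℝ≥0∞) (i : ι) : c i ≤ lqNorm q c := by
  have hq0 : 0 < q := by linarith
  rw [lqNorm, one_div, ENNReal.le_rpow_inv_iff hq0]
  exact ENNReal.le_tsum (f := fun i => c i ^ q) i

lemma lqNorm_const_mul {q : ℝ} (hq : 1 ≤ q) (a : ℝ≥0∞) (c : ι → ℝ≥0∞) :
    lqNorm q (fun i => a * c i) = a * lqNorm q c := by
  have hq0 : 0 < q := by linarith
  unfold lqNorm
  simp_rw [ENNReal.mul_rpow_of_nonneg _ _ hq0.le]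
  rw [ENNReal.tsum_mul_left, ENNReal.mul_rpow_of_nonneg _ _ (by positivity), ← ENNReal.rpow_mul,
    mul_one_div_cancel hq0.ne', ENNReal.rpow_one]

lemma lqNorm_comp_equiv (q : ℝ) (c : ι → ℝ≥0∞) (e : ι ≃ ι) :
    lqNorm q (fun i => c (e i)) = lqNorm q c := by
  unfold lqNorm
  rw [e.tsum_eq fun i => c i ^ q]

/-- Minkowski's inequality for the counting measure. -/
lemma lqNorm_tsum_le [Countable ι] {q : ℝ} (hq : 1 ≤ q) {κ : Type*} [Countable κ]
    (c : κ → ι → ℝ≥0∞) : lqNorm q (fun i => ∑' j, c j i) ≤ ∑' j, lqNorm q (c j) := by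
  let _ : MeasurableSpace ι := ⊤
  have := lintegral_rpow_tsum_le (μ := Measure.count) hq (g := c)
    fun j => (Measurable.of_discrete (f := c j)).aemeasurable
  simpa only [lintegral_count, lqNorm] using this

lemma lqNorm_add_le [Countable ι] {q : ℝ} (hq : 1 ≤ q) (c d : ι → ℝ≥0∞) :
    lqNorm q (fun i => c i + d i) ≤ lqNorm q c + lqNorm q d := by
  have := lqNorm_tsum_le hq (fun b : Bool => if b then c else d)
  simpa [tsum_fintype, add_comm] using this

lemma lqNorm_sum_le [Countable ι] {q : ℝ} (hq : 1 ≤ q) {κ : Type*} (t : Finset κ)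
    (c : κ → ι → ℝ≥0∞) : lqNorm q (fun i => ∑ j ∈ t, c j i) ≤ ∑ j ∈ t, lqNorm q (c j) := by
  have hq0 : 0 < q := by linarith
  classical
  induction t using Finset.induction_on with
  | empty => simp [lqNorm, ENNReal.zero_rpow_of_pos hq0, hq0]
  | insert i t hi ih =>
    simp_rw [Finset.sum_insert hi]
    exact (lqNorm_add_le hq _ _).trans (add_le_add le_rfl ih)

end Sequences

end GevreyModulation

end

noncomputable section

namespace GevreyModulation

open MeasureTheory
open scoped ENNReal

variable {n : ℕ}

/-! ### Weights -/

/-- The weight `exp (|k| ^ (1 / s))`. -/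
def weight (s : ℝ) (k : Fin n → ℤ) : ℝ≥0∞ :=
  ENNReal.ofReal (Real.exp (‖latticePoint k‖ ^ (1 / s)))

/-- The smaller weight `exp (|k| ^ (1 / s) / s)`. -/
def lowWeight (s : ℝ) (k : Fin n → ℤ) : ℝ≥0∞ :=
  ENNReal.ofReal (Real.exp (1 / s * ‖latticePoint k‖ ^ (1 / s)))

lemma norm_latticePoint_add_le (k l : Fin n → ℤ) :
    ‖latticePoint (k + l)‖ ≤ ‖latticePoint k‖ + ‖latticePoint l‖ := by
  rw [latticePoint_add]; exact norm_add_le _ _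

section

variable {s : ℝ} (hs : 1 < s)
include hs

lemma one_div_nonneg_and_le_one : 0 ≤ 1 / s ∧ 1 / s ≤ 1 := by
  have hs0 : 0 < s := by linarith
  exact ⟨by positivity, by rw [div_le_one hs0]; exact hs.le⟩

/-- The larger of the two frequencies carries the full weight, the smaller one only the fraction 1/s
of the exponent; the sum covers both cases. -/
lemma weight_add_le (k l : Fin n → ℤ) :
    weight s (k + l) ≤ weight s k * lowWeight s l + lowWeight s k * weight s l := by
  obtain ⟨ha0, ha1⟩ := one_div_nonneg_and_le_one hs
  have h0 := Real.rpow_le_rpow (norm_nonneg _) (norm_latticePoint_add_le k l) ha0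
  unfold weight lowWeight
  rw [← ENNReal.ofReal_mul (Real.exp_pos _).le, ← ENNReal.ofReal_mul (Real.exp_pos _).le,
    ← Real.exp_add, ← Real.exp_add]
  rcases le_total ‖latticePoint l‖ ‖latticePoint k‖ with h | h
  · refine le_trans (ENNReal.ofReal_le_ofReal (Real.exp_le_exp.2 ?_)) le_self_add
    exact h0.trans (add_rpow_le_add_mul_rpow ha0 ha1 (norm_nonneg _) h)
  · refine le_trans (ENNReal.ofReal_le_ofReal (Real.exp_le_exp.2 ?_)) le_add_self
    have := add_rpow_le_add_mul_rpow ha0 ha1 (norm_nonneg _) h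
    rw [add_comm ‖latticePoint l‖] at this
    linarith

lemma lowWeight_add_le (k l : Fin n → ℤ) :
    lowWeight s (k + l) ≤ lowWeight s k * lowWeight s l := by
  obtain ⟨ha0, ha1⟩ := one_div_nonneg_and_le_one hs
  have h0 := Real.rpow_le_rpow (norm_nonneg _) (norm_latticePoint_add_le k l) ha0
  unfold lowWeight
  rw [← ENNReal.ofReal_mul (Real.exp_pos _).le, ← Real.exp_add, ← mul_add]
  refine ENNReal.ofReal_le_ofReal (Real.exp_le_exp.2 ?_)
  gcongr
  exact h0.trans (add_rpow_le_add_rpow ha0 ha1 (norm_nonneg _) (norm_nonneg _))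

lemma weight_add_le_mul (k l : Fin n → ℤ) : weight s (k + l) ≤ weight s k * weight s l := by
  obtain ⟨ha0, ha1⟩ := one_div_nonneg_and_le_one hs
  have h0 := Real.rpow_le_rpow (norm_nonneg _) (norm_latticePoint_add_le k l) ha0
  unfold weight
  rw [← ENNReal.ofReal_mul (Real.exp_pos _).le, ← Real.exp_add]
  refine ENNReal.ofReal_le_ofReal (Real.exp_le_exp.2 ?_)
  exact h0.trans (add_rpow_le_add_rpow ha0 ha1 (norm_nonneg _) (norm_nonneg _))

lemma one_le_lowWeight (k : Fin n → ℤ) : 1 ≤ lowWeight s k := by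
  obtain ⟨ha0, -⟩ := one_div_nonneg_and_le_one hs
  rw [lowWeight, ENNReal.one_le_ofReal]
  exact Real.one_le_exp (by positivity)

omit hs in
lemma one_le_weight (k : Fin n → ℤ) : 1 ≤ weight s k := by
  rw [weight, ENNReal.one_le_ofReal]
  exact Real.one_le_exp (by positivity)

lemma weight_zero : weight s (0 : Fin n → ℤ) = 1 := by
  have hs0 : 0 < s := by linarith
  rw [weight, latticePoint_zero, norm_zero, Real.zero_rpow (by positivity)]
  simp

end

lemma gmENorm_eq_lqNorm {s p q : ℝ} (hq : 1 ≤ q) (ρ : EuclideanSpace ℝ (Fin n) → ℝ)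
    (f : EuclideanSpace ℝ (Fin n) → ℂ) :
    gmENorm s p q ρ f =
      lqNorm q fun k => weight s k * eLpNorm (box ρ k f) (ENNReal.ofReal p) volume := by
  have hq0 : 0 < q := by linarith
  rw [gmENorm, lqNorm]
  congr 2
  ext k
  rw [ENNReal.mul_rpow_of_nonneg _ _ hq0.le, weight,
    ENNReal.ofReal_rpow_of_nonneg (Real.exp_pos _).le hq0.le, ← Real.exp_mul, mul_comm q]

/-! ### Families of functions with localized spectra -/

/-- A family of bounded functions with spectra in cubes around the lattice points and absolutely
summable sup norms, even with the smaller weight. -/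
structure IsAtomic (s P : ℝ) (a : (Fin n → ℤ) → ℝ≥0∞)
    (F : (Fin n → ℤ) → EuclideanSpace ℝ (Fin n) → ℂ) : Prop where
  meas : ∀ k, AEStronglyMeasurable (F k) volume
  bound : ∀ k x, ‖F k x‖ₑ ≤ a k
  spectrum : ∀ k, HasSpectrumIn (F k) (latticeCube k P)
  finite : ∑' k, lowWeight s k * a k < ⊤

/-- The weighted `ℓ^q(L^p)` norm of a family. -/
def familyNorm (s p q : ℝ) (F : (Fin n → ℤ) → EuclideanSpace ℝ (Fin n) → ℂ) : ℝ≥0∞ :=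
  lqNorm q fun k => weight s k * eLpNorm (F k) (ENNReal.ofReal p) volume

namespace IsAtomic

variable {s P P' : ℝ} {a b : (Fin n → ℤ) → ℝ≥0∞}
  {F G : (Fin n → ℤ) → EuclideanSpace ℝ (Fin n) → ℂ}

lemma tsum_lt_top (hs : 1 < s) (hF : IsAtomic s P a F) : ∑' k, a k < ⊤ :=
  (ENNReal.tsum_le_tsum fun k => le_mul_of_one_le_left' (one_le_lowWeight hs k)).trans_lt hF.finite

lemma lt_top (hs : 1 < s) (hF : IsAtomic s P a F) (k : Fin n → ℤ) : a k < ⊤ :=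
  (ENNReal.le_tsum k).trans_lt (hF.tsum_lt_top hs)

lemma norm_le (hs : 1 < s) (hF : IsAtomic s P a F) (k : Fin n → ℤ)
    (x : EuclideanSpace ℝ (Fin n)) : ‖F k x‖ ≤ (a k).toReal := by
  have := ENNReal.toReal_mono (hF.lt_top hs k).ne (hF.bound k x)
  rwa [toReal_enorm] at this

lemma summable_toReal (hs : 1 < s) (hF : IsAtomic s P a F) : Summable fun k => (a k).toReal :=
  ENNReal.summable_toReal (hF.tsum_lt_top hs).ne

lemma summable_norm (hs : 1 < s) (hF : IsAtomic s P a F) (x : EuclideanSpace ℝ (Fin n)) :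
    Summable fun k => ‖F k x‖ :=
  Summable.of_nonneg_of_le (fun _ => norm_nonneg _) (fun k => hF.norm_le hs k x)
    (hF.summable_toReal hs)

end IsAtomic

lemma tsum_tsum_sub_mul (c d : (Fin n → ℤ) → ℝ≥0∞) :
    ∑' k, ∑' j, c (k - j) * d j = (∑' k, c k) * ∑' j, d j := by
  rw [ENNReal.tsum_comm, ← ENNReal.tsum_mul_left]
  refine tsum_congr fun j => ?_
  rw [ENNReal.tsum_mul_right]
  congr 1
  exact (Equiv.subRight j).tsum_eq c

/-- Young's inequality for ℓ^q and ℓ¹: a superposition of translates of c with masses d_j. -/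
lemma lqNorm_convolution_le {q : ℝ} (hq : 1 ≤ q) (c d : (Fin n → ℤ) → ℝ≥0∞) :
    lqNorm q (fun k => ∑' j, c (k - j) * d j) ≤ lqNorm q c * ∑' j, d j := by
  refine (lqNorm_tsum_le hq fun j k => c (k - j) * d j).trans ?_
  rw [← ENNReal.tsum_mul_left]
  refine ENNReal.tsum_le_tsum fun j => ?_
  have h1 : (fun k => c (k - j) * d j) = fun k => d j * c (Equiv.subRight j k) := by
    ext k; rw [mul_comm]; rfl
  rw [h1, lqNorm_const_mul hq, lqNorm_comp_equiv, mul_comm]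

lemma eLpNorm_mul_le_of_bound {p : ℝ} (hp : 1 ≤ p) {f g : EuclideanSpace ℝ (Fin n) → ℂ} {b : ℝ≥0∞}
    (hf : AEStronglyMeasurable f volume) (hg : ∀ x, ‖g x‖ₑ ≤ b) :
    eLpNorm (fun x => f x * g x) (ENNReal.ofReal p) volume ≤
      eLpNorm f (ENNReal.ofReal p) volume * b := by
  have hp0 : 0 < p := by linarith
  rw [eLpNorm_ofReal_eq hp, eLpNorm_ofReal_eq hp, one_div, ENNReal.rpow_inv_le_iff hp0,
    ENNReal.mul_rpow_of_nonneg _ _ hp0.le, ENNReal.rpow_inv_rpow hp0.ne',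
    ← lintegral_mul_const'' _ (hf.enorm.pow_const p)]
  gcongr with x
  rw [enorm_mul, ENNReal.mul_rpow_of_nonneg _ _ hp0.le]
  gcongr
  exact hg x

/-- The convolution product of two families. -/
def familyMul (F G : (Fin n → ℤ) → EuclideanSpace ℝ (Fin n) → ℂ) (k : Fin n → ℤ)
    (x : EuclideanSpace ℝ (Fin n)) : ℂ :=
  ∑' j, F (k - j) x * G j x

/-! ### Products and powers of localized families -/

section Product

variable {s P P' : ℝ} {a b : (Fin n → ℤ) → ℝ≥0∞}
  {F G : (Fin n → ℤ) → EuclideanSpace ℝ (Fin n) → ℂ}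

lemma tsum_lowWeight_convolution_le (hs : 1 < s) (a b : (Fin n → ℤ) → ℝ≥0∞) :
    ∑' k, lowWeight s k * ∑' j, a (k - j) * b j ≤
      (∑' k, lowWeight s k * a k) * ∑' k, lowWeight s k * b k := by
  rw [← tsum_tsum_sub_mul]
  refine ENNReal.tsum_le_tsum fun k => ?_
  rw [← ENNReal.tsum_mul_left]
  refine ENNReal.tsum_le_tsum fun j => ?_
  have := lowWeight_add_le hs (k - j) j
  rw [sub_add_cancel] at this
  calc _ ≤ lowWeight s (k - j) * lowWeight s j * (a (k - j) * b j) := by gcongr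
    _ = _ := by ring

lemma IsAtomic.mul (hs : 1 < s) (hF : IsAtomic s P a F) (hG : IsAtomic s P' b G) :
    IsAtomic s (P + P') (fun k => ∑' j, a (k - j) * b j) (familyMul F G) := by
  have hfin : ∑' k, lowWeight s k * ∑' j, a (k - j) * b j < ⊤ :=
    (tsum_lowWeight_convolution_le hs a b).trans_lt (ENNReal.mul_lt_top hF.finite hG.finite)
  have hb : ∀ k j x, ‖F (k - j) x * G j x‖ₑ ≤ a (k - j) * b j := fun k j x => by
    rw [enorm_mul]; exact mul_le_mul' (hF.bound _ _) (hG.bound _ _)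
  have hk : ∀ k, ∑' j, a (k - j) * b j < ⊤ := fun k =>
    ((le_mul_of_one_le_left' (one_le_lowWeight hs k)).trans
      (ENNReal.le_tsum (f := fun k => lowWeight s k * ∑' j, a (k - j) * b j) k)).trans_lt hfin
  have hsum : ∀ k, Summable fun j => (a (k - j) * b j).toReal := fun k =>
    ENNReal.summable_toReal (hk k).ne
  have hnb : ∀ k j x, ‖F (k - j) x * G j x‖ ≤ (a (k - j) * b j).toReal := fun k j x => by
    have := ENNReal.toReal_mono
      (ENNReal.mul_lt_top (hF.lt_top hs (k - j)) (hG.lt_top hs j)).ne (hb k j x)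
    rwa [toReal_enorm] at this
  have hm : ∀ k j, AEStronglyMeasurable (fun x => F (k - j) x * G j x) volume :=
    fun k j => (hF.meas _).mul (hG.meas _)
  refine ⟨fun k => aestronglyMeasurable_tsum (hsum k) (hm k) (hnb k), fun k x => ?_, fun k => ?_,
    hfin⟩
  · exact enorm_tsum_le_tsum_enorm.trans (ENNReal.tsum_le_tsum fun j => hb k j x)
  · refine HasSpectrumIn.tsum (hsum k) (hm k) (hnb k) fun j => ?_
    have := (hF.spectrum (k - j)).mul (hG.spectrum j) (hG.meas j) (hG.norm_le hs j)
    rwa [sub_add_cancel] at this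

/-- The shear `(k, j) ↦ (k - j, j)`. -/
def shearEquiv (A : Type*) [AddGroup A] : A × A ≃ A × A where
  toFun z := (z.1 - z.2, z.2)
  invFun z := (z.1 + z.2, z.2)
  left_inv z := by simp
  right_inv z := by simp

lemma tsum_mul_tsum_eq_tsum_tsum_sub {A : Type*} [AddGroup A] {f g : A → ℂ}
    (hf : Summable fun k => ‖f k‖) (hg : Summable fun k => ‖g k‖) :
    ∑' k, ∑' j, f (k - j) * g j = (∑' k, f k) * ∑' k, g k := by
  have h1 : Summable fun z : A × A => f z.1 * g z.2 := summable_mul_of_summable_norm hf hg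
  have h2 : Summable fun z : A × A => f (z.1 - z.2) * g z.2 := (shearEquiv A).summable_iff.2 h1
  rw [tsum_mul_tsum_of_summable_norm hf hg,
    ← (shearEquiv A).tsum_eq fun z : A × A => f z.1 * g z.2]
  exact h2.tsum_prod.symm

lemma tsum_familyMul (hs : 1 < s) (hF : IsAtomic s P a F) (hG : IsAtomic s P' b G)
    (x : EuclideanSpace ℝ (Fin n)) :
    ∑' k, familyMul F G k x = (∑' k, F k x) * ∑' k, G k x :=
  tsum_mul_tsum_eq_tsum_tsum_sub (hF.summable_norm hs x) (hG.summable_norm hs x)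

/-- A tame product estimate: each term has the strong norm on one factor and only the weaker sup
norm sum on the other, since `weight_add_le` splits the weight and Hölder's inequality puts L^∞ on
the low-weight factor. -/
lemma familyNorm_familyMul_le {p q : ℝ} (hs : 1 < s) (hp : 1 ≤ p) (hq : 1 ≤ q)
    (hF : IsAtomic s P a F) (hG : IsAtomic s P' b G) :
    familyNorm s p q (familyMul F G) ≤
      familyNorm s p q F * (∑' k, lowWeight s k * b k) +
        (∑' k, lowWeight s k * a k) * familyNorm s p q G := by
  set N : (EuclideanSpace ℝ (Fin n) → ℂ) → ℝ≥0∞ :=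
    fun f => eLpNorm f (ENNReal.ofReal p) volume with hN
  have hstep : ∀ k, weight s k * N (familyMul F G k) ≤
      (∑' j, (weight s (k - j) * N (F (k - j))) * (lowWeight s j * b j)) +
        ∑' j, (weight s (k - j) * N (G (k - j))) * (lowWeight s j * a j) := fun k => by
    have h1 : N (familyMul F G k) ≤ ∑' j, N (fun x => F (k - j) x * G j x) :=
      eLpNorm_tsum_le hp fun j => (hF.meas _).mul (hG.meas _)
    have h2 : ∑' j, (weight s (k - j) * N (G (k - j))) * (lowWeight s j * a j) =
        ∑' j, (weight s j * N (G j)) * (lowWeight s (k - j) * a (k - j)) := by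
      rw [← (Equiv.subLeft k).tsum_eq]
      refine tsum_congr fun j => ?_
      simp
    rw [h2, ← ENNReal.tsum_add]
    refine (mul_le_mul_right h1 _).trans ?_
    rw [← ENNReal.tsum_mul_left]
    refine ENNReal.tsum_le_tsum fun j => ?_
    have hw := weight_add_le hs (k - j) j
    rw [sub_add_cancel] at hw
    have h3 : N (fun x => F (k - j) x * G j x) ≤ N (F (k - j)) * b j :=
      eLpNorm_mul_le_of_bound hp (hF.meas _) (hG.bound j)
    have h4 : N (fun x => F (k - j) x * G j x) ≤ N (G j) * a (k - j) := by
      simp_rw [mul_comm (F (k - j) _)]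
      exact eLpNorm_mul_le_of_bound hp (hG.meas _) (hF.bound _)
    calc weight s k * N (fun x => F (k - j) x * G j x)
        ≤ (weight s (k - j) * lowWeight s j + lowWeight s (k - j) * weight s j) *
          N (fun x => F (k - j) x * G j x) := by gcongr
      _ = weight s (k - j) * lowWeight s j * N (fun x => F (k - j) x * G j x) +
          lowWeight s (k - j) * weight s j * N (fun x => F (k - j) x * G j x) := add_mul _ _ _
      _ ≤ weight s (k - j) * lowWeight s j * (N (F (k - j)) * b j) +
          lowWeight s (k - j) * weight s j * (N (G j) * a (k - j)) := by gcongr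
      _ = _ := by ring
  refine (lqNorm_mono hq hstep).trans ((lqNorm_add_le hq _ _).trans ?_)
  refine add_le_add (lqNorm_convolution_le hq (fun k => weight s k * N (F k)) _) ?_
  rw [mul_comm]
  exact lqNorm_convolution_le hq (fun k => weight s k * N (G k)) _

/-- Powers of a sum of localized functions. -/
lemma IsAtomic.exists_pow {p q : ℝ} (hs : 1 < s) (hp : 1 ≤ p) (hq : 1 ≤ q)
    (hF : IsAtomic s P a F) (m : ℕ) :
    ∃ (b : (Fin n → ℤ) → ℝ≥0∞) (G : (Fin n → ℤ) → EuclideanSpace ℝ (Fin n) → ℂ),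
      IsAtomic s ((m + 1 : ℕ) * P) b G ∧ (∀ x, ∑' k, G k x = (∑' k, F k x) ^ (m + 1)) ∧
      ∑' k, lowWeight s k * b k ≤ (∑' k, lowWeight s k * a k) ^ (m + 1) ∧
      familyNorm s p q G ≤
        (m + 1 : ℕ) * (∑' k, lowWeight s k * a k) ^ m * familyNorm s p q F := by
  induction m with
  | zero => exact ⟨a, F, by simpa using hF, by simp, by simp, by simp⟩
  | succ m ih =>
    obtain ⟨b, G, hG, htot, hlow, hnorm⟩ := ih
    refine ⟨fun k => ∑' j, b (k - j) * a j, familyMul G F, ?_, fun x => ?_, ?_, ?_⟩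
    · have := hG.mul hs hF
      convert this using 1
      push_cast; ring
    · rw [tsum_familyMul hs hG hF, htot, ← pow_succ]
    · refine (tsum_lowWeight_convolution_le hs b a).trans ?_
      rw [pow_succ (∑' k, lowWeight s k * a k) (m + 1)]
      gcongr
    -- Each new factor adds one term with the strong norm on it, so the constant is m + 1 and the
    -- strong norm appears to the first power only.
    · refine (familyNorm_familyMul_le hs hp hq hG hF).trans ?_
      calc _ ≤ (m + 1 : ℕ) * (∑' k, lowWeight s k * a k) ^ m * familyNorm s p q F *
            (∑' k, lowWeight s k * a k) +
            (∑' k, lowWeight s k * a k) ^ (m + 1) * familyNorm s p q F := by gcongr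
        _ = _ := by push_cast; ring

lemma IsAtomic.mul_left (hs : 1 < s) (hF : IsAtomic s P a F)
    {g : EuclideanSpace ℝ (Fin n) → ℂ} {γ : ℝ≥0∞} (hγ : γ ≠ ⊤)
    (hg : HasSpectrumIn g (latticeCube 0 P')) (hgm : AEStronglyMeasurable g volume)
    (hgb : ∀ x, ‖g x‖ₑ ≤ γ) :
    IsAtomic s (P' + P) (fun k => γ * a k) (fun k x => g x * F k x) := by
  refine ⟨fun k => hgm.mul (hF.meas k), fun k x => ?_, fun k => ?_, ?_⟩
  · rw [enorm_mul]; exact mul_le_mul' (hgb x) (hF.bound k x)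
  · have := hg.mul (hF.spectrum k) (hF.meas k) (hF.norm_le hs k)
    rwa [zero_add] at this
  · simp_rw [mul_left_comm _ γ]
    rw [ENNReal.tsum_mul_left]
    exact ENNReal.mul_lt_top hγ.lt_top hF.finite

lemma familyNorm_mul_left_le {p q : ℝ} (hp : 1 ≤ p) (hq : 1 ≤ q) (hF : IsAtomic s P a F)
    {g : EuclideanSpace ℝ (Fin n) → ℂ} {γ : ℝ≥0∞} (hgb : ∀ x, ‖g x‖ₑ ≤ γ) :
    familyNorm s p q (fun k x => g x * F k x) ≤ γ * familyNorm s p q F := by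
  rw [familyNorm, familyNorm, ← lqNorm_const_mul hq]
  refine lqNorm_mono hq fun k => ?_
  rw [mul_left_comm]
  gcongr
  rw [mul_comm γ]
  simp_rw [mul_comm (g _)]
  exact eLpNorm_mul_le_of_bound hp (hF.meas k) hgb

end Product

end GevreyModulation

end

noncomputable section

namespace GevreyModulation

open MeasureTheory
open scoped ENNReal

variable {n : ℕ} {s : ℝ} {ρ : EuclideanSpace ℝ (Fin n) → ℝ}

/-! ### Modulation norms of sums of localized functions -/

/-- The `L¹` norm of the kernels of the decomposition operators. -/
def kernelMass (ρ : EuclideanSpace ℝ (Fin n) → ℝ) : ℝ≥0∞ := ∫⁻ z, ‖boxKernel ρ 0 z‖ₑ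

lemma kernelMass_lt_top (hs : 1 < s) (hρ : GeneratesDecomposition s ρ) : kernelMass ρ < ⊤ :=
  ((stretchedDecay_boxKernel hs hρ 0).integrable hs hρ).2

lemma lintegral_enorm_boxKernel (ρ : EuclideanSpace ℝ (Fin n) → ℝ) (k : Fin n → ℤ) :
    ∫⁻ z, ‖boxKernel ρ k z‖ₑ = kernelMass ρ := by
  refine lintegral_congr fun z => ?_
  rw [← ofReal_norm, ← ofReal_norm, norm_boxKernel]

lemma eLpNorm_box_le {p : ℝ} (hp : 1 ≤ p) (hs : 1 < s) (hρ : GeneratesDecomposition s ρ)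
    {f : EuclideanSpace ℝ (Fin n) → ℂ} (hf : AEStronglyMeasurable f volume) (k : Fin n → ℤ) :
    eLpNorm (box ρ k f) (ENNReal.ofReal p) volume ≤
      kernelMass ρ * eLpNorm f (ENNReal.ofReal p) volume := by
  rw [← lintegral_enorm_boxKernel ρ k]
  exact eLpNorm_conv_le hp hf (stretchedDecay_boxKernel hs hρ k).continuous

lemma box_congr_ae {f g : EuclideanSpace ℝ (Fin n) → ℂ} (h : f =ᵐ[volume] g) (k : Fin n → ℤ) :
    box ρ k f = box ρ k g := conv_congr_ae h _

lemma gmENorm_congr_ae {p q : ℝ} {f g : EuclideanSpace ℝ (Fin n) → ℂ} (h : f =ᵐ[volume] g) :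
    gmENorm s p q ρ f = gmENorm s p q ρ g := by
  unfold gmENorm
  simp_rw [box_congr_ae h]

lemma gmENorm_tsum_le {p q : ℝ} (hs : 1 < s) (hp : 1 ≤ p) (hq : 1 ≤ q)
    (hρ : GeneratesDecomposition s ρ) {ι : Type*} [Countable ι]
    {f : ι → EuclideanSpace ℝ (Fin n) → ℂ} {M : ι → ℝ} (hM : Summable M)
    (hf : ∀ i, AEStronglyMeasurable (f i) volume) (hb : ∀ i x, ‖f i x‖ ≤ M i) :
    gmENorm s p q ρ (fun x => ∑' i, f i x) ≤ ∑' i, gmENorm s p q ρ (f i) := by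
  simp_rw [gmENorm_eq_lqNorm hq]
  refine le_trans (lqNorm_mono hq fun k => ?_)
    (lqNorm_tsum_le hq fun i k => weight s k * eLpNorm (box ρ k (f i)) (ENNReal.ofReal p) volume)
  rw [ENNReal.tsum_mul_left]
  gcongr
  have h1 : box ρ k (fun x => ∑' i, f i x) = fun x => ∑' i, box ρ k (f i) x := by
    ext x
    exact conv_tsum hs hρ hM hf hb (stretchedDecay_boxKernel hs hρ k) x
  rw [h1]
  exact eLpNorm_tsum_le hp fun i =>
    aestronglyMeasurable_box hs hρ (StretchedIntegrable.of_bounded hs hρ (hf i) (hb i)) k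

lemma gmENorm_add_le {p q : ℝ} (hs : 1 < s) (hp : 1 ≤ p) (hq : 1 ≤ q)
    (hρ : GeneratesDecomposition s ρ) {f g : EuclideanSpace ℝ (Fin n) → ℂ} {M M' : ℝ}
    (hf : AEStronglyMeasurable f volume) (hg : AEStronglyMeasurable g volume)
    (hfb : ∀ x, ‖f x‖ ≤ M) (hgb : ∀ x, ‖g x‖ ≤ M') :
    gmENorm s p q ρ (fun x => f x + g x) ≤ gmENorm s p q ρ f + gmENorm s p q ρ g := by
  have := gmENorm_tsum_le hs hp hq hρ (f := fun b : Bool => if b then f else g)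
    (M := fun b : Bool => if b then M else M') (Summable.of_finite)
    (by rintro (_ | _) <;> simpa) (by rintro (_ | _) <;> simpa)
  simpa [tsum_fintype, add_comm] using this

/-- The lattice points in a centered box. -/
def boxFinset (n : ℕ) (P : ℝ) : Finset (Fin n → ℤ) :=
  Fintype.piFinset fun _ => Finset.Icc (-⌊P⌋) ⌊P⌋

lemma mem_boxFinset {P : ℝ} {d : Fin n → ℤ} : d ∈ boxFinset n P ↔ ∀ i, |(d i : ℝ)| ≤ P := by
  rw [boxFinset, Fintype.mem_piFinset]
  refine forall_congr' fun i => ?_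
  rw [Finset.mem_Icc, abs_le, neg_le, Int.le_floor, Int.le_floor, neg_le]
  push_cast
  rw [neg_le]

lemma card_boxFinset_le {P : ℝ} (hP : 0 ≤ P) :
    ((boxFinset n P).card : ℝ) ≤ (2 * P + 1) ^ n := by
  have h0 : 0 ≤ ⌊P⌋ := Int.floor_nonneg.2 hP
  have h1 : (((⌊P⌋ + 1 - -⌊P⌋).toNat : ℕ) : ℝ) ≤ 2 * P + 1 := by
    have h2 : (((⌊P⌋ + 1 - -⌊P⌋).toNat : ℕ) : ℤ) = 2 * ⌊P⌋ + 1 := by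
      rw [Int.toNat_of_nonneg (by linarith)]; ring
    have h3 : (((⌊P⌋ + 1 - -⌊P⌋).toNat : ℕ) : ℝ) = 2 * (⌊P⌋ : ℝ) + 1 := by exact_mod_cast h2
    rw [h3]
    linarith [Int.floor_le P]
  rw [boxFinset, Fintype.card_piFinset]
  simp only [Int.card_Icc, Finset.prod_const, Finset.card_univ, Fintype.card_fin]
  push_cast
  gcongr

/-- By the spectral condition □_m sees only the F_{m-d} with |d_i| ≤ P + 1. The price is the number
of such d, the L¹ norm of the kernel, and the largest weight of a shift d. -/
lemma IsAtomic.gmENorm_tsum_le {p q : ℝ} (hs : 1 < s) (hp : 1 ≤ p) (hq : 1 ≤ q)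
    (hρ : GeneratesDecomposition s ρ) {P : ℝ} {a : (Fin n → ℤ) → ℝ≥0∞}
    {F : (Fin n → ℤ) → EuclideanSpace ℝ (Fin n) → ℂ} (hF : IsAtomic s P a F) :
    gmENorm s p q ρ (fun x => ∑' k, F k x) ≤ (boxFinset n (P + 1)).card *
      (kernelMass ρ * ENNReal.ofReal (Real.exp ((n * (P + 1)) ^ (1 / s)))) *
        familyNorm s p q F := by
  obtain ⟨ha0, -⟩ := one_div_nonneg_and_le_one hs
  rw [gmENorm_eq_lqNorm hq]
  set D := boxFinset n (P + 1)
  set Λ := kernelMass ρ * ENNReal.ofReal (Real.exp ((n * (P + 1)) ^ (1 / s)))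
  have hbox : ∀ m, box ρ m (fun x => ∑' k, F k x) = fun x => ∑ d ∈ D, box ρ m (F (m - d)) x := by
    intro m
    ext x
    rw [box_eq_conv, conv_tsum hs hρ (hF.summable_toReal hs) hF.meas (hF.norm_le hs)
      (stretchedDecay_boxKernel hs hρ m), ← (Equiv.subLeft m).tsum_eq]
    refine tsum_eq_sum fun d hd => ?_
    by_contra hne
    refine hd (mem_boxFinset.2 fun i => ?_)
    have h1 := abs_sub_le_of_box_ne_zero hs hρ (hF.spectrum (m - d)) (m := m)
      (fun h0 => hne (congrFun h0 x)) i
    simpa using h1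
  have hstep : ∀ m, weight s m * eLpNorm (box ρ m fun x => ∑' k, F k x) (ENNReal.ofReal p) volume ≤
      ∑ d ∈ D, Λ * (weight s (Equiv.subRight d m) *
        eLpNorm (F (Equiv.subRight d m)) (ENNReal.ofReal p) volume) := fun m => by
    rw [hbox]
    have h1 : eLpNorm (fun x => ∑ d ∈ D, box ρ m (F (m - d)) x) (ENNReal.ofReal p) volume ≤
        ∑ d ∈ D, eLpNorm (box ρ m (F (m - d))) (ENNReal.ofReal p) volume := by
      have := eLpNorm_sum_le (s := D) (f := fun d => box ρ m (F (m - d))) (μ := volume)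
        (p := ENNReal.ofReal p) (fun d _ => aestronglyMeasurable_box hs hρ
          (StretchedIntegrable.of_bounded hs hρ (hF.meas _) (hF.norm_le hs _)) m)
        (by rw [ENNReal.one_le_ofReal]; exact hp)
      simpa only [Finset.sum_fn] using this
    refine (mul_le_mul_right h1 _).trans ?_
    rw [Finset.mul_sum]
    refine Finset.sum_le_sum fun d hd => ?_
    have hw : weight s m ≤ weight s (m - d) *
        ENNReal.ofReal (Real.exp ((n * (P + 1)) ^ (1 / s))) := by
      have := weight_add_le_mul hs (m - d) d
      rw [sub_add_cancel] at this
      refine this.trans ?_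
      gcongr
      refine ENNReal.ofReal_le_ofReal (Real.exp_le_exp.2 ?_)
      gcongr
      exact norm_le_of_abs_coord_le fun i => mem_boxFinset.1 hd i
    calc _ ≤ (weight s (m - d) * ENNReal.ofReal (Real.exp ((n * (P + 1)) ^ (1 / s)))) *
          (kernelMass ρ * eLpNorm (F (m - d)) (ENNReal.ofReal p) volume) :=
          mul_le_mul' hw (eLpNorm_box_le hp hs hρ (hF.meas _) m)
      _ = _ := by simp only [Equiv.subRight_apply, Λ]; ring
  refine (lqNorm_mono hq hstep).trans ((lqNorm_sum_le hq D _).trans ?_)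
  have h2 : ∀ d ∈ D, lqNorm q (fun m => Λ * (weight s (Equiv.subRight d m) *
      eLpNorm (F (Equiv.subRight d m)) (ENNReal.ofReal p) volume)) = Λ * familyNorm s p q F :=
    fun d _ => by
      rw [lqNorm_const_mul hq, lqNorm_comp_equiv q (fun m => weight s m *
        eLpNorm (F m) (ENNReal.ofReal p) volume) (Equiv.subRight d)]
      rfl
  rw [Finset.sum_congr rfl h2, Finset.sum_const, nsmul_eq_mul, ← mul_assoc]

theorem exists_gmENorm_tsum_le (hs : 1 < s) (hρ : GeneratesDecomposition s ρ) :
    ∃ C B : ℝ, 0 < C ∧ 0 < B ∧ ∀ (p q : ℝ), 1 ≤ p → 1 ≤ q → ∀ (P : ℝ), 0 ≤ P →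
      ∀ (a : (Fin n → ℤ) → ℝ≥0∞) (F : (Fin n → ℤ) → EuclideanSpace ℝ (Fin n) → ℂ),
        IsAtomic s P a F → gmENorm s p q ρ (fun x => ∑' k, F k x) ≤
          ENNReal.ofReal (C * Real.exp (B * (P + 1) ^ (1 / s))) * familyNorm s p q F := by
  have hs0 : 0 < s := by linarith
  set κ := (kernelMass ρ).toReal
  have hκ : kernelMass ρ = ENNReal.ofReal κ :=
    (ENNReal.ofReal_toReal (kernelMass_lt_top hs hρ).ne).symm
  have hκ0 : 0 ≤ κ := ENNReal.toReal_nonneg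
  -- This is the constant with which the number of shifts, polynomial in P + 1, is absorbed into one
  -- more exponential of (P+1)^(1/s).
  set D : ℝ := ((s / 1) ^ s) ^ n * (n.factorial : ℝ) ^ s
  have hD : 0 < D := by positivity
  refine ⟨3 ^ n * D * (κ + 1), 1 + (n : ℝ) ^ (1 / s), by positivity, by positivity,
    fun p q hp hq P hP a F hF => (hF.gmENorm_tsum_le hs hp hq hρ).trans ?_⟩
  gcongr
  have hcard : ((boxFinset n (P + 1)).card : ℝ≥0∞) =
      ENNReal.ofReal ((boxFinset n (P + 1)).card : ℝ) :=
    (ENNReal.ofReal_natCast _).symm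
  rw [hκ, hcard, ← ENNReal.ofReal_mul hκ0, ← ENNReal.ofReal_mul (Nat.cast_nonneg _)]
  refine ENNReal.ofReal_le_ofReal ?_
  have hP1 : 0 ≤ P + 1 := by linarith
  have h1 : ((boxFinset n (P + 1)).card : ℝ) ≤ 3 ^ n * (P + 1) ^ n := by
    refine (card_boxFinset_le hP1).trans ?_
    rw [← mul_pow]
    gcongr
    linarith
  have h2 := pow_le_mul_exp_rpow hs0 one_pos hP1 n
  rw [one_mul] at h2
  rw [Real.mul_rpow (by positivity) hP1, add_mul, one_mul, Real.exp_add]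
  calc _ ≤ (3 ^ n * (D * Real.exp ((P + 1) ^ (1 / s)))) *
        ((κ + 1) * Real.exp ((n : ℝ) ^ (1 / s) * (P + 1) ^ (1 / s))) := by
        refine mul_le_mul (h1.trans (by gcongr)) ?_ (by positivity) (by positivity)
        gcongr
        linarith
    _ = _ := by ring

/-- The function is viewed as a family concentrated at k = 0, where the weight equals 1. -/
lemma HasSpectrumIn.gmENorm_le {C B p q P : ℝ} (hs : 1 < s) (hq : 1 ≤ q)
    (hCB : ∀ (a : (Fin n → ℤ) → ℝ≥0∞) (F : (Fin n → ℤ) → EuclideanSpace ℝ (Fin n) → ℂ),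
        IsAtomic s P a F → gmENorm s p q ρ (fun x => ∑' k, F k x) ≤
          ENNReal.ofReal (C * Real.exp (B * (P + 1) ^ (1 / s))) * familyNorm s p q F)
    {g : EuclideanSpace ℝ (Fin n) → ℂ} {M : ℝ} (hg : HasSpectrumIn g (latticeCube 0 P))
    (hgm : AEStronglyMeasurable g volume) (hgb : ∀ x, ‖g x‖ ≤ M) :
    gmENorm s p q ρ g ≤ ENNReal.ofReal (C * Real.exp (B * (P + 1) ^ (1 / s))) *
      eLpNorm g (ENNReal.ofReal p) volume := by
  classical
  have hq0 : 0 < q := by linarith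
  let F : (Fin n → ℤ) → EuclideanSpace ℝ (Fin n) → ℂ := fun k => if k = 0 then g else 0
  let a : (Fin n → ℤ) → ℝ≥0∞ := fun k => if k = 0 then ENNReal.ofReal M else 0
  have hF0 : F 0 = g := if_pos rfl
  have hne : ∀ k, k ≠ 0 → F k = 0 := fun k hk => if_neg hk
  have ha0 : a 0 = ENNReal.ofReal M := if_pos rfl
  have hane : ∀ k, k ≠ 0 → a k = 0 := fun k hk => if_neg hk
  have hF : IsAtomic s P a F := by
    refine ⟨fun k => ?_, fun k x => ?_, fun k => ?_, ?_⟩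
    · rcases eq_or_ne k 0 with rfl | hk
      · rwa [hF0]
      · rw [hne k hk]; exact aestronglyMeasurable_zero
    · rcases eq_or_ne k 0 with rfl | hk
      · rw [hF0, ha0, ← ofReal_norm]
        exact ENNReal.ofReal_le_ofReal (hgb x)
      · rw [hne k hk]; simp
    · rcases eq_or_ne k 0 with rfl | hk
      · rwa [hF0]
      · rw [hne k hk]; exact HasSpectrumIn.zero _
    · rw [tsum_eq_single 0 fun k hk => by rw [hane k hk, mul_zero], ha0]
      exact ENNReal.mul_lt_top ENNReal.ofReal_lt_top ENNReal.ofReal_lt_top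
  have h1 := hCB _ _ hF
  have h2 : (fun x => ∑' k, F k x) = g := by
    ext x
    rw [tsum_eq_single 0 fun k hk => by rw [hne k hk]; rfl, hF0]
  have h3 : familyNorm s p q F = eLpNorm g (ENNReal.ofReal p) volume := by
    rw [familyNorm, lqNorm, tsum_eq_single 0 fun k hk => by
      rw [hne k hk, eLpNorm_zero, mul_zero, ENNReal.zero_rpow_of_pos hq0], hF0,
      weight_zero hs, one_mul, ← ENNReal.rpow_mul, mul_one_div_cancel hq0.ne', ENNReal.rpow_one]
  rwa [h2, h3] at h1

end GevreyModulation

end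

noncomputable section

namespace GevreyModulation

open MeasureTheory
open scoped ENNReal

variable {n : ℕ} {s : ℝ} {ρ : EuclideanSpace ℝ (Fin n) → ℝ}

/-! ### Decomposition of real functions into low and high frequencies -/

/-- Bernstein's inequality. -/
lemma exists_enorm_box_le {p : ℝ} (hp : 1 ≤ p) (hs : 1 < s) (hρ : GeneratesDecomposition s ρ) :
    ∃ C : ℝ, 0 < C ∧ ∀ f : EuclideanSpace ℝ (Fin n) → ℂ, StretchedIntegrable (1 / s) f →
      ∀ k x, ‖box ρ k f x‖ₑ ≤
        ENNReal.ofReal C * eLpNorm (box ρ k f) (ENNReal.ofReal p) volume := by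
  obtain ⟨c, C, hc, hC, h⟩ := exists_norm_boxKernel_zero_le hs.le hρ
  set κ : ℝ≥0∞ := ENNReal.ofReal (7 ^ n) * kernelMass ρ
  set S : ℝ≥0∞ := ENNReal.ofReal (7 ^ n * C)
  set Λ : ℝ≥0∞ := (κ ^ (p - 1) * S) ^ (1 / p)
  have hκ : κ < ⊤ := ENNReal.mul_lt_top ENNReal.ofReal_lt_top (kernelMass_lt_top hs hρ)
  have hΛ : Λ < ⊤ := ENNReal.rpow_lt_top_of_nonneg (by positivity)
    (ENNReal.mul_lt_top (ENNReal.rpow_lt_top_of_nonneg (by linarith) hκ.ne)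
      ENNReal.ofReal_lt_top).ne
  have hrepro : ∀ k z, ‖reproKernel ρ k z‖ₑ ≤ ENNReal.ofReal (7 ^ n) * ‖boxKernel ρ 0 z‖ₑ :=
    fun k z => by
      rw [← ofReal_norm, ← ofReal_norm, ← ENNReal.ofReal_mul (by positivity)]
      exact ENNReal.ofReal_le_ofReal (norm_reproKernel_le k z)
  refine ⟨Λ.toReal + 1, by positivity, fun f hf k x => ?_⟩
  have hK := stretchedDecay_reproKernel hs hρ k
  have h1 : ‖conv (box ρ k f) (reproKernel ρ k) x‖ₑ ≤
      ((∫⁻ z, ‖reproKernel ρ k z‖ₑ) ^ (p - 1) * S) ^ (1 / p) *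
        eLpNorm (box ρ k f) (ENNReal.ofReal p) volume := by
    refine enorm_conv_le hp (aestronglyMeasurable_box hs hρ hf k) hK.continuous (fun z => ?_) x
    rw [← ofReal_norm]
    refine ENNReal.ofReal_le_ofReal ((norm_reproKernel_le k z).trans ?_)
    gcongr
    refine (h z).trans (mul_le_of_le_one_right hC.le (Real.exp_le_one_iff.2 ?_))
    have : 0 ≤ ‖z‖ ^ (1 / s) := by positivity
    nlinarith
  rw [← box_eq_conv_reproKernel hs hρ hf k] at h1
  refine h1.trans ?_
  gcongr
  have h2 : ∫⁻ z, ‖reproKernel ρ k z‖ₑ ≤ κ := by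
    refine (lintegral_mono (hrepro k)).trans (le_of_eq ?_)
    exact lintegral_const_mul' _ _ ENNReal.ofReal_ne_top
  calc _ ≤ Λ := by
        refine ENNReal.rpow_le_rpow ?_ (by positivity)
        gcongr
    _ = ENNReal.ofReal Λ.toReal := (ENNReal.ofReal_toReal hΛ.ne).symm
    _ ≤ _ := ENNReal.ofReal_le_ofReal (by linarith)

lemma weight_neg (s : ℝ) (k : Fin n → ℤ) : weight s (-k) = weight s k := by
  rw [weight, weight, latticePoint_neg, norm_neg]

/-- The frequency blocks of a real function `f`, symmetrized such that the block at `-k` is the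
complex conjugate of the one at `k`. -/
def symBox (ρ : EuclideanSpace ℝ (Fin n) → ℝ) (f : EuclideanSpace ℝ (Fin n) → ℂ) (k : Fin n → ℤ)
    (x : EuclideanSpace ℝ (Fin n)) : ℂ :=
  2⁻¹ * (box ρ k f x + (starRingEnd ℂ) (box ρ (-k) f x))

/-- As ρ is not assumed even, the blocks of a real function at k and -k need not be conjugate.
Symmetrizing restores this, so truncation to a symmetric set of frequencies gives a real function.
-/
lemma conj_symBox (f : EuclideanSpace ℝ (Fin n) → ℂ) (k : Fin n → ℤ)
    (x : EuclideanSpace ℝ (Fin n)) : (starRingEnd ℂ) (symBox ρ f k x) = symBox ρ f (-k) x := by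
  have h2 : (starRingEnd ℂ) 2 = 2 := map_ofNat _ 2
  rw [symBox, symBox, map_mul, map_add, map_inv₀, h2, Complex.conj_conj, neg_neg, add_comm]

/-- The size of the symmetrized frequency blocks. -/
def symSize (p : ℝ) (ρ : EuclideanSpace ℝ (Fin n) → ℝ) (f : EuclideanSpace ℝ (Fin n) → ℂ)
    (k : Fin n → ℤ) : ℝ≥0∞ :=
  2⁻¹ * (eLpNorm (box ρ k f) (ENNReal.ofReal p) volume +
    eLpNorm (box ρ (-k) f) (ENNReal.ofReal p) volume)

lemma aestronglyMeasurable_conj {f : EuclideanSpace ℝ (Fin n) → ℂ}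
    (hf : AEStronglyMeasurable f volume) :
    AEStronglyMeasurable (fun x => (starRingEnd ℂ) (f x)) volume :=
  Complex.continuous_conj.comp_aestronglyMeasurable hf

lemma aestronglyMeasurable_symBox (hs : 1 < s) (hρ : GeneratesDecomposition s ρ)
    {f : EuclideanSpace ℝ (Fin n) → ℂ} (hf : StretchedIntegrable (1 / s) f) (k : Fin n → ℤ) :
    AEStronglyMeasurable (symBox ρ f k) volume :=
  ((aestronglyMeasurable_box hs hρ hf k).add
    (aestronglyMeasurable_conj (aestronglyMeasurable_box hs hρ hf (-k)))).const_mul _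

lemma enorm_two_inv : ‖(2⁻¹ : ℂ)‖ₑ = 2⁻¹ := by
  rw [enorm_inv two_ne_zero]
  congr 1
  rw [← ofReal_norm]
  simp

lemma enorm_conj (z : ℂ) : ‖(starRingEnd ℂ) z‖ₑ = ‖z‖ₑ := by
  rw [← ofReal_norm, ← ofReal_norm, Complex.norm_conj]

lemma eLpNorm_symBox_le {p : ℝ} (hp : 1 ≤ p) (hs : 1 < s) (hρ : GeneratesDecomposition s ρ)
    {f : EuclideanSpace ℝ (Fin n) → ℂ} (hf : StretchedIntegrable (1 / s) f) (k : Fin n → ℤ) :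
    eLpNorm (symBox ρ f k) (ENNReal.ofReal p) volume ≤ symSize p ρ f k := by
  have h1 : symBox ρ f k =
      (2⁻¹ : ℂ) • (box ρ k f + fun x => (starRingEnd ℂ) (box ρ (-k) f x)) := rfl
  rw [h1, eLpNorm_const_smul, enorm_two_inv, symSize]
  gcongr
  refine (eLpNorm_add_le (aestronglyMeasurable_box hs hρ hf k)
    (aestronglyMeasurable_conj (aestronglyMeasurable_box hs hρ hf (-k)))
    (by rw [ENNReal.one_le_ofReal]; exact hp)).trans (le_of_eq ?_)
  congr 1
  refine eLpNorm_congr_norm_ae (Filter.Eventually.of_forall fun x => ?_)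
  rw [Complex.norm_conj]

lemma weight_mul_eLpNorm_box_le {p q : ℝ} (hq : 1 ≤ q) (f : EuclideanSpace ℝ (Fin n) → ℂ)
    (k : Fin n → ℤ) : weight s k * eLpNorm (box ρ k f) (ENNReal.ofReal p) volume ≤
      gmENorm s p q ρ f := by
  rw [gmENorm_eq_lqNorm hq]
  exact le_lqNorm hq (fun k => weight s k * eLpNorm (box ρ k f) (ENNReal.ofReal p) volume) k

lemma weight_mul_symSize_le {p q : ℝ} (hq : 1 ≤ q) (f : EuclideanSpace ℝ (Fin n) → ℂ)
    (k : Fin n → ℤ) : weight s k * symSize p ρ f k ≤ gmENorm s p q ρ f := by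
  rw [symSize, mul_left_comm, mul_add]
  calc _ ≤ 2⁻¹ * (gmENorm s p q ρ f + gmENorm s p q ρ f) := by
        gcongr
        · exact weight_mul_eLpNorm_box_le hq f k
        · rw [← weight_neg]; exact weight_mul_eLpNorm_box_le hq f (-k)
    _ = _ := by
        rw [← two_mul, ← mul_assoc, ENNReal.inv_mul_cancel two_ne_zero ENNReal.ofNat_ne_top, one_mul]

lemma lqNorm_weight_mul_symSize_le {p q : ℝ} (hq : 1 ≤ q) (f : EuclideanSpace ℝ (Fin n) → ℂ) :
    lqNorm q (fun k => weight s k * symSize p ρ f k) ≤ gmENorm s p q ρ f := by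
  set g : (Fin n → ℤ) → ℝ≥0∞ :=
    fun k => weight s k * eLpNorm (box ρ k f) (ENNReal.ofReal p) volume with hg
  have h1 : (fun k => weight s k * symSize p ρ f k) =
      fun k => 2⁻¹ * (g k + g (Equiv.neg _ k)) := by
    ext k
    rw [symSize, mul_left_comm, mul_add]
    simp only [hg, Equiv.neg_apply, weight_neg]
  rw [h1, lqNorm_const_mul hq]
  calc _ ≤ 2⁻¹ * (lqNorm q g + lqNorm q fun k => g (Equiv.neg _ k)) := by
        gcongr; exact lqNorm_add_le hq _ _
    _ = gmENorm s p q ρ f := by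
        rw [lqNorm_comp_equiv, ← two_mul, ← mul_assoc,
          ENNReal.inv_mul_cancel two_ne_zero ENNReal.ofNat_ne_top, one_mul, gmENorm_eq_lqNorm hq]

lemma symSize_le {p q N : ℝ} (hN : 0 ≤ N) (hq : 1 ≤ q) {f : EuclideanSpace ℝ (Fin n) → ℂ}
    (hf : gmENorm s p q ρ f ≤ ENNReal.ofReal N) (k : Fin n → ℤ) :
    symSize p ρ f k ≤ ENNReal.ofReal (N * Real.exp (-‖latticePoint k‖ ^ (1 / s))) := by
  have h1 := (weight_mul_symSize_le hq f k).trans hf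
  rw [ENNReal.ofReal_mul hN, Real.exp_neg, ENNReal.ofReal_inv_of_pos (Real.exp_pos _),
    ← div_eq_mul_inv, ENNReal.le_div_iff_mul_le (Or.inl (by positivity))
      (Or.inl ENNReal.ofReal_ne_top), mul_comm]
  exact h1

open Classical in
theorem exists_low_high_decomposition {p q : ℝ} (hs : 1 < s) (hp : 1 ≤ p) (hq : 1 ≤ q)
    (hρ : GeneratesDecomposition s ρ) :
    ∃ A : ℝ, 0 < A ∧ ∀ (u : EuclideanSpace ℝ (Fin n) → ℝ) (N R : ℝ), 0 ≤ N → 0 ≤ R →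
      StretchedIntegrable (1 / s) (fun x => (u x : ℂ)) →
      gmENorm s p q ρ (fun x => (u x : ℂ)) ≤ ENNReal.ofReal N →
      ∃ (u₀ : EuclideanSpace ℝ (Fin n) → ℝ) (a : (Fin n → ℤ) → ℝ≥0∞)
        (F : (Fin n → ℤ) → EuclideanSpace ℝ (Fin n) → ℂ),
        AEStronglyMeasurable (fun x => (u₀ x : ℂ)) volume ∧ (∀ x, |u₀ x| ≤ A * N) ∧
        HasSpectrumIn (fun x => (u₀ x : ℂ)) (latticeCube 0 (R + 4)) ∧
        eLpNorm (fun x => (u₀ x : ℂ)) (ENNReal.ofReal p) volume ≤ ENNReal.ofReal (A * N) ∧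
        IsAtomic s 4 a F ∧
        ∑' k, lowWeight s k * a k ≤
          ENNReal.ofReal (A * N * Real.exp (-((1 - 1 / s) / 2) * R ^ (1 / s))) ∧
        familyNorm s p q F ≤ ENNReal.ofReal N ∧
        ∀ᵐ x, (u x : ℂ) = u₀ x + ∑' k, F k x := by
  obtain ⟨C, hC, hbern⟩ := exists_enorm_box_le hp hs hρ
  obtain ⟨ha0, -⟩ := one_div_nonneg_and_le_one hs
  have hs0 : 0 < s := by linarith
  have ha0' : 0 < 1 / s := by positivity
  have ha1 : 1 / s < 1 := by rw [div_lt_one hs0]; exact hs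
  -- After paying the smaller weight, decay with rate 1 - 1/s = 2β is left: one half makes the
  -- lattice sum converge, the other gives the gain in R.
  set β : ℝ := (1 - 1 / s) / 2 with hβ
  have hβ0 : 0 < β := by rw [hβ]; linarith
  have hsum : Summable fun k : Fin n → ℤ => Real.exp (-β * ‖latticePoint k‖ ^ (1 / s)) :=
    summable_exp_neg_mul_norm_latticePoint_rpow hβ0 ha0'
  set T : ℝ := ∑' k : Fin n → ℤ, Real.exp (-β * ‖latticePoint k‖ ^ (1 / s)) with hT
  have hT0 : 0 ≤ T := tsum_nonneg fun _ => (Real.exp_pos _).le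
  have hTsum : ∑' k : Fin n → ℤ, ENNReal.ofReal (Real.exp (-β * ‖latticePoint k‖ ^ (1 / s))) =
      ENNReal.ofReal T := (ENNReal.ofReal_tsum_of_nonneg (fun _ => (Real.exp_pos _).le) hsum).symm
  refine ⟨(C + 1) * (T + 1), by positivity, fun u N R hN hR hu hNu => ?_⟩
  set f : EuclideanSpace ℝ (Fin n) → ℂ := fun x => (u x : ℂ) with hf
  set v := symBox ρ f with hv
  set d := symSize p ρ f with hd
  have hvm := fun k => aestronglyMeasurable_symBox hs hρ hu k
  have hdle := fun k => symSize_le hN hq hNu k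
  have hvb : ∀ k x, ‖v k x‖ₑ ≤ ENNReal.ofReal C * d k := fun k x => by
    rw [hv, symBox, enorm_mul, enorm_two_inv, hd, symSize, mul_left_comm]
    gcongr
    refine (enorm_add_le _ _).trans ?_
    rw [enorm_conj, mul_add]
    exact add_le_add (hbern f hu k x) (hbern f hu (-k) x)
  have hvs : ∀ k, HasSpectrumIn (v k) (latticeCube k 4) := fun k => by
    have hbd : ∀ k x, ‖box ρ k f x‖ ≤
        (ENNReal.ofReal C * eLpNorm (box ρ k f) (ENNReal.ofReal p) volume).toReal := fun k x => by
      have hfin : ENNReal.ofReal C * eLpNorm (box ρ k f) (ENNReal.ofReal p) volume < ⊤ := by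
        refine ENNReal.mul_lt_top ENNReal.ofReal_lt_top ?_
        refine (le_mul_of_one_le_left' (one_le_weight (s := s) k)).trans_lt
          ((weight_mul_eLpNorm_box_le hq f k).trans_lt (hNu.trans_lt ENNReal.ofReal_lt_top))
      have := ENNReal.toReal_mono hfin.ne (hbern f hu k x)
      rwa [toReal_enorm] at this
    have h1 := hasSpectrumIn_box hs hρ hu (hbd k)
    have h2 := (hasSpectrumIn_box hs hρ hu (hbd (-k))).conj
    rw [neg_neg] at h2
    exact (h1.add h2 (aestronglyMeasurable_box hs hρ hu k) (hbd k)
      (aestronglyMeasurable_conj (aestronglyMeasurable_box hs hρ hu (-k)))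
      (fun x => by rw [Complex.norm_conj]; exact hbd (-k) x)).const_mul _
  have hlowd : ∀ k, lowWeight s k * (ENNReal.ofReal C * d k) ≤
      ENNReal.ofReal (C * N * Real.exp (-(2 * β) * ‖latticePoint k‖ ^ (1 / s))) := fun k => by
    calc _ ≤ lowWeight s k * (ENNReal.ofReal C *
          ENNReal.ofReal (N * Real.exp (-‖latticePoint k‖ ^ (1 / s)))) := by
          gcongr; exact hdle k
      _ = _ := by
          rw [lowWeight, ← ENNReal.ofReal_mul hC.le, ← ENNReal.ofReal_mul (Real.exp_pos _).le]
          congr 1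
          rw [hβ, show -(2 * ((1 - 1 / s) / 2)) * ‖latticePoint k‖ ^ (1 / s) =
            1 / s * ‖latticePoint k‖ ^ (1 / s) + -‖latticePoint k‖ ^ (1 / s) by ring, Real.exp_add]
          ring
  have hnn : ∀ k : Fin n → ℤ, 0 ≤ ‖latticePoint k‖ ^ (1 / s) := fun k => by positivity
  have hexp1 : ∀ k : Fin n → ℤ, Real.exp (-‖latticePoint k‖ ^ (1 / s)) ≤
      Real.exp (-β * ‖latticePoint k‖ ^ (1 / s)) := fun k => by
    refine Real.exp_le_exp.2 ?_
    have := hnn k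
    have : β ≤ 1 := by rw [hβ]; linarith
    nlinarith
  have htot : ∑' k, lowWeight s k * (ENNReal.ofReal C * d k) < ⊤ := by
    calc _ ≤ ∑' k : Fin n → ℤ, ENNReal.ofReal (C * N) *
          ENNReal.ofReal (Real.exp (-β * ‖latticePoint k‖ ^ (1 / s))) := by
          refine ENNReal.tsum_le_tsum fun k => (hlowd k).trans ?_
          rw [← ENNReal.ofReal_mul (by positivity)]
          refine ENNReal.ofReal_le_ofReal ?_
          gcongr
          linarith
      _ < ⊤ := by
          rw [ENNReal.tsum_mul_left, hTsum]
          exact ENNReal.mul_lt_top ENNReal.ofReal_lt_top ENNReal.ofReal_lt_top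
  have hat : IsAtomic s 4 (fun k => ENNReal.ofReal C * d k) v := ⟨hvm, hvb, hvs, htot⟩
  have hrec : ∀ᵐ x, f x = ∑' k, v k x := by
    have hbsum : Summable fun k => (2 * (ENNReal.ofReal C * d k)).toReal := by
      simp_rw [ENNReal.toReal_mul (a := 2)]
      exact (hat.summable_toReal hs).mul_left _
    have hbb : ∀ k x, ‖box ρ k f x‖ ≤ (2 * (ENNReal.ofReal C * d k)).toReal := fun k x => by
      have h1 : ‖box ρ k f x‖ₑ ≤ 2 * (ENNReal.ofReal C * d k) := by
        refine (hbern f hu k x).trans ?_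
        rw [hd, symSize, mul_left_comm, ← mul_assoc 2, ENNReal.mul_inv_cancel two_ne_zero
          ENNReal.ofNat_ne_top, one_mul]
        gcongr
        exact le_self_add
      have := ENNReal.toReal_mono
        (ENNReal.mul_lt_top ENNReal.ofNat_lt_top (hat.lt_top hs k)).ne h1
      rwa [toReal_enorm] at this
    filter_upwards [ae_eq_tsum_box hs hρ hu hbsum hbb] with x hx
    have hsx : Summable fun k => box ρ k f x := Summable.of_norm_bounded hbsum fun k => hbb k x
    have hsx' : Summable fun k => (starRingEnd ℂ) (box ρ (-k) f x) := by
      have h1 : Summable fun k => box ρ (-k) f x := (Equiv.neg _).summable_iff.2 hsx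
      exact Summable.of_norm (by simpa using h1.norm)
    -- Reflecting the index and conjugating does not change the reconstruction, because f is
    -- real-valued.
    have h2 : ∑' k, (starRingEnd ℂ) (box ρ (-k) f x) = f x := by
      have h3 := (Equiv.neg (Fin n → ℤ)).tsum_eq fun k => (starRingEnd ℂ) (box ρ k f x)
      simp only [Equiv.neg_apply] at h3
      rw [h3, ← Complex.conj_tsum, ← hx]
      simp [hf]
    simp only [hv, symBox]
    rw [tsum_mul_left, hsx.tsum_add hsx', ← hx, h2]
    ring
  set S : Set (Fin n → ℤ) := {k | ‖latticePoint k‖ ≤ R} with hS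
  have hSneg : ∀ k, -k ∈ S ↔ k ∈ S := fun k => by simp [hS, latticePoint_neg]
  set L : (Fin n → ℤ) → EuclideanSpace ℝ (Fin n) → ℂ := fun k => if k ∈ S then v k else 0 with hL
  set H : (Fin n → ℤ) → EuclideanSpace ℝ (Fin n) → ℂ := fun k => if k ∈ S then 0 else v k with hH
  set a : (Fin n → ℤ) → ℝ≥0∞ := fun k => if k ∈ S then 0 else ENNReal.ofReal C * d k with ha
  have hLle : ∀ k x, ‖L k x‖ₑ ≤ ENNReal.ofReal C * d k := fun k x => by
    by_cases hk : k ∈ S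
    · simpa [hL, hk] using hvb k x
    · simp [hL, hk]
  have hLb : ∀ k x, ‖L k x‖ ≤ (ENNReal.ofReal C * d k).toReal := fun k x => by
    have := ENNReal.toReal_mono (hat.lt_top hs k).ne (hLle k x)
    rwa [toReal_enorm] at this
  have hLm : ∀ k, AEStronglyMeasurable (L k) volume := fun k => by
    by_cases hk : k ∈ S
    · simpa [hL, hk] using hvm k
    · simpa [hL, hk] using aestronglyMeasurable_zero
  have hconj : ∀ x, (starRingEnd ℂ) (∑' k, L k x) = ∑' k, L k x := fun x => by
    rw [Complex.conj_tsum, ← (Equiv.neg (Fin n → ℤ)).tsum_eq]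
    refine tsum_congr fun k => ?_
    by_cases hk : k ∈ S
    · simp [hL, hk, hSneg, hv, conj_symBox]
    · simp [hL, hk, hSneg]
  have hreal : ∀ x, (((∑' k, L k x).re : ℝ) : ℂ) = ∑' k, L k x := fun x =>
    Complex.conj_eq_iff_re.1 (hconj x)
  have hu0 : (fun x => (((∑' k, L k x).re : ℝ) : ℂ)) = fun x => ∑' k, L k x := funext hreal
  refine ⟨fun x => (∑' k, L k x).re, a, H, ?_, fun x => ?_, ?_, ?_, ⟨fun k => ?_, fun k x => ?_,
    fun k => ?_, ?_⟩, ?_, ?_, ?_⟩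
  · rw [hu0]
    exact aestronglyMeasurable_tsum (hat.summable_toReal hs) hLm hLb
  · rw [← Real.norm_eq_abs, ← Complex.norm_real, hreal]
    have h1 : ∑' k, (ENNReal.ofReal C * d k) ≤ ENNReal.ofReal (C * N * T) := by
      rw [ENNReal.ofReal_mul (by positivity), ← hTsum, ← ENNReal.tsum_mul_left]
      refine ENNReal.tsum_le_tsum fun k => ?_
      rw [← ENNReal.ofReal_mul (by positivity)]
      calc _ ≤ ENNReal.ofReal C *
            ENNReal.ofReal (N * Real.exp (-‖latticePoint k‖ ^ (1 / s))) := by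
            gcongr; exact hdle k
        _ ≤ _ := by
            rw [← ENNReal.ofReal_mul hC.le]
            refine ENNReal.ofReal_le_ofReal ?_
            rw [mul_assoc]
            gcongr
            exact Real.exp_le_exp.1 (hexp1 k)
    have h2 : ‖∑' k, L k x‖ₑ ≤ ENNReal.ofReal (C * N * T) :=
      (enorm_tsum_le_tsum_enorm.trans (ENNReal.tsum_le_tsum fun k => hLle k x)).trans h1
    rw [← ofReal_norm, ENNReal.ofReal_le_ofReal_iff (by positivity)] at h2
    refine h2.trans ?_
    nlinarith [mul_nonneg hT0 hN, mul_nonneg hC.le hN]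
  · rw [hu0]
    refine HasSpectrumIn.tsum (hat.summable_toReal hs) hLm hLb fun k => ?_
    by_cases hk : k ∈ S
    · simp only [hL, hk, if_true]
      refine (hvs k).mono fun ξ hξ i => ?_
      have h1 := (abs_coord_le_norm (latticePoint k) i).trans hk
      have h2 := hξ i
      rw [latticePoint_apply] at h1
      rw [abs_le] at h1 h2 ⊢
      simp only [Pi.zero_apply, Int.cast_zero, sub_zero]
      constructor <;> linarith
    · simp only [hL, hk, if_false]
      exact HasSpectrumIn.zero _
  · rw [hu0]
    refine (eLpNorm_tsum_le hp hLm).trans ?_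
    calc ∑' k, eLpNorm (L k) (ENNReal.ofReal p) volume ≤ ∑' k, d k := by
          refine ENNReal.tsum_le_tsum fun k => ?_
          by_cases hk : k ∈ S
          · simpa only [hL, hk, if_true] using eLpNorm_symBox_le hp hs hρ hu k
          · simp [hL, hk]
      _ ≤ ∑' k : Fin n → ℤ, ENNReal.ofReal N *
            ENNReal.ofReal (Real.exp (-β * ‖latticePoint k‖ ^ (1 / s))) := by
          refine ENNReal.tsum_le_tsum fun k => (hdle k).trans ?_
          rw [← ENNReal.ofReal_mul hN]
          refine ENNReal.ofReal_le_ofReal ?_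
          gcongr
          exact Real.exp_le_exp.1 (hexp1 k)
      _ = ENNReal.ofReal (N * T) := by
          rw [ENNReal.tsum_mul_left, hTsum, ENNReal.ofReal_mul hN]
      _ ≤ _ := by
          refine ENNReal.ofReal_le_ofReal ?_
          nlinarith [mul_nonneg hT0 hN, mul_nonneg hC.le hN, mul_nonneg (mul_nonneg hC.le hN) hT0]
  · by_cases hk : k ∈ S
    · simpa [hH, hk] using aestronglyMeasurable_zero
    · simpa [hH, hk] using hvm k
  · by_cases hk : k ∈ S
    · simp [hH, ha, hk]
    · simpa [hH, ha, hk] using hvb k x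
  · by_cases hk : k ∈ S
    · simp only [hH, hk, if_true]
      exact HasSpectrumIn.zero _
    · simpa only [hH, hk, if_false] using hvs k
  · refine (ENNReal.tsum_le_tsum fun k => ?_).trans_lt htot
    by_cases hk : k ∈ S
    · simp [ha, hk]
    · simp [ha, hk]
  · calc ∑' k, lowWeight s k * a k ≤ ∑' k : Fin n → ℤ,
          ENNReal.ofReal (C * N * Real.exp (-β * R ^ (1 / s))) *
            ENNReal.ofReal (Real.exp (-β * ‖latticePoint k‖ ^ (1 / s))) := by
          refine ENNReal.tsum_le_tsum fun k => ?_
          by_cases hk : k ∈ S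
          · simp [ha, hk]
          · simp only [ha, hk, if_false]
            refine (hlowd k).trans ?_
            rw [← ENNReal.ofReal_mul (by positivity), mul_assoc (C * N), ← Real.exp_add]
            refine ENNReal.ofReal_le_ofReal ?_
            gcongr
            have h1 : R ^ (1 / s) ≤ ‖latticePoint k‖ ^ (1 / s) :=
              Real.rpow_le_rpow hR (not_le.1 hk).le ha0
            nlinarith
      _ = ENNReal.ofReal (C * N * Real.exp (-β * R ^ (1 / s)) * T) := by
          rw [ENNReal.tsum_mul_left, hTsum, ← ENNReal.ofReal_mul (by positivity)]
      _ ≤ _ := by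
          refine ENNReal.ofReal_le_ofReal ?_
          have h0 : 0 ≤ N * Real.exp (-β * R ^ (1 / s)) := by positivity
          have h1 := mul_nonneg hT0 h0
          have h2 := mul_nonneg hC.le h0
          nlinarith
  · refine le_trans ?_ ((lqNorm_weight_mul_symSize_le hq f).trans hNu)
    refine lqNorm_mono hq fun k => ?_
    by_cases hk : k ∈ S
    · simp [hH, hk]
    · simp only [hH, hk, if_false]
      gcongr
      exact eLpNorm_symBox_le hp hs hρ hu k
  · filter_upwards [hrec] with x hx
    rw [hreal]
    have h1 : Summable fun k => L k x :=
      Summable.of_norm_bounded (hat.summable_toReal hs) fun k => hLb k x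
    have h2 : Summable fun k => H k x := by
      refine Summable.of_norm_bounded (hat.summable_toReal hs) fun k => ?_
      by_cases hk : k ∈ S
      · simp only [hH, hk, if_true, Pi.zero_apply, norm_zero]
        exact ENNReal.toReal_nonneg
      · simpa only [hH, hk, if_false] using hat.norm_le hs k x
    have h3 : (u x : ℂ) = f x := rfl
    rw [h3, hx, ← h1.tsum_add h2]
    refine tsum_congr fun k => ?_
    by_cases hk : k ∈ S
    · simp [hL, hH, hk]
    · simp [hL, hH, hk]

end GevreyModulation

end

noncomputable section

namespace GevreyModulation

open MeasureTheory
open scoped ENNReal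

variable {n : ℕ}

/-! ### Splitting the exponential series -/

/-- From l^l / l! ≤ e^l and M ≤ e^{-3} l. Of the resulting e^{-2l}, one e^{-l} will pay for the size
of the spectrum and the other for summability. -/
lemma pow_div_factorial_le_exp_neg {M : ℝ} {l : ℕ} (hM : 0 ≤ M) (h : Real.exp 3 * M ≤ l) :
    M ^ l / l.factorial ≤ Real.exp (-2 * l) := by
  have h1 := Real.pow_div_factorial_le_exp (l : ℝ) (Nat.cast_nonneg _) l
  have h2 : M ≤ Real.exp (-3) * l := by
    rw [Real.exp_neg, ← div_eq_inv_mul, le_div_iff₀ (Real.exp_pos _), mul_comm]; exact h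
  calc M ^ l / l.factorial ≤ (Real.exp (-3) * l) ^ l / l.factorial := by gcongr
    _ = Real.exp (-3) ^ l * ((l : ℝ) ^ l / l.factorial) := by rw [mul_pow, mul_div_assoc]
    _ ≤ Real.exp (-3) ^ l * Real.exp l := by gcongr
    _ = _ := by rw [← Real.exp_nat_mul, ← Real.exp_add]; congr 1; ring

/-- The degrees of the blocks of the exponential series. -/
def blockDegree (L : ℕ) : ℕ → ℕ
  | 0 => L
  | j + 1 => L + j

/-- Bounds for the blocks of the exponential series. -/
def blockSize (L : ℕ) : ℕ → ℝ
  | 0 => 2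
  | j + 1 => Real.exp (-2 * (L + j : ℕ))

/-- The blocks of the exponential series of `i v`: the first `L` terms form one block, and each of
the other terms is a block of its own. -/
def expBlock (L : ℕ) (v : EuclideanSpace ℝ (Fin n) → ℝ) : ℕ → EuclideanSpace ℝ (Fin n) → ℂ
  | 0 => fun x => ∑ l ∈ Finset.range L, (Complex.I * v x) ^ l / l.factorial
  | j + 1 => fun x => (Complex.I * v x) ^ (L + j) / (L + j).factorial

lemma hasSum_complex_exp (z : ℂ) : HasSum (fun l : ℕ => z ^ l / l.factorial) (Complex.exp z) := by
  rw [Complex.exp_eq_exp_ℂ]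
  exact NormedSpace.expSeries_div_hasSum_exp z

lemma hasSum_real_exp (t : ℝ) : HasSum (fun l : ℕ => t ^ l / l.factorial) (Real.exp t) := by
  rw [Real.exp_eq_exp_ℝ]
  exact NormedSpace.expSeries_div_hasSum_exp t

variable {L : ℕ} {v : EuclideanSpace ℝ (Fin n) → ℝ} {M : ℝ}

lemma hasSum_expBlock_succ (x : EuclideanSpace ℝ (Fin n)) :
    HasSum (fun j => expBlock L v (j + 1) x)
      (Complex.exp (Complex.I * v x) - expBlock L v 0 x) := by
  have h := (hasSum_nat_add_iff' L).2 (hasSum_complex_exp (Complex.I * v x))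
  simp_rw [add_comm _ L] at h
  exact h

lemma hasSum_expBlock (x : EuclideanSpace ℝ (Fin n)) :
    HasSum (fun j => expBlock L v j x) (Complex.exp (Complex.I * v x)) := by
  refine (hasSum_nat_add_iff' 1).1 ?_
  simpa using hasSum_expBlock_succ x

lemma blockSize_nonneg (L j : ℕ) : 0 ≤ blockSize L j := by
  rcases j with _ | j
  · exact zero_le_two
  · exact (Real.exp_pos _).le

lemma exp_neg_two_mul_le (hL : 1 ≤ L) (j : ℕ) :
    Real.exp (-2 * (L + j : ℕ)) ≤ 1 / 2 / 2 ^ j := by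
  have h1 : Real.exp (-2) ≤ 1 / 2 := by
    rw [Real.exp_neg, one_div]
    gcongr
    linarith [Real.add_one_le_exp (2 : ℝ)]
  have h2 : (1 : ℝ) / 2 / 2 ^ j = (1 / 2) ^ (j + 1) := by
    rw [pow_succ, one_div_pow]; ring
  rw [h2]
  calc Real.exp (-2 * (L + j : ℕ)) ≤ Real.exp (-2 * (j + 1 : ℕ)) := by
        refine Real.exp_le_exp.2 ?_
        have : (1 : ℝ) ≤ L := by exact_mod_cast hL
        push_cast; linarith
    _ = Real.exp (-2) ^ (j + 1) := by rw [← Real.exp_nat_mul, mul_comm]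
    _ ≤ _ := by gcongr

/-- The second bound trades one power of M for |v x|, which is possible as M ≥ 1; the factor |v x|
keeps the block in L^p. -/
lemma norm_expBlock_succ_le (hM : 1 ≤ M) (hL : 1 ≤ L) (hML : Real.exp 3 * M ≤ L)
    (hv : ∀ x, |v x| ≤ M) (j : ℕ) (x : EuclideanSpace ℝ (Fin n)) :
    ‖expBlock L v (j + 1) x‖ ≤ blockSize L (j + 1) ∧
      ‖expBlock L v (j + 1) x‖ ≤ blockSize L (j + 1) * |v x| := by
  have h0 : ‖expBlock L v (j + 1) x‖ = |v x| ^ (L + j) / (L + j).factorial := by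
    simp [expBlock]
  have h1 : M ^ (L + j) / (L + j).factorial ≤ blockSize L (j + 1) := by
    refine pow_div_factorial_le_exp_neg (by linarith) (hML.trans ?_)
    push_cast
    linarith [(Nat.cast_nonneg j : (0 : ℝ) ≤ j)]
  rw [h0]
  constructor
  · refine le_trans ?_ h1
    gcongr
    exact hv x
  · obtain ⟨m, hm⟩ : ∃ m, L + j = m + 1 := ⟨L + j - 1, by omega⟩
    calc |v x| ^ (L + j) / (L + j).factorial ≤ (M ^ (L + j) * |v x|) / (L + j).factorial := by
          gcongr
          rw [hm, pow_succ]
          gcongr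
          calc |v x| ^ m ≤ M ^ m := by gcongr; exact hv x
            _ ≤ M ^ (m + 1) := pow_le_pow_right₀ hM (Nat.le_succ m)
      _ = M ^ (L + j) / (L + j).factorial * |v x| := by ring
      _ ≤ _ := by gcongr

lemma norm_exp_sub_expBlock_zero_le (hM : 1 ≤ M) (hL : 1 ≤ L) (hML : Real.exp 3 * M ≤ L)
    (hv : ∀ x, |v x| ≤ M) (x : EuclideanSpace ℝ (Fin n)) :
    ‖Complex.exp (Complex.I * v x) - expBlock L v 0 x‖ ≤ 1 ∧
      ‖Complex.exp (Complex.I * v x) - expBlock L v 0 x‖ ≤ |v x| := by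
  constructor
  · refine (hasSum_expBlock_succ x).norm_le_of_bounded (hasSum_geometric_two' 1) fun j => ?_
    exact (norm_expBlock_succ_le hM hL hML hv j x).1.trans (exp_neg_two_mul_le hL j)
  · have := (hasSum_geometric_two' 1).mul_right |v x|
    rw [one_mul] at this
    refine (hasSum_expBlock_succ x).norm_le_of_bounded this fun j => ?_
    refine (norm_expBlock_succ_le hM hL hML hv j x).2.trans ?_
    gcongr
    exact exp_neg_two_mul_le hL j

/-- The long block is e^{iv}, of modulus 1 because v is real, minus a tail of size at most 1. No
power of M appears, although individual terms may be as large as e^M. -/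
lemma norm_expBlock_le (hM : 1 ≤ M) (hL : 1 ≤ L) (hML : Real.exp 3 * M ≤ L)
    (hv : ∀ x, |v x| ≤ M) (j : ℕ) (x : EuclideanSpace ℝ (Fin n)) :
    ‖expBlock L v j x‖ ≤ blockSize L j := by
  rcases j with _ | j
  · have h1 := (norm_exp_sub_expBlock_zero_le hM hL hML hv x).1
    have h2 : ‖Complex.exp (Complex.I * v x)‖ = 1 := Complex.norm_exp_I_mul_ofReal _
    have h3 := norm_sub_norm_le (expBlock L v 0 x) (Complex.exp (Complex.I * v x))
    rw [norm_sub_rev] at h3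
    simp only [blockSize]
    linarith
  · exact (norm_expBlock_succ_le hM hL hML hv j x).1

/-- Subtracting 1 from the zeroth block makes every block vanish with v; there |e^{iv} - 1| and the
tail contribute |v x| each. -/
lemma norm_expBlock_sub_le (hM : 1 ≤ M) (hL : 1 ≤ L) (hML : Real.exp 3 * M ≤ L)
    (hv : ∀ x, |v x| ≤ M) (j : ℕ) (x : EuclideanSpace ℝ (Fin n)) :
    ‖expBlock L v j x - (if j = 0 then 1 else 0)‖ ≤ blockSize L j * |v x| := by
  rcases j with _ | j
  · have h1 := (norm_exp_sub_expBlock_zero_le hM hL hML hv x).2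
    have h2 := Real.norm_exp_I_mul_ofReal_sub_one_le (x := v x)
    have h3 := norm_sub_le (Complex.exp (Complex.I * v x) - 1)
      (Complex.exp (Complex.I * v x) - expBlock L v 0 x)
    rw [show Complex.exp (Complex.I * v x) - 1 - (Complex.exp (Complex.I * v x) -
      expBlock L v 0 x) = expBlock L v 0 x - 1 by ring] at h3
    rw [Real.norm_eq_abs] at h2
    simp only [blockSize, if_true]
    linarith
  · simpa using (norm_expBlock_succ_le hM hL hML hv j x).2

lemma aestronglyMeasurable_expBlock (hv : AEStronglyMeasurable (fun x => (v x : ℂ)) volume)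
    (L j : ℕ) : AEStronglyMeasurable (expBlock L v j) volume := by
  have h1 : ∀ l : ℕ, AEStronglyMeasurable
      (fun x => (Complex.I * v x) ^ l / (l.factorial : ℂ)) volume := fun l => by
    simp_rw [div_eq_mul_inv]
    exact ((hv.const_mul _).pow l).mul_const _
  rcases j with _ | j
  · have := Finset.aestronglyMeasurable_sum (Finset.range L) fun l _ => h1 l
    simpa only [Finset.sum_fn] using! this
  · exact h1 _

lemma hasSpectrumIn_expBlock {P : ℝ} (hP : 0 ≤ P)
    (hvm : AEStronglyMeasurable (fun x => (v x : ℂ)) volume)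
    (hv : ∀ x, |v x| ≤ M) (hs : HasSpectrumIn (fun x => (v x : ℂ)) (latticeCube 0 P)) (L j : ℕ) :
    HasSpectrumIn (expBlock L v j) (latticeCube 0 (blockDegree L j * P)) := by
  have hvb : ∀ x, ‖(v x : ℂ)‖ ≤ M := fun x => by simpa using hv x
  have h1 : ∀ l : ℕ, HasSpectrumIn
      (fun x => (Complex.I * v x) ^ l / (l.factorial : ℂ)) (latticeCube 0 (l * P)) := fun l => by
    have := (hs.pow hvm hvb l).const_mul (Complex.I ^ l / l.factorial)
    convert this using 2
    rw [mul_pow]; ring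
  have h2 : ∀ l : ℕ, AEStronglyMeasurable
      (fun x => (Complex.I * v x) ^ l / (l.factorial : ℂ)) volume := fun l => by
    simp_rw [div_eq_mul_inv]
    exact ((hvm.const_mul _).pow l).mul_const _
  have h3 : ∀ (l : ℕ) x, ‖(Complex.I * v x) ^ l / (l.factorial : ℂ)‖ ≤ M ^ l / l.factorial :=
    fun l x => by
      rw [norm_div, norm_pow, norm_mul, Complex.norm_I, one_mul, Complex.norm_natCast]
      gcongr
      exact hvb x
  rcases j with _ | j
  · refine HasSpectrumIn.sum (Finset.range L) (fun l _ => h2 l) (fun l _ => h3 l) fun l hl => ?_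
    refine (h1 l).mono (latticeCube_mono 0 ?_)
    have : (l : ℝ) ≤ L := by exact_mod_cast (Finset.mem_range.1 hl).le
    simp only [blockDegree]
    gcongr
  · exact h1 _

/-! ### Growth of the blocks -/

lemma exists_mul_rpow_mul_log_le {a c : ℝ} (ha0 : 0 ≤ a) (ha1 : a < 1) (hc : 0 ≤ c) :
    ∃ C : ℝ, ∀ t : ℝ, 1 ≤ t → c * (t ^ a * Real.log t) ≤ t + C := by
  have h1 := (isLittleO_log_rpow_atTop (sub_pos.2 ha1)).bound (c := 1 / (c + 1)) (by positivity)
  obtain ⟨T, hT⟩ := Filter.eventually_atTop.1 h1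
  set T' := max T 1
  have hT1 : 1 ≤ T' := le_max_right _ _
  have hC : 0 ≤ c * (T' ^ a * Real.log T') := by
    have := Real.log_nonneg hT1
    positivity
  refine ⟨c * (T' ^ a * Real.log T'), fun t ht => ?_⟩
  have ht0 : 0 < t := by linarith
  have hlog : 0 ≤ Real.log t := Real.log_nonneg ht
  rcases le_total t T' with h | h
  · have : c * (t ^ a * Real.log t) ≤ c * (T' ^ a * Real.log T') := by gcongr
    linarith
  · have h2 := hT t ((le_max_left _ _).trans h)
    rw [Real.norm_of_nonneg hlog, Real.norm_of_nonneg (by positivity)] at h2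
    have h3 : t ^ a * t ^ (1 - a) = t := by rw [← Real.rpow_add ht0]; simp
    have h4 : c / (c + 1) ≤ 1 := by rw [div_le_one (by positivity)]; linarith
    calc c * (t ^ a * Real.log t) ≤ c * (t ^ a * (1 / (c + 1) * t ^ (1 - a))) := by gcongr
      _ = c / (c + 1) * (t ^ a * t ^ (1 - a)) := by ring
      _ ≤ 1 * t := by rw [h3]; gcongr
      _ ≤ _ := by linarith

/-- Here (κ log X)^s is the cut-off R, so the spectral cost of degree l has exponent of order
l^(1/s) log X. For the long block l is comparable to X, which gives the main term. For the others
log X ≤ log l, and l^(1/s) log l grows slower than l. -/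
lemma exists_blockSize_mul_exp_le {s B κ D : ℝ} (hs : 1 < s) (hB : 0 ≤ B) (hκ : 0 ≤ κ)
    (hD : 1 ≤ D) :
    ∃ C b : ℝ, 0 < C ∧ 0 < b ∧ ∀ X : ℝ, 2 ≤ X → ∀ L : ℕ, X ≤ L → L ≤ D * X → ∀ j,
      blockSize L j * Real.exp (B * (blockDegree L j * ((κ * Real.log X) ^ s + 4) + 1) ^ (1 / s)) ≤
        C * Real.exp (b * X ^ (1 / s) * Real.log X) * (1 / 2) ^ j := by
  have hs0 : 0 < s := by linarith
  obtain ⟨ha0, ha1⟩ := one_div_nonneg_and_le_one hs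
  have ha1' : 1 / s < 1 := by rw [div_lt_one hs0]; exact hs
  obtain ⟨C, hC⟩ := exists_mul_rpow_mul_log_le ha0 ha1' (c := B * (κ + 10)) (by positivity)
  -- The summand 2 is the size of the long block and e^C serves the remaining ones. The number 10
  -- comes from 5 ≤ 10 log X, valid since log X ≥ 1/2; the final 1 makes b positive even if B = 0.
  refine ⟨2 + Real.exp C, B * (κ + 10) * D + 1, by positivity, by positivity,
    fun X hX L hXL hLX j => ?_⟩
  have hlog : 1 / 2 ≤ Real.log X := by
    have h1 : Real.log 2 ≤ Real.log X := Real.log_le_log two_pos hX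
    linarith [Real.log_two_gt_d9]
  have hlog0 : 0 ≤ Real.log X := by linarith
  have hR : ((κ * Real.log X) ^ s) ^ (1 / s) = κ * Real.log X := by
    rw [← Real.rpow_mul (by positivity), mul_one_div_cancel hs0.ne', Real.rpow_one]
  have key : ∀ l : ℕ, 1 ≤ l → (l * ((κ * Real.log X) ^ s + 4) + 1) ^ (1 / s) ≤
      (κ + 10) * ((l : ℝ) ^ (1 / s) * Real.log X) := fun l hl => by
    have hl' : (1 : ℝ) ≤ l := by exact_mod_cast hl
    have h5 : (5 : ℝ) ^ (1 / s) ≤ 5 := by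
      calc (5 : ℝ) ^ (1 / s) ≤ 5 ^ (1 : ℝ) :=
            Real.rpow_le_rpow_of_exponent_le (by norm_num) ha1
        _ = 5 := Real.rpow_one _
    calc (l * ((κ * Real.log X) ^ s + 4) + 1) ^ (1 / s)
        ≤ (l * ((κ * Real.log X) ^ s + 5)) ^ (1 / s) := by
          refine Real.rpow_le_rpow (by positivity) ?_ ha0
          linarith
      _ = (l : ℝ) ^ (1 / s) * ((κ * Real.log X) ^ s + 5) ^ (1 / s) :=
          Real.mul_rpow (by positivity) (by positivity)
      _ ≤ (l : ℝ) ^ (1 / s) * (κ * Real.log X + 5) := by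
          gcongr
          refine (add_rpow_le_add_rpow ha0 ha1 (by positivity) (by norm_num)).trans ?_
          rw [hR]
          gcongr
      _ ≤ (l : ℝ) ^ (1 / s) * ((κ + 10) * Real.log X) := by
          gcongr
          linarith
      _ = _ := by ring
  have hL1 : 1 ≤ L := by
    have : (1 : ℝ) ≤ L := by linarith
    exact_mod_cast this
  have hXa : 0 ≤ X ^ (1 / s) * Real.log X := by positivity
  rcases j with _ | j
  · simp only [blockSize, blockDegree, pow_zero, mul_one]
    refine mul_le_mul (by linarith [Real.exp_pos C]) (Real.exp_le_exp.2 ?_) (Real.exp_pos _).le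
      (by positivity)
    have h1 : (L : ℝ) ^ (1 / s) ≤ D * X ^ (1 / s) := by
      calc (L : ℝ) ^ (1 / s) ≤ (D * X) ^ (1 / s) := by gcongr
        _ = D ^ (1 / s) * X ^ (1 / s) := Real.mul_rpow (by linarith) (by linarith)
        _ ≤ D ^ (1 : ℝ) * X ^ (1 / s) := by gcongr
        _ = _ := by rw [Real.rpow_one]
    calc _ ≤ B * ((κ + 10) * ((D * X ^ (1 / s)) * Real.log X)) := by
          gcongr
          refine (key L hL1).trans ?_
          gcongr
      _ = B * (κ + 10) * D * (X ^ (1 / s) * Real.log X) := by ring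
      _ ≤ (B * (κ + 10) * D + 1) * (X ^ (1 / s) * Real.log X) := by gcongr; linarith
      _ = _ := by ring
  · simp only [blockSize, blockDegree]
    have hl1 : 1 ≤ L + j := by omega
    set l := L + j with hl
    have hl1' : (1 : ℝ) ≤ l := by exact_mod_cast hl1
    have hXl : X ≤ l := hXL.trans (by rw [hl]; push_cast; linarith [(Nat.cast_nonneg j : (0:ℝ) ≤ j)])
    have h1 : B * (l * ((κ * Real.log X) ^ s + 4) + 1) ^ (1 / s) ≤ l + C := by
      refine le_trans ?_ (hC l hl1')
      rw [mul_assoc B]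
      gcongr
      refine (key l hl1).trans ?_
      gcongr
    have h2 : Real.exp (-(l : ℝ)) ≤ (1 / 2) ^ (j + 1) := by
      have h3 : Real.exp (-1) ≤ 1 / 2 := by
        rw [Real.exp_neg, one_div]
        gcongr
        linarith [Real.add_one_le_exp (1 : ℝ)]
      calc Real.exp (-(l : ℝ)) ≤ Real.exp (-(j + 1 : ℕ)) := by
            refine Real.exp_le_exp.2 (neg_le_neg ?_)
            exact_mod_cast (by omega : j + 1 ≤ l)
        _ = Real.exp (-1) ^ (j + 1) := by rw [← Real.exp_nat_mul]; congr 1; ring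
        _ ≤ _ := by gcongr
    calc _ ≤ Real.exp (-2 * (l : ℝ)) * Real.exp (l + C) := by gcongr
      _ = Real.exp C * 1 * Real.exp (-(l : ℝ)) := by
          rw [← Real.exp_add, mul_one, ← Real.exp_add]; congr 1; ring
      _ ≤ _ := by
          gcongr
          · linarith
          · refine Real.one_le_exp ?_
            rw [mul_assoc]
            positivity

end GevreyModulation

end

noncomputable section

namespace GevreyModulation

open MeasureTheory
open scoped ENNReal

variable {n : ℕ} {s : ℝ} {ρ : EuclideanSpace ℝ (Fin n) → ℝ}

/-! ### The exponential of a function in a Gevrey-modulation space -/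

/-- The condition that the modulation norms of sums of localized functions are controlled, with
constants `C` and `B`. -/
def ControlsSums (s p q C B : ℝ) (ρ : EuclideanSpace ℝ (Fin n) → ℝ) : Prop :=
  ∀ (P : ℝ), 0 ≤ P →
    ∀ (a : (Fin n → ℤ) → ℝ≥0∞) (F : (Fin n → ℤ) → EuclideanSpace ℝ (Fin n) → ℂ),
      IsAtomic s P a F → gmENorm s p q ρ (fun x => ∑' k, F k x) ≤
        ENNReal.ofReal (C * Real.exp (B * (P + 1) ^ (1 / s))) * familyNorm s p q F

section

variable {p q C B P P' γ A : ℝ} {a : (Fin n → ℤ) → ℝ≥0∞}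
  {F : (Fin n → ℤ) → EuclideanSpace ℝ (Fin n) → ℂ} {g : EuclideanSpace ℝ (Fin n) → ℂ}

lemma IsAtomic.norm_tsum_le (hs : 1 < s) (hF : IsAtomic s P a F) (hA : 0 ≤ A)
    (hlow : ∑' k, lowWeight s k * a k ≤ ENNReal.ofReal A) (x : EuclideanSpace ℝ (Fin n)) :
    ‖∑' k, F k x‖ ≤ A := by
  rw [← ENNReal.ofReal_le_ofReal_iff hA, ofReal_norm]
  refine (enorm_tsum_le_tsum_enorm.trans (ENNReal.tsum_le_tsum fun k => ?_)).trans hlow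
  exact (hF.bound k x).trans (le_mul_of_one_le_left' (one_le_lowWeight hs k))

lemma IsAtomic.aestronglyMeasurable_tsum (hs : 1 < s) (hF : IsAtomic s P a F) :
    AEStronglyMeasurable (fun x => ∑' k, F k x) volume :=
  GevreyModulation.aestronglyMeasurable_tsum (hF.summable_toReal hs) hF.meas (hF.norm_le hs)

/-- The factor m + 1 of the tame power estimate reduces (m+1)! to m!. The spectrum grows by 4(m+1),
which costs at most e^{4B(m+1)}, again of exponential type, so the sum over m converges. -/
lemma gmENorm_mul_pow_le (hs : 1 < s) (hp : 1 ≤ p) (hq : 1 ≤ q) (hC : 0 ≤ C) (hB : 0 ≤ B)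
    (hCB : ControlsSums s p q C B ρ) (hF : IsAtomic s 4 a F) (hA : 0 ≤ A)
    (hlow : ∑' k, lowWeight s k * a k ≤ ENNReal.ofReal A) (hP' : 0 ≤ P') (hγ : 0 ≤ γ)
    (hg : HasSpectrumIn g (latticeCube 0 P')) (hgm : AEStronglyMeasurable g volume)
    (hgb : ∀ x, ‖g x‖ ≤ γ) (m : ℕ) :
    gmENorm s p q ρ
        (fun x => g x * ((Complex.I * ∑' k, F k x) ^ (m + 1) / (m + 1).factorial)) ≤
      ENNReal.ofReal (C * Real.exp (4 * B) * (γ * Real.exp (B * (P' + 1) ^ (1 / s))) *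
        ((Real.exp (4 * B) * A) ^ m / m.factorial)) * familyNorm s p q F := by
  obtain ⟨ha0, ha1⟩ := one_div_nonneg_and_le_one hs
  obtain ⟨b, G, hG, htot, -, hnorm⟩ := hF.exists_pow hs hp hq m
  set c : ℂ := Complex.I ^ (m + 1) / (m + 1).factorial with hc
  have hcn : ‖c‖ = 1 / (m + 1).factorial := by
    rw [hc, norm_div, norm_pow, Complex.norm_I, one_pow, Complex.norm_natCast]
  have hgb' : ∀ x, ‖c * g x‖ₑ ≤ ENNReal.ofReal (γ / (m + 1).factorial) := fun x => by
    rw [← ofReal_norm]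
    refine ENNReal.ofReal_le_ofReal ?_
    rw [norm_mul, hcn, div_mul_eq_mul_div, one_mul]
    gcongr
    exact hgb x
  have hat := hG.mul_left hs ENNReal.ofReal_ne_top (hg.const_mul c) (hgm.const_mul c) hgb'
  have h1 := hCB _ (by positivity) _ _ hat
  have h2 : (fun x => ∑' k, c * g x * G k x) =
      fun x => g x * ((Complex.I * ∑' k, F k x) ^ (m + 1) / (m + 1).factorial) := by
    ext x
    rw [tsum_mul_left, htot, hc, mul_pow]
    ring
  rw [h2] at h1
  have h3 : familyNorm s p q (fun k x => c * g x * G k x) ≤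
      ENNReal.ofReal (γ * (A ^ m / m.factorial)) * familyNorm s p q F := by
    calc _ ≤ ENNReal.ofReal (γ / (m + 1).factorial) *
          ((m + 1 : ℕ) * (ENNReal.ofReal A) ^ m * familyNorm s p q F) := by
          refine (familyNorm_mul_left_le hp hq hG hgb').trans ?_
          gcongr
          refine hnorm.trans ?_
          gcongr
      _ = _ := by
          rw [← ENNReal.ofReal_natCast, ← ENNReal.ofReal_pow hA, ← mul_assoc,
            ← ENNReal.ofReal_mul (by positivity), ← ENNReal.ofReal_mul (by positivity)]
          congr 2
          rw [Nat.factorial_succ]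
          push_cast
          have : (m : ℝ) + 1 ≠ 0 := by positivity
          field_simp
  refine h1.trans ((mul_le_mul_right h3 _).trans ?_)
  rw [← mul_assoc, ← ENNReal.ofReal_mul (by positivity)]
  refine mul_le_mul_left (ENNReal.ofReal_le_ofReal ?_) _
  have h4 : (P' + (m + 1 : ℕ) * 4 + 1) ^ (1 / s) ≤ (P' + 1) ^ (1 / s) + 4 * (m + 1) := by
    calc _ = ((P' + 1) + 4 * (m + 1)) ^ (1 / s) := by push_cast; ring_nf
      _ ≤ (P' + 1) ^ (1 / s) + (4 * (m + 1)) ^ (1 / s) :=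
          add_rpow_le_add_rpow ha0 ha1 (by positivity) (by positivity)
      _ ≤ (P' + 1) ^ (1 / s) + (4 * (m + 1)) ^ (1 : ℝ) := by
          gcongr
          linarith [(Nat.cast_nonneg m : (0 : ℝ) ≤ m)]
      _ = _ := by rw [Real.rpow_one]
  calc _ ≤ C * Real.exp (B * ((P' + 1) ^ (1 / s) + 4 * (m + 1))) *
        (γ * (A ^ m / m.factorial)) := by gcongr
    _ = C * (Real.exp (B * (P' + 1) ^ (1 / s)) * (Real.exp (4 * B) ^ m * Real.exp (4 * B))) *
        (γ * (A ^ m / m.factorial)) := by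
        rw [← pow_succ, ← Real.exp_nat_mul, ← Real.exp_add]
        congr 3
        push_cast; ring
    _ = _ := by rw [mul_pow]; ring

/-- Summing the power estimates builds exp(e^{4B} A), a constant once A bounds the low-weight size
of the family. The factor g is carried along because its modulation norm is never used, only its sup
norm and spectrum. -/
lemma gmENorm_mul_exp_sub_one_le (hs : 1 < s) (hp : 1 ≤ p) (hq : 1 ≤ q)
    (hρ : GeneratesDecomposition s ρ) (hC : 0 ≤ C) (hB : 0 ≤ B)
    (hCB : ControlsSums s p q C B ρ) (hF : IsAtomic s 4 a F) (hA : 0 ≤ A)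
    (hlow : ∑' k, lowWeight s k * a k ≤ ENNReal.ofReal A) (hP' : 0 ≤ P') (hγ : 0 ≤ γ)
    (hg : HasSpectrumIn g (latticeCube 0 P')) (hgm : AEStronglyMeasurable g volume)
    (hgb : ∀ x, ‖g x‖ ≤ γ) :
    gmENorm s p q ρ (fun x => g x * (Complex.exp (Complex.I * ∑' k, F k x) - 1)) ≤
      ENNReal.ofReal (C * Real.exp (4 * B) * Real.exp (Real.exp (4 * B) * A) *
        (γ * Real.exp (B * (P' + 1) ^ (1 / s)))) * familyNorm s p q F := by
  have hfn := hF.norm_tsum_le hs hA hlow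
  have hfm := hF.aestronglyMeasurable_tsum hs
  have h1 : (fun x => g x * (Complex.exp (Complex.I * ∑' k, F k x) - 1)) = fun x =>
      ∑' m : ℕ, g x * ((Complex.I * ∑' k, F k x) ^ (m + 1) / (m + 1).factorial) := by
    ext x
    rw [tsum_mul_left]
    have h := (hasSum_nat_add_iff' 1).2 (hasSum_complex_exp (Complex.I * ∑' k, F k x))
    rw [h.tsum_eq]
    simp
  have hM : Summable fun m : ℕ => γ * (A ^ (m + 1) / (m + 1).factorial) :=
    ((summable_nat_add_iff 1).2 (Real.summable_pow_div_factorial A)).mul_left γ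
  rw [h1]
  refine (gmENorm_tsum_le hs hp hq hρ hM (fun m => ?_) fun m x => ?_).trans ?_
  · simp_rw [div_eq_mul_inv]
    exact hgm.mul (((hfm.const_mul _).pow (m + 1)).mul_const _)
  · rw [norm_mul, norm_div, norm_pow, norm_mul, Complex.norm_I, one_mul, Complex.norm_natCast]
    gcongr
    · exact hgb x
    · exact hfn x
  · refine (ENNReal.tsum_le_tsum fun m =>
      gmENorm_mul_pow_le hs hp hq hC hB hCB hF hA hlow hP' hγ hg hgm hgb m).trans (le_of_eq ?_)
    rw [ENNReal.tsum_mul_right]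
    congr 1
    have h2 := (hasSum_real_exp (Real.exp (4 * B) * A)).mul_left
      (C * Real.exp (4 * B) * (γ * Real.exp (B * (P' + 1) ^ (1 / s))))
    rw [← ENNReal.ofReal_tsum_of_nonneg (fun m => by positivity) h2.summable, h2.tsum_eq]
    congr 1
    ring

end

lemma eLpNorm_le_of_norm_le_mul {p c : ℝ} {f : EuclideanSpace ℝ (Fin n) → ℂ}
    {v : EuclideanSpace ℝ (Fin n) → ℝ} (h : ∀ x, ‖f x‖ ≤ c * |v x|) :
    eLpNorm f (ENNReal.ofReal p) volume ≤
      ENNReal.ofReal c * eLpNorm (fun x => (v x : ℂ)) (ENNReal.ofReal p) volume :=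
  eLpNorm_le_mul_eLpNorm_of_ae_le_mul
    (Filter.Eventually.of_forall fun x => by simpa using h x) _

/-- The parameter X is kept apart from N so that the bound stays linear in N: for small N one takes
X = 2, where the exponential is a constant. -/
theorem exists_gmENorm_exp_sub_one_le {p q : ℝ} (hs : 1 < s) (hp : 1 ≤ p) (hq : 1 ≤ q)
    (hρ : GeneratesDecomposition s ρ) :
    ∃ K b : ℝ, 0 < K ∧ 0 < b ∧ ∀ (u : EuclideanSpace ℝ (Fin n) → ℝ) (N X : ℝ), 0 ≤ N → 2 ≤ X →
      N ≤ X → StretchedIntegrable (1 / s) (fun x => (u x : ℂ)) →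
      gmENorm s p q ρ (fun x => (u x : ℂ)) ≤ ENNReal.ofReal N →
      gmENorm s p q ρ (fun x => Complex.exp (Complex.I * (u x : ℂ)) - 1) ≤
        ENNReal.ofReal (K * N * Real.exp (b * X ^ (1 / s) * Real.log X)) := by
  have hs0 : 0 < s := by linarith
  have ha1 : 1 / s < 1 := by rw [div_lt_one hs0]; exact hs
  obtain ⟨C, B, hC, hB, hCB'⟩ := exists_gmENorm_tsum_le hs hρ
  have hCB : ControlsSums s p q C B ρ := hCB' p q hp hq
  obtain ⟨A, hA, hdec⟩ := exists_low_high_decomposition hs hp hq hρ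
  set β : ℝ := (1 - 1 / s) / 2 with hβ
  have hβ0 : 0 < β := by rw [hβ]; linarith
  set A' : ℝ := max A 1
  have hA'1 : 1 ≤ A' := le_max_right _ _
  have hAA' : A ≤ A' := le_max_left _ _
  have hD : 1 ≤ Real.exp 3 * A' + 1 := by
    have : 0 ≤ Real.exp 3 * A' := by positivity
    linarith
  obtain ⟨S, b, hS, hb, hsize⟩ := exists_blockSize_mul_exp_le hs hB.le (inv_nonneg.2 hβ0.le) hD
  set K' : ℝ := C * A + C * Real.exp (4 * B) * Real.exp (Real.exp (4 * B) * A) with hK'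
  have hK'0 : 0 < K' := by positivity
  refine ⟨K' * S * 2, b, by positivity, hb, fun u N X hN hX hNX hu hNu => ?_⟩
  have hlog : 0 ≤ Real.log X := Real.log_nonneg (by linarith)
  -- With this cut-off exp(-β R^(1/s)) = 1/X, so the low-weight size A N / X of the high frequencies
  -- is at most A.
  set R : ℝ := (β⁻¹ * Real.log X) ^ s with hR
  have hR0 : 0 ≤ R := by positivity
  have hRa : R ^ (1 / s) = β⁻¹ * Real.log X := by
    rw [hR, ← Real.rpow_mul (by positivity), mul_one_div_cancel hs0.ne', Real.rpow_one]
  obtain ⟨v, a, F, hvm, hvb, hvs, hvp, hF, hlow, hFn, hdecomp⟩ := hdec u N R hN hR0 hu hNu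
  have hlow' : ∑' k, lowWeight s k * a k ≤ ENNReal.ofReal A := by
    refine hlow.trans (ENNReal.ofReal_le_ofReal ?_)
    rw [hRa, show -β * (β⁻¹ * Real.log X) = -Real.log X by field_simp, Real.exp_neg,
      Real.exp_log (by linarith), ← div_eq_mul_inv, div_le_iff₀ (by linarith)]
    gcongr
  set M : ℝ := A' * X with hM
  have hM1 : 1 ≤ M := by rw [hM]; nlinarith
  have hvM : ∀ x, |v x| ≤ M := fun x => (hvb x).trans (by rw [hM]; gcongr)
  -- From degree e³ M on, the terms are at most e^{-2l}; L remains comparable to X.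
  set L : ℕ := ⌈Real.exp 3 * M⌉₊ with hL
  have hLM : Real.exp 3 * M ≤ L := Nat.le_ceil _
  have hexp3 : 1 ≤ Real.exp 3 := Real.one_le_exp (by norm_num)
  have hXL : X ≤ L := by
    refine le_trans ?_ hLM
    have h1 : X ≤ M := by rw [hM]; nlinarith
    nlinarith
  have hLX : (L : ℝ) ≤ (Real.exp 3 * A' + 1) * X := by
    have := (Nat.ceil_lt_add_one (a := Real.exp 3 * M) (by positivity)).le
    refine this.trans ?_
    rw [hM]; linarith
  have hL1 : 1 ≤ L := by
    have : (1 : ℝ) ≤ L := by linarith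
    exact_mod_cast this
  set E : ℝ := Real.exp (b * X ^ (1 / s) * Real.log X) with hE
  set w : ℕ → ℝ := fun j =>
    blockSize L j * Real.exp (B * (blockDegree L j * (R + 4) + 1) ^ (1 / s)) with hw
  have hw0 : ∀ j, 0 ≤ w j := fun j => mul_nonneg (blockSize_nonneg L j) (Real.exp_pos _).le
  have hwle : ∀ j, w j ≤ S * E * (1 / 2) ^ j := hsize X hX L hXL hLX
  have hP : ∀ j, 0 ≤ blockDegree L j * (R + 4) := fun j => by positivity
  set G := expBlock L v with hG
  have hGm := aestronglyMeasurable_expBlock hvm L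
  have hGs := hasSpectrumIn_expBlock (by positivity : 0 ≤ R + 4) hvm hvM hvs L
  have hGb := norm_expBlock_le hM1 hL1 hLM hvM
  have hGb' := norm_expBlock_sub_le hM1 hL1 hLM hvM
  set δ : ℕ → ℂ := fun j => if j = 0 then 1 else 0 with hδ
  set f : EuclideanSpace ℝ (Fin n) → ℂ := fun x => ∑' k, F k x with hf
  set h : EuclideanSpace ℝ (Fin n) → ℂ := fun x => Complex.exp (Complex.I * f x) - 1 with hh
  have hfm : AEStronglyMeasurable f volume := hF.aestronglyMeasurable_tsum hs
  have hhm : AEStronglyMeasurable h volume :=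
    (Complex.continuous_exp.comp_aestronglyMeasurable (hfm.const_mul _)).sub
      aestronglyMeasurable_const
  have hhb : ∀ x, ‖h x‖ ≤ Real.exp A + 1 := fun x => by
    refine (norm_sub_le _ _).trans ?_
    rw [norm_one]
    gcongr
    refine (Complex.norm_exp_le_exp_norm _).trans (Real.exp_le_exp.2 ?_)
    rw [norm_mul, Complex.norm_I, one_mul]
    exact hF.norm_tsum_le hs hA.le hlow' x
  have hδm : ∀ j, AEStronglyMeasurable (fun x => G j x - δ j) volume := fun j =>
    (hGm j).sub aestronglyMeasurable_const
  have hγsum : Summable (blockSize L) := by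
    refine (summable_nat_add_iff 1).1 ?_
    exact Summable.of_nonneg_of_le (fun j => blockSize_nonneg L _)
      (fun j => exp_neg_two_mul_le hL1 j) (hasSum_geometric_two' 1).summable
  have hδb : ∀ j x, ‖G j x - δ j‖ ≤ blockSize L j * M := fun j x =>
    (hGb' j x).trans (mul_le_mul_of_nonneg_left (hvM x) (blockSize_nonneg L j))
  have hGhb : ∀ j x, ‖G j x * h x‖ ≤ blockSize L j * (Real.exp A + 1) := fun j x => by
    rw [norm_mul]
    exact mul_le_mul (hGb j x) (hhb x) (norm_nonneg _) (blockSize_nonneg L j)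
  -- With h = e^{if} - 1 this is e^{iv} e^{if} - 1 = (e^{iv} - 1) + e^{iv} h, expanded in the blocks
  -- of e^{iv}.
  have hkey : (fun x => Complex.exp (Complex.I * (u x : ℂ)) - 1) =ᵐ[volume]
      fun x => ∑' j, (G j x - δ j + G j x * h x) := by
    filter_upwards [hdecomp] with x hx
    have h1 : HasSum (fun j => G j x) (Complex.exp (Complex.I * v x)) := hasSum_expBlock x
    have h2 : HasSum δ 1 := hasSum_ite_eq 0 1
    rw [((h1.sub h2).add (h1.mul_right (h x))).tsum_eq, hx, mul_add, Complex.exp_add]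
    simp only [hh, hf]
    ring
  rw [gmENorm_congr_ae hkey]
  have hterm : ∀ j, gmENorm s p q ρ (fun x => G j x - δ j + G j x * h x) ≤
      ENNReal.ofReal (K' * N * (S * E) * (1 / 2) ^ j) := fun j => by
    have hsp : HasSpectrumIn (fun x => G j x - δ j)
        (latticeCube 0 (blockDegree L j * (R + 4))) := by
      have h1 : HasSpectrumIn (fun _ => -δ j)
          (latticeCube (0 : Fin n → ℤ) (blockDegree L j * (R + 4))) :=
        (HasSpectrumIn.const (-δ j)).mono (latticeCube_mono 0 (hP j))
      exact (hGs j).add h1 (hGm j) (hGb j) aestronglyMeasurable_const fun _ => le_rfl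
    have h1 : gmENorm s p q ρ (fun x => G j x - δ j) ≤ ENNReal.ofReal (C * A * N * w j) := by
      refine (hsp.gmENorm_le hs hq (hCB _ (hP j)) (hδm j) (hδb j)).trans ?_
      calc _ ≤ ENNReal.ofReal (C * Real.exp (B * (blockDegree L j * (R + 4) + 1) ^ (1 / s))) *
            (ENNReal.ofReal (blockSize L j) * ENNReal.ofReal (A * N)) := by
            gcongr
            exact (eLpNorm_le_of_norm_le_mul (hGb' j)).trans
              (mul_le_mul_right hvp _)
        _ = _ := by
            rw [← ENNReal.ofReal_mul (blockSize_nonneg L j), ← ENNReal.ofReal_mul (by positivity)]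
            congr 1
            simp only [hw]
            ring
    have h2 : gmENorm s p q ρ (fun x => G j x * h x) ≤ ENNReal.ofReal
        (C * Real.exp (4 * B) * Real.exp (Real.exp (4 * B) * A) * N * w j) := by
      refine (gmENorm_mul_exp_sub_one_le hs hp hq hρ hC.le hB.le hCB hF hA.le hlow' (hP j)
        (blockSize_nonneg L j) (hGs j) (hGm j) (hGb j)).trans ((mul_le_mul_right hFn _).trans ?_)
      have h0 := hw0 j
      rw [← ENNReal.ofReal_mul (by positivity)]
      refine le_of_eq ?_
      congr 1
      simp only [hw]
      ring
    refine (gmENorm_add_le hs hp hq hρ (hδm j) ((hGm j).mul hhm) (hδb j) (hGhb j)).trans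
      ((add_le_add h1 h2).trans ?_)
    have h0 := hw0 j
    rw [← ENNReal.ofReal_add (by positivity) (by positivity), ← add_mul, ← add_mul, ← hK',
      mul_assoc _ _ ((1 / 2 : ℝ) ^ j)]
    refine ENNReal.ofReal_le_ofReal ?_
    have := hwle j
    gcongr
  refine (gmENorm_tsum_le hs hp hq hρ ((hγsum.mul_right M).add (hγsum.mul_right (Real.exp A + 1)))
    (fun j => (hδm j).add ((hGm j).mul hhm))
    fun j x => (norm_add_le _ _).trans (add_le_add (hδb j x) (hGhb j x))).trans ?_
  refine (ENNReal.tsum_le_tsum hterm).trans (le_of_eq ?_)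
  have h2 := hasSum_geometric_two.mul_left (K' * N * (S * E))
  rw [← ENNReal.ofReal_tsum_of_nonneg (fun m => by positivity) h2.summable, h2.tsum_eq]
  congr 1
  ring

end GevreyModulation

end

/-! ### Conclusion: the choice of X -/

theorem lemma3p15 (n : ℕ) (s p q : ℝ) (hs : 1 < s) (hp : 1 ≤ p) (hq : 1 ≤ q)
    (ρ : EuclideanSpace ℝ (Fin n) → ℝ) (hρ : GevreyModulation.GeneratesDecomposition s ρ) :
    ∃ b c : ℝ, 0 < b ∧ 0 < c ∧
      ∀ u : EuclideanSpace ℝ (Fin n) → ℝ,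
        GevreyModulation.MemGM s p q ρ (fun x => (u x : ℂ)) →
        GevreyModulation.MemGM s p q ρ (fun x => Complex.exp (Complex.I * (u x : ℂ)) - 1) ∧
        (1 < GevreyModulation.gmNorm s p q ρ (fun x => (u x : ℂ)) →
          GevreyModulation.gmNorm s p q ρ (fun x => Complex.exp (Complex.I * (u x : ℂ)) - 1) ≤
            c * Real.exp (b * GevreyModulation.gmNorm s p q ρ (fun x => (u x : ℂ)) ^ (1 / s) *
              Real.log (GevreyModulation.gmNorm s p q ρ (fun x => (u x : ℂ))))) ∧
        (GevreyModulation.gmNorm s p q ρ (fun x => (u x : ℂ)) ≤ 1 →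
          GevreyModulation.gmNorm s p q ρ (fun x => Complex.exp (Complex.I * (u x : ℂ)) - 1) ≤
            c * GevreyModulation.gmNorm s p q ρ (fun x => (u x : ℂ))) := by
  open GevreyModulation in
  have hs0 : 0 < s := by linarith
  obtain ⟨K, b, hK, hb, hmain⟩ := exists_gmENorm_exp_sub_one_le hs hp hq hρ
  set T : ℝ := Real.exp (b * 2 ^ (1 / s) * Real.log 2)
  have hT : 1 ≤ T := Real.one_le_exp (by positivity)
  -- The extra 1 in b + 1 absorbs the linear factor N when N ≥ 2, and 2T covers N ≤ 2, where X = 2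
  -- is taken.
  refine ⟨b + 1, K * 2 * T, by positivity, by positivity, fun u hu => ?_⟩
  have hui := hu.1.stretchedIntegrable hs hρ
  set N := gmNorm s p q ρ (fun x => (u x : ℂ)) with hN
  have hN0 : 0 ≤ N := ENNReal.toReal_nonneg
  have hNu : gmENorm s p q ρ (fun x => (u x : ℂ)) ≤ ENNReal.ofReal N :=
    (ENNReal.ofReal_toReal hu.2.ne).ge
  have hbound : ∀ X, 2 ≤ X → N ≤ X →
      gmENorm s p q ρ (fun x => Complex.exp (Complex.I * (u x : ℂ)) - 1) ≤
        ENNReal.ofReal (K * N * Real.exp (b * X ^ (1 / s) * Real.log X)) :=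
    fun X hX hNX => hmain u N X hN0 hX hNX hui hNu
  have hnorm : ∀ X, 2 ≤ X → N ≤ X →
      gmNorm s p q ρ (fun x => Complex.exp (Complex.I * (u x : ℂ)) - 1) ≤
        K * N * Real.exp (b * X ^ (1 / s) * Real.log X) := fun X hX hNX =>
    ENNReal.toReal_le_of_le_ofReal (by positivity) (hbound X hX hNX)
  refine ⟨⟨?_, ?_⟩, fun h1 => ?_, fun h1 => ?_⟩
  · refine memGelfandShilovDual_of_bounded (M := 2) ?_ fun x => ?_
    · exact (Complex.continuous_exp.comp_aestronglyMeasurable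
        (hui.aestronglyMeasurable.const_mul _)).sub MeasureTheory.aestronglyMeasurable_const
    · refine (norm_sub_le _ _).trans ?_
      rw [Complex.norm_exp_I_mul_ofReal, norm_one]
      norm_num
  · exact (hbound (max N 2) (le_max_right _ _) (le_max_left _ _)).trans_lt ENNReal.ofReal_lt_top
  · have hlog : 0 ≤ Real.log N := Real.log_nonneg h1.le
    rcases le_total N 2 with h2 | h2
    · refine (hnorm 2 le_rfl h2).trans ?_
      have h3 : 1 ≤ Real.exp ((b + 1) * N ^ (1 / s) * Real.log N) :=
        Real.one_le_exp (by positivity)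
      calc K * N * T ≤ K * 2 * T := by gcongr
        _ ≤ _ := le_mul_of_one_le_right (by positivity) h3
    · refine (hnorm N h2 le_rfl).trans ?_
      have h3 : N ≤ Real.exp (N ^ (1 / s) * Real.log N) := by
        calc N = Real.exp (1 * Real.log N) := by rw [one_mul, Real.exp_log (by linarith)]
          _ ≤ _ := by
            gcongr
            exact Real.one_le_rpow h1.le (by positivity)
      calc K * N * Real.exp (b * N ^ (1 / s) * Real.log N)
          ≤ K * Real.exp (N ^ (1 / s) * Real.log N) *
            Real.exp (b * N ^ (1 / s) * Real.log N) := by gcongr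
        _ = K * 1 * 1 * Real.exp ((b + 1) * N ^ (1 / s) * Real.log N) := by
            rw [mul_assoc, ← Real.exp_add, mul_one, mul_one]
            congr 2
            ring
        _ ≤ _ := by gcongr; norm_num
  · refine (hnorm 2 le_rfl (by linarith)).trans ?_
    calc K * N * T ≤ 2 * (K * N * T) := by
          have : 0 ≤ K * N * T := by positivity
          linarith
      _ = _ := by ring
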